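/- **Setting.** Fix $n,q\ge 1$, $T\ge 0$, and let $L_n$ be the set of ordered pairs (directed case), or of unordered pairs (undirected case), of distinct elements of $V_n=\{1,\dots,n\}$; put $r_n=|L_n|$. On a probability space with a filtration $(\mathcal F_t)_{t\in[0,T]}$ let $(N_u,X_u,C_u)_{u\in L_n}$, together with random functions $d_t:L_n\times L_n\to[0,\infty]$, be a *structured interaction network process*: the $N_u$ are adapted counting processes (unit jumps), almost surely no two of them jump at the same time; $X_u:[0,T]\to\mathbb R^q$, $C_u:[0,T]\to\{0,1\}$ and $t\mapsto d_t(u,v)$ are predictable; for each $t$, $d_t$ is almost surely a metric; $N_u$ has intensity $\lambda_u(t)=C_u(t)\lambda(t,X_u(t))$ for a measurable link function $\lambda:[0,T]\times\mathbb R^q\to[0,\infty)$, i.e. $M_u(t)=N_u(t)-\int_0^t\lambda_u(s)\,ds$ is a martingale; and the law of $(N_u,X_u,C_u)_{u\in L_n}$ is invariant under all permutations of the vertices. Put $p_n(t)=\mathbb P(C_u(t)=1)$, which does not depend on $u$. Let $K:\mathbb R\to[0,\infty)$ be a kernel with $\int K=1$, supported on $[-1,1]$, Hölder continuous and bounded by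 a constant also denoted $K$. Let $t_0\in[0,T]$, $0<h\le 1$, $K_{h,t_0}(s)=\frac1hK\big(\frac{s-t_0}h\big)$ and $\bar p_n(t_0)=\int_0^TK_{h,t_0}(s)p_n(s)\,ds$, and assume $R:=r_n\bar p_n(t_0)>1$. Times outside $[0,T]$ are cut off: $t_0-h$ means $\max(t_0-h,0)$ as a time index, and $[t_0-h,t_0+h]$ means $[t_0-h,t_0+h]\cap[0,T]$. Assume that almost surely, on $[0,T]$, all coordinates of all $X_u$ are bounded in absolute value by $\hat K$, and all $\lambda_u$ by $\Lambda>0$. Let $A>0$ satisfy $$A\ge\max\Big\{\sqrt{\hat K},\ \hat K,\ \tfrac1K,\ \sqrt{2^{3/2}\sqrt\Lambda\,\tfrac{\hat K}{K}}\Big\},\qquad \frac1A\exp\Big(\frac{\sqrt2}{A\sqrt\Lambda}\Big)\le1 .$$ Let $\Delta_n>0$, $\mathcal K\in\mathbb N$, and let $G(k,m)\subseteq L_n$ ($k=1,\dots,\mathcal K$, $m=1,\dots,r_n$) be random sets with indicators $I_u^{k,m}=\mathbb 1(u\in G(k,m))$ such that almost surely they form a $\Delta_n$-partition at time $t_0-h$: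 the sets are pairwise disjoint, and $d_{t_0-h}(u,v)\ge\Delta_n$ whenever $u\in G(k,m)$, $v\in G(k,m')$, $m\ne m'$. Assume that the $I_u^{k,m}$ are $\mathcal F_{t_0-h}$-measurable and that almost surely, for all $u\in L_n$, $$\sum_{k}\sum_{m}I_u^{k,m}=\sup_{r\in[t_0-h,t_0+h]}C_u(r).$$ For $c_3>0$ let $$E_{k,m}=\sum_{u\in L_n}\int_0^TK_{h,t_0}(s)\,\mathbb E\big[I_u^{k,m}C_u(s)\big]ds,\qquad S_k=\max_{m}\sum_{u\in L_n}I_u^{k,m},$$ $$\Gamma=\mathbb 1\Big(\forall k:\ \frac{S_k^2\log R}{R}\le c_3^2,\ S_k\sqrt h\ge1\Big),\qquad \sigma^2=\frac1h\Lambda A^2K\hat K,\qquad c_1=\sqrt{\frac{\Lambda}{2h}}\,K\hat KA,$$ and assume that there is $c_2>0$ with $\frac1R\sum_{m=1}^{r_n}E_{k,m}\ge c_2$ for all $k$. *Mixing coefficient.* For $\sigma$-fields $\mathcal A,\mathcal B$ let $\beta(\mathcal A,\mathcal B)=\sup_{S\in\mathcal A\otimes\mathcal B}|\mathbb P_{\mathcal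 A\otimes\mathcal B}(S)-(\mathbb P_{\mathcal A}\otimes\mathbb P_{\mathcal B})(S)|$, where $\mathbb P_{\mathcal A\otimes\mathcal B}$ is the image of $\mathbb P$ under $\omega\mapsto(\omega,\omega)$ and $\mathbb P_{\mathcal A},\mathbb P_{\mathcal B}$ are the restrictions of $\mathbb P$; for random variables use the generated $\sigma$-fields. For an $\mathbb R^d$-valued integrand $\varphi=(\varphi_u)_{u\in L_n}$ put $Z_u^{(i)}=\Gamma\int_0^TK_{h,t_0}(s)\varphi_u^{(i)}(s)\,dM_u(s)$, $U^{(i)}_{k,m}=\sum_{u\in L_n}\big(Z^{(i)}_uI_u^{k,m}-\mathbb E[Z^{(i)}_uI_u^{k,m}]\big)$ and $$\beta_{t_0}(\Delta_n)=\max_{1\le i\le d}\ \max_{1\le k\le\mathcal K}\ \max_{1\le M\le r_n}\beta\big((U^{(i)}_{k,m})_{m<M},\,U^{(i)}_{k,M}\big).$$ **Lemma.** Let $c^{**}$ be a constant with $\|y\|\le c^{**}\|y\|_1$ for all $y\in\mathbb R^q$ (Euclidean norm and $1$-norm). Then, with $\varphi=X$ in the definition of $\beta_{t_0}(\Delta_n)$,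 for every $x>0$, $$\mathbb P\Big(\frac1R\Big\|\sum_{u\in L_n}\int_0^TK_{h,t_0}(s)X_u(s)\,dM_u(s)\Big\|\ge x\,q\,c^{**}\sqrt{\frac{\log R}{R}}\Big)\le 2q\mathcal K\,R^{-\frac{c_2x^2}{2(\sigma^2+c_1c_3x)}}+2q\,\beta_{t_0}(\Delta_n)\,\mathcal K r_n+2q\,\mathbb P(\Gamma=0).$$ Moreover, $X$ may be replaced in this inequality (and in $\beta_{t_0}(\Delta_n)$) by any predictable process $(\varphi_u)_{u\in L_n}$ with values in some $\mathbb R^d$, $d\ge1$, whose coordinates are almost surely bounded by $\hat K$ on $[0,T]$, with $q$ replaced by $d$ (the intensities remain those of the network). -/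

import Mathlib

open MeasureTheory ProbabilityTheory Filter Topology Set
open scoped NNReal ENNReal

noncomputable section

namespace DynNet

/-! ### Pairs of vertices -/

/-- Whether the pairs of vertices are ordered or unordered. -/
inductive NetworkKind
  | directed
  | undirected

/-- The set `L_n` of pairs of distinct vertices of `{1, …, n}`: ordered pairs for directed
networks, unordered pairs for undirected ones. -/
def Pair : NetworkKind → ℕ → Type
  | .directed, n => {p : Fin n × Fin n // p.1 ≠ p.2}
  | .undirected, n => {e : Sym2 (Fin n) // ¬ e.IsDiag}

instance instFintypePair : (κ : NetworkKind) → (n : ℕ) → Fintype (Pair κ n)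
  | .directed, n => inferInstanceAs (Fintype {p : Fin n × Fin n // p.1 ≠ p.2})
  | .undirected, n => inferInstanceAs (Fintype {e : Sym2 (Fin n) // ¬ e.IsDiag})

/-- `r_n = |L_n|`. -/
def numPairs (κ : NetworkKind) (n : ℕ) : ℕ := Fintype.card (Pair κ n)

/-- The action of a permutation of the vertices on pairs, `(i, j) ↦ (σ i, σ j)`. -/
def relabel {n : ℕ} (σ : Equiv.Perm (Fin n)) : (κ : NetworkKind) → Pair κ n → Pair κ n
  | .directed, p => ⟨(σ p.1.1, σ p.1.2), fun h => p.2 (σ.injective h)⟩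
  | .undirected, e =>
      ⟨Sym2.map σ e.1, fun h => e.2 ((Sym2.isDiag_map σ.injective).1 h)⟩

/-! ### Structured interaction networks

Time is `ℝ≥0` and the observation window is `[0, T]`.  A process (or filtration) on `[0, T]` is
viewed as a process on `ℝ≥0` by keeping it constant after `T`. -/

/-- The processes of an interaction network with `q`-dimensional covariates. -/
structure Network (κ : NetworkKind) (n q : ℕ) (Ω : Type*) [mΩ : MeasurableSpace Ω] where
  /-- the filtration -/
  ℱ : Filtration ℝ≥0 mΩ
  /-- the counting processes -/
  N : Pair κ n → ℝ≥0 → Ω → ℕ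
  /-- the covariates -/
  X : Pair κ n → ℝ≥0 → Ω → EuclideanSpace ℝ (Fin q)
  /-- the activity indicators (adjacency matrix) -/
  C : Pair κ n → ℝ≥0 → Ω → ℝ
  /-- the link function of the intensities -/
  link : ℝ≥0 → EuclideanSpace ℝ (Fin q) → ℝ≥0
  /-- the random distance function -/
  dist : Pair κ n → Pair κ n → ℝ≥0 → Ω → ℝ≥0∞

/-- Paths of counting processes: started at `0`, nondecreasing, right-continuous, and with jumps
of size one. -/
structure IsCountingPath (N : ℝ≥0 → ℕ) : Prop where
  zero : N 0 = 0
  mono : Monotone N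
  rightCts : ∀ t, ContinuousWithinAt N (Ici t) t
  unitJumps : ∀ t, ∀ᶠ s in 𝓝[<] t, N t ≤ N s + 1

/-- The set of jump times in `(0, T]` of a nondecreasing path. -/
def jumpTimes (N : ℝ≥0 → ℕ) (T : ℝ≥0) : Set ℝ≥0 :=
  {t | 0 < t ∧ t ≤ T ∧ ∀ s < t, N s < N t}

namespace Network

variable {κ : NetworkKind} {n q : ℕ} {Ω : Type*} [mΩ : MeasurableSpace Ω]

/-- The intensity `λ_u(t) = C_u(t) λ(t, X_u(t))`. -/
def intensity (D : Network κ n q Ω) (u : Pair κ n) (t : ℝ≥0) (ω : Ω) : ℝ :=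
  D.C u t ω * D.link t (D.X u t ω)

/-- The compensated process `M_u(t) = N_u(t) - ∫_0^t λ_u(s) ds`. -/
def M (D : Network κ n q Ω) (u : Pair κ n) (t : ℝ≥0) (ω : Ω) : ℝ :=
  D.N u t ω - ∫ s in (0 : ℝ)..t, D.intensity u s.toNNReal ω

/-- The integral `∫_0^T φ(s) dM_u(s)` over `(0, T]`.  As `N_u` is a counting process, the
Stieltjes integral with respect to `N_u` is the sum of `φ` over the (finitely many) jump times. -/
def integralM {E : Type*} [NormedAddCommGroup E] [NormedSpace ℝ E] (D : Network κ n q Ω)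
    (T : ℝ≥0) (u : Pair κ n) (φ : ℝ≥0 → Ω → E) (ω : Ω) : E :=
  (∑ᶠ s ∈ jumpTimes (fun t => D.N u t ω) T, φ s ω) -
    ∫ s in (0 : ℝ)..T, D.intensity u s.toNNReal ω • φ s.toNNReal ω

/-- A structured interaction network process on `[0, T]`. -/
structure IsStructured (D : Network κ n q Ω) (μ : Measure Ω) (T : ℝ≥0) : Prop where
  N_path : ∀ u ω, IsCountingPath fun t => D.N u t ω
  N_adapted : ∀ u, Adapted D.ℱ (D.N u)
  /-- the `N_u` form a multivariate counting process: no two of them jump at the same time -/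
  no_common_jumps : ∀ᵐ ω ∂μ, ∀ u v, u ≠ v →
    Disjoint (jumpTimes (fun t => D.N u t ω) T) (jumpTimes (fun t => D.N v t ω) T)
  X_predictable : ∀ u, IsStronglyPredictable D.ℱ (D.X u)
  C_predictable : ∀ u, IsStronglyPredictable D.ℱ (D.C u)
  C_mem : ∀ u t ω, D.C u t ω = 0 ∨ D.C u t ω = 1
  link_measurable : Measurable fun p : ℝ≥0 × EuclideanSpace ℝ (Fin q) => D.link p.1 p.2
  /-- `λ_u` is the intensity of `N_u` on `[0, T]` -/
  M_martingale : ∀ u, Martingale (fun t => D.M u (min t T)) D.ℱ μ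
  /-- joint exchangeability of the array `(N, X, C)` -/
  exchangeable : ∀ σ : Equiv.Perm (Fin n),
    IdentDistrib (fun ω u t => (D.N u t ω, D.X u t ω, D.C u t ω))
      (fun ω u t => (D.N (relabel σ κ u) t ω, D.X (relabel σ κ u) t ω,
        D.C (relabel σ κ u) t ω)) μ μ
  dist_predictable : ∀ u v, IsStronglyPredictable D.ℱ (D.dist u v)
  /-- at each time the distance is almost surely a metric, with values in `[0, ∞]` -/
  dist_metric : ∀ t, ∀ᵐ ω ∂μ,
    (∀ u v, D.dist u v t ω = 0 ↔ u = v) ∧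
    (∀ u v, D.dist u v t ω = D.dist v u t ω) ∧
    (∀ u v w, D.dist u w t ω ≤ D.dist u v t ω + D.dist v w t ω)

/-- The edge probability `p_n(t) = P(C_u(t) = 1)`, written as an average over `u`.  For
structured networks all terms agree, see `IsStructured.edgeProb_eq`. -/
def edgeProb (D : Network κ n q Ω) (μ : Measure Ω) (t : ℝ≥0) : ℝ :=
  (∑ u, μ.real {ω | D.C u t ω = 1}) / numPairs κ n

end Network

lemma exists_relabel_eq {κ : NetworkKind} {n : ℕ} (u v : Pair κ n) :
    ∃ σ : Equiv.Perm (Fin n), relabel σ κ u = v := by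
  have key : ∀ a b c d : Fin n, a ≠ b → c ≠ d → ∃ σ : Equiv.Perm (Fin n), σ a = c ∧ σ b = d := by
    intro a b c d hab hcd
    refine ⟨(Equiv.swap a c).trans (Equiv.swap (Equiv.swap a c b) d), ?_, by simp⟩
    have h1 : Equiv.swap a c b ≠ c := fun h => hab
      ((Equiv.swap a c).injective (by rw [h, Equiv.swap_apply_left]))
    simp [Equiv.swap_apply_of_ne_of_ne h1.symm hcd]
  cases κ with
  | directed =>
    obtain ⟨⟨a, b⟩, hab⟩ := u
    obtain ⟨⟨c, d⟩, hcd⟩ := v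
    obtain ⟨σ, h1, h2⟩ := key a b c d hab hcd
    exact ⟨σ, Subtype.ext (Prod.ext h1 h2)⟩
  | undirected =>
    obtain ⟨e, he⟩ := u
    obtain ⟨f, hf⟩ := v
    induction e with | _ a b
    induction f with | _ c d
    obtain ⟨σ, h1, h2⟩ := key a b c d he hf
    exact ⟨σ, Subtype.ext (by simp [h1, h2, relabel])⟩

lemma Network.IsStructured.edgeProb_eq {κ : NetworkKind} {n q : ℕ} {Ω : Type*}
    [mΩ : MeasurableSpace Ω] {D : Network κ n q Ω} {μ : Measure Ω} {T : ℝ≥0}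
    (hD : D.IsStructured μ T) (u : Pair κ n) (t : ℝ≥0) :
    D.edgeProb μ t = μ.real {ω | D.C u t ω = 1} := by
  have h : ∀ v, μ.real {ω | D.C v t ω = 1} = μ.real {ω | D.C u t ω = 1} := by
    intro v
    obtain ⟨σ, rfl⟩ := exists_relabel_eq u v
    have hm : Measurable fun f : Pair κ n → ℝ≥0 → ℕ × EuclideanSpace ℝ (Fin q) × ℝ =>
        (f u t).2.2 := by fun_prop
    have := ((hD.exchangeable σ).comp hm).measure_mem_eq (measurableSet_singleton (1 : ℝ))
    simp only [measureReal_def]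
    exact congrArg ENNReal.toReal this.symm
  have hne : (numPairs κ n : ℝ) ≠ 0 := by
    have : Nonempty (Pair κ n) := ⟨u⟩
    exact_mod_cast Fintype.card_ne_zero
  rw [Network.edgeProb, Finset.sum_congr rfl fun v _ => h v]
  simp only [Finset.sum_const, Finset.card_univ, nsmul_eq_mul]
  exact mul_div_cancel_left₀ _ hne

/-! ### Partitions and mixing -/

/-- The `β`-mixing coefficient of two sub-σ-algebras,
`sup_{S ∈ 𝒜 ⊗ ℬ} |P_{𝒜 ⊗ ℬ}(S) - (P_𝒜 ⊗ P_ℬ)(S)|`.  Here `P_{𝒜 ⊗ ℬ}` is the image of `P` under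
`ω ↦ (ω, ω)`, and on `𝒜 ⊗ ℬ` the product of the restrictions of `P` is the restriction of
`P ⊗ P`. -/
def betaMixing {Ω : Type*} (𝒜 ℬ : MeasurableSpace Ω) [mΩ : MeasurableSpace Ω] (μ : Measure Ω) :
    ℝ :=
  ⨆ S : {S : Set (Ω × Ω) // MeasurableSet[𝒜.prod ℬ] S},
    |μ.real {ω | (ω, ω) ∈ S.1} - (μ.prod μ).real S.1|

variable {κ : NetworkKind} {n q : ℕ} {Ω : Type*} [mΩ : MeasurableSpace Ω]

/-- A family of random sets of pairs `G(k, m)`, `k = 1, …, 𝒦`, `m = 1, …, r_n`. -/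
abbrev Blocks (κ : NetworkKind) (n 𝒦 : ℕ) (Ω : Type*) : Type _ :=
  Fin 𝒦 → Fin (numPairs κ n) → Ω → Set (Pair κ n)

/-- The `G(k, m)` form, at the outcome `ω`, a `Δ`-partition of the network at time `t`. -/
def IsDeltaPartition {𝒦 : ℕ} (D : Network κ n q Ω) (t : ℝ≥0) (Δ : ℝ) (G : Blocks κ n 𝒦 Ω)
    (ω : Ω) : Prop :=
  (∀ k m k' m', (k, m) ≠ (k', m') → Disjoint (G k m ω) (G k' m' ω)) ∧
  (∀ k m m', m ≠ m' → ∀ u ∈ G k m ω, ∀ v ∈ G k m' ω, ENNReal.ofReal Δ ≤ D.dist u v t ω)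

/-- The indicators `I_u^{k,m} = 1(u ∈ G(k, m))`. -/
def blockInd {𝒦 : ℕ} (G : Blocks κ n 𝒦 Ω) (k : Fin 𝒦) (m : Fin (numPairs κ n)) (u : Pair κ n)
    (ω : Ω) : ℝ :=
  (G k m ω).indicator (fun _ => (1 : ℝ)) u

/-- The centred block sums `U_{k,m} = ∑_u (Z_u I_u^{k,m} - E(Z_u I_u^{k,m}))`. -/
def blockSum {𝒦 : ℕ} (μ : Measure Ω) (G : Blocks κ n 𝒦 Ω) (Z : Pair κ n → Ω → ℝ) (k : Fin 𝒦)
    (m : Fin (numPairs κ n)) (ω : Ω) : ℝ :=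
  ∑ u, (Z u ω * blockInd G k m u ω - ∫ ω', Z u ω' * blockInd G k m u ω' ∂μ)

/-- The `β`-mixing coefficient of the array `Z` along the partition `G`:
`max_{k, M} β((U_{k,m})_{m < M}, U_{k,M})`. -/
def networkBeta {𝒦 : ℕ} (μ : Measure Ω) (G : Blocks κ n 𝒦 Ω) (Z : Pair κ n → Ω → ℝ) : ℝ :=
  ⨆ k : Fin 𝒦, ⨆ M : Fin (numPairs κ n),
    betaMixing (⨆ m, ⨆ (_ : m < M), MeasurableSpace.comap (blockSum μ G Z k m) inferInstance)
      (MeasurableSpace.comap (blockSum μ G Z k M) inferInstance) μ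

/-! ### Kernel smoothing -/

/-- A kernel, a bandwidth and a centre of smoothing, together with the time horizon. -/
structure Smoothing where
  /-- the time horizon -/
  T : ℝ≥0
  /-- the centre of the smoothing window -/
  t₀ : ℝ≥0
  /-- the bandwidth -/
  h : ℝ≥0
  /-- the kernel function -/
  K : ℝ → ℝ

/-- `K` is a kernel (nonnegative with integral one) which is supported on `[-1, 1]`, Hölder
continuous, and bounded by `Kb`. -/
structure IsHolderKernel (K : ℝ → ℝ) (Kb : ℝ) : Prop where
  nonneg : ∀ y, 0 ≤ K y
  support : ∀ y, 1 < |y| → K y = 0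
  integral_eq_one : ∫ y, K y = 1
  holder : ∃ α H : ℝ, 0 < α ∧ ∀ y z, |K y - K z| ≤ H * |y - z| ^ α
  bounded : ∀ y, K y ≤ Kb

namespace Smoothing

/-- `K_{h,t₀}(s) = K((s - t₀) / h) / h`. -/
def Kh (W : Smoothing) (s : ℝ) : ℝ := 1 / (W.h : ℝ) * W.K ((s - W.t₀) / W.h)

/-- The left end of the window `[t₀ - h, t₀ + h] ∩ [0, T]`, that is `max(t₀ - h, 0)`: subtraction
in `ℝ≥0` is truncated at zero. -/
def left (W : Smoothing) : ℝ≥0 := W.t₀ - W.h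

/-- The window `[t₀ - h, t₀ + h] ∩ [0, T]`. -/
def window (W : Smoothing) : Set ℝ≥0 := Icc W.left (min (W.t₀ + W.h) W.T)

/-- `p̄_n(t₀) = ∫_0^T K_{h,t₀}(s) p_n(s) ds`. -/
def pbar (W : Smoothing) (D : Network κ n q Ω) (μ : Measure Ω) : ℝ :=
  ∫ s in (0 : ℝ)..W.T, W.Kh s * D.edgeProb μ s.toNNReal

/-- The normalisation `r_n p̄_n(t₀)`. -/
def R (W : Smoothing) (D : Network κ n q Ω) (μ : Measure Ω) : ℝ := numPairs κ n * W.pbar D μ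

/-- `E_{k,m} = ∑_u ∫_0^T K_{h,t₀}(s) E(I_u^{k,m} C_u(s)) ds`. -/
def Ekm {𝒦 : ℕ} (W : Smoothing) (D : Network κ n q Ω) (μ : Measure Ω) (G : Blocks κ n 𝒦 Ω)
    (k : Fin 𝒦) (m : Fin (numPairs κ n)) : ℝ :=
  ∑ u, ∫ s in (0 : ℝ)..W.T, W.Kh s * ∫ ω, blockInd G k m u ω * D.C u s.toNNReal ω ∂μ

/-- `S_k = max_m ∑_u I_u^{k,m}`, the size of the largest block of type `k`. -/
def S {𝒦 : ℕ} (G : Blocks κ n 𝒦 Ω) (k : Fin 𝒦) (ω : Ω) : ℝ :=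
  ⨆ m : Fin (numPairs κ n), ∑ u, blockInd G k m u ω

/-- The event `Γ = 1`. -/
def goodEvent {𝒦 : ℕ} (W : Smoothing) (D : Network κ n q Ω) (μ : Measure Ω)
    (G : Blocks κ n 𝒦 Ω) (c₃ : ℝ) : Set Ω :=
  {ω | ∀ k, S G k ω ^ 2 * Real.log (W.R D μ) / W.R D μ ≤ c₃ ^ 2 ∧ 1 ≤ S G k ω * √(W.h : ℝ)}

/-- `∫_0^T K_{h,t₀}(s) φ_u(s) dM_u(s)`. -/
def smoothInt {E : Type*} [NormedAddCommGroup E] [NormedSpace ℝ E] (W : Smoothing)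
    (D : Network κ n q Ω) (φ : Pair κ n → ℝ≥0 → Ω → E) (u : Pair κ n) (ω : Ω) : E :=
  D.integralM W.T u (fun s ω => W.Kh s • φ u s ω) ω

/-- The mixing coefficient `β_{t₀}` of the array `Γ ∫_0^T K_{h,t₀}(s) φ_u^{(i)}(s) dM_u(s)`,
maximised over the coordinates `i` of the integrand. -/
def beta {𝒦 d : ℕ} (W : Smoothing) (D : Network κ n q Ω) (μ : Measure Ω) (G : Blocks κ n 𝒦 Ω)
    (c₃ : ℝ) (φ : Pair κ n → ℝ≥0 → Ω → EuclideanSpace ℝ (Fin d)) : ℝ :=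
  ⨆ i : Fin d, networkBeta μ G fun u =>
    (W.goodEvent D μ G c₃).indicator (W.smoothInt D (fun u s ω => φ u s ω i) u)

/-- The exponential inequality for the integrand `φ`, with constants `σ² = sigmaSq`, `c₁`, `c₂`,
`c₃`, for every `x > 0`; here `cs` is any constant with `‖y‖ ≤ cs ‖y‖₁` for all `y`. -/
def ExpInequality {𝒦 d : ℕ} (W : Smoothing) (D : Network κ n q Ω) (μ : Measure Ω)
    (G : Blocks κ n 𝒦 Ω) (sigmaSq c₁ c₂ c₃ : ℝ)
    (φ : Pair κ n → ℝ≥0 → Ω → EuclideanSpace ℝ (Fin d)) : Prop :=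
  ∀ cs : ℝ, (∀ y : EuclideanSpace ℝ (Fin d), ‖y‖ ≤ cs * ∑ i, |y i|) → ∀ x : ℝ, 0 < x →
    μ.real {ω | x * d * cs * √(Real.log (W.R D μ) / W.R D μ) ≤
        1 / W.R D μ * ‖∑ u, W.smoothInt D φ u ω‖}
      ≤ 2 * d * 𝒦 * W.R D μ ^ (-(c₂ * x ^ 2 / (2 * (sigmaSq + c₁ * c₃ * x))))
        + 2 * d * W.beta D μ G c₃ φ * (𝒦 * numPairs κ n)
        + 2 * d * μ.real (W.goodEvent D μ G c₃)ᶜ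

end Smoothing

end DynNet

end

/-! The sum over all pairs is cut into block sums, each block sum gets a Bernstein-type exponential
moment from martingale theory, and `β`-mixing allows the blocks of one type to be treated as
independent.

Blocks as martingale integrals. `Γ` and the indicators `I_u^{k,m}` are known at the left end of the
window, and the kernel only matters after it. Hence `Γ I_u^{k,m} K_{h,t₀} φ_u` agrees, at positive
times, with a predictable integrand. So `U_{k,m}` is almost surely a martingale integral, and the
centring terms vanish (`blockSum_eq`). On `Γ` the block sums add up to the whole sum, because a pair
outside all blocks is inactive throughout the window and its integral is zero
(`ae_smoothInt_eq_zero`).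

Exponential moment of one block. For bounded predictable `f` the product formula
`exp_integral_jumpMeasure` writes the exponential of `∑_u ∫ f_u dN_u - ∫ ∑_u (exp f_u - 1) λ_u ds`
as `1` plus compensated integrals, so its mean is at most `1` (`lintegral_exp_le_one`). Take `f = (1
+ τ) θ w k φ`, where `w` is the weight `Γ I`, `k` the kernel and `τ = |θ| c₁ B`, with `B` a bound
for the block sizes on `Γ`. The second-order compensator is at most a constant times the
kernel-weighted active mass `W` of the block, which satisfies `0 ≤ W ≤ B` and has mean at most
`E_{k,m}`. Hölder's inequality with exponent `1 + τ` separates the martingale from `W`, and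
convexity bounds the exponential moment of `W` by its mean (`lintegral_exp_le_of_compensator`). The
conditions on `A` are what compresses the outcome into `exp(θ² σ² E_{k,m} / (2 (1 - τ)))` for `τ ≤
1/2` (`holder_constant_le`, `holder_bound_le_exp`).

Dependence. Decoupling the blocks of one type one after the other changes the law of their sum by at
most `r_n β` (`abs_sub_convLaw_le`). A Chernoff bound for the convolution then gives Bernstein's
inequality (`measureReal_abs_sum_ge_le`).

Assembly. Type `k` receives the threshold `x √(log R / R) ∑_m E_{k,m}`. Since `∑_k ∑_m E_{k,m} = R`
(`sum_Ekm`), these thresholds add up to exactly the required one. With `B = c₃ √(R / log R)` the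
Bernstein exponent becomes a multiple of `log R`, that is, a power of `R`. A union bound over
coordinates and types, plus `P(Γ = 0)`, concludes. -/

noncomputable section

namespace DynNet

/-! ### Jumps of counting paths -/

namespace IsCountingPath

variable {N : ℝ≥0 → ℕ}

/-- The first time at which a level `k ≥ 1` is reached is a jump time with value exactly `k`:
right-continuity makes the infimum attained, and unit jumps exclude overshooting. This is what
identifies the number of jump times with the value of the path. -/
lemma image_jumpTimes (h : IsCountingPath N) (t : ℝ≥0) : N '' jumpTimes N t = Icc 1 (N t) := by
  ext k
  constructor
  · rintro ⟨s, ⟨hs0, hst, hs⟩, rfl⟩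
    have := hs 0 hs0
    exact ⟨by omega, h.mono hst⟩
  · rintro ⟨hk1, hk⟩
    set A : Set ℝ≥0 := {r | k ≤ N r}
    have hA : t ∈ A := hk
    set s := sInf A
    have hst : s ≤ t := csInf_le (OrderBot.bddBelow A) hA
    have hlt : ∀ r < s, N r < k := fun r hr => not_le.1 fun hc =>
      (notMem_of_lt_csInf hr (OrderBot.bddBelow A)) hc
    -- In the discrete space `ℕ`, right-continuity means being constant on some `[s, u)`, and that
    -- interval meets the superlevel set.
    have hge : k ≤ N s := by
      have h1 : ∀ᶠ r in 𝓝[≥] s, N r = N s := by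
        have := h.rightCts s
        rw [ContinuousWithinAt, nhds_discrete, tendsto_pure] at this
        exact this
      obtain ⟨u, hu, hu'⟩ := mem_nhdsGE_iff_exists_Ico_subset' (lt_add_one s) |>.1 h1
      obtain ⟨r, hrA, hru⟩ := exists_lt_of_csInf_lt ⟨t, hA⟩ hu
      have : N r = N s := hu' ⟨csInf_le (OrderBot.bddBelow A) hrA, hru⟩
      exact this ▸ hrA
    have hs0 : 0 < s := by
      rcases eq_or_ne s 0 with h0 | h0
      · rw [h0, h.zero] at hge; omega
      · exact pos_iff_ne_zero.2 h0
    have : (𝓝[<] s).NeBot := nhdsLT_neBot_of_exists_lt ⟨0, hs0⟩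
    obtain ⟨r, hr1, hr2⟩ := ((h.unitJumps s).and self_mem_nhdsWithin).exists
    have := hlt r hr2
    exact ⟨s, ⟨hs0, hst, fun r hr => (hlt r hr).trans_le hge⟩, by omega⟩

lemma encard_jumpTimes (h : IsCountingPath N) (t : ℝ≥0) : (jumpTimes N t).encard = N t := by
  have hinj : InjOn N (jumpTimes N t) := by
    intro a ha b hb hab
    rcases lt_trichotomy a b with hl | hl | hl
    · exact absurd hab (hb.2.2 a hl).ne
    · exact hl
    · exact absurd hab (ha.2.2 b hl).ne'
  rw [← hinj.encard_image, h.image_jumpTimes]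
  rw [← Finset.coe_Icc, Set.encard_coe_eq_coe_finsetCard]
  simp

lemma finite_jumpTimes (h : IsCountingPath N) (t : ℝ≥0) : (jumpTimes N t).Finite := by
  rw [← Set.encard_lt_top_iff, h.encard_jumpTimes]
  exact ENat.natCast_lt_top _

end IsCountingPath

lemma jumpTimes_inter_Iic (N : ℝ≥0 → ℕ) (T t : ℝ≥0) :
    jumpTimes N T ∩ Iic t = jumpTimes N (min t T) := by
  ext s
  simp only [jumpTimes, mem_inter_iff, mem_ofPred_eq, mem_Iic, le_min_iff]
  tauto

/-- The counting measure of the jump times in `(0, T]`. -/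
def jumpMeasure (N : ℝ≥0 → ℕ) (T : ℝ≥0) : Measure ℝ≥0 :=
  ∑ᶠ s ∈ jumpTimes N T, Measure.dirac s

namespace IsCountingPath

variable {N : ℝ≥0 → ℕ}

lemma jumpMeasure_eq (h : IsCountingPath N) (T : ℝ≥0) :
    jumpMeasure N T = ∑ s ∈ (h.finite_jumpTimes T).toFinset, Measure.dirac s :=
  finsum_mem_eq_finite_toFinset_sum _ _

lemma integral_jumpMeasure {E : Type*} [NormedAddCommGroup E] [NormedSpace ℝ E] [CompleteSpace E]
    (h : IsCountingPath N) (T : ℝ≥0) (f : ℝ≥0 → E) :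
    ∫ s, f s ∂jumpMeasure N T = ∑ᶠ s ∈ jumpTimes N T, f s := by
  rw [h.jumpMeasure_eq, integral_finsetSum_measure fun i _ => integrable_dirac (by simp),
    finsum_mem_eq_finite_toFinset_sum _ (h.finite_jumpTimes T)]
  simp

lemma lintegral_jumpMeasure (h : IsCountingPath N) (T : ℝ≥0) (f : ℝ≥0 → ℝ≥0∞) :
    ∫⁻ s, f s ∂jumpMeasure N T = ∑ s ∈ (h.finite_jumpTimes T).toFinset, f s := by
  rw [h.jumpMeasure_eq, lintegral_finsetSum_measure]
  simp

lemma jumpMeasure_apply (h : IsCountingPath N) (T : ℝ≥0) (A : Set ℝ≥0) :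
    jumpMeasure N T A = (jumpTimes N T ∩ A).encard := by
  classical
  have hf := h.finite_jumpTimes T
  rw [h.jumpMeasure_eq, Measure.finsetSum_apply]
  simp only [Measure.dirac_apply, Set.indicator_apply, Pi.one_apply]
  rw [Finset.sum_ite, Finset.sum_const_zero, add_zero, Finset.sum_const, nsmul_one]
  have : jumpTimes N T ∩ A = ((hf.toFinset.filter (· ∈ A) : Finset ℝ≥0) : Set ℝ≥0) := by
    ext; simp
  rw [this, Set.encard_coe_eq_coe_finsetCard]
  simp

lemma jumpMeasure_Iic (h : IsCountingPath N) (T t : ℝ≥0) :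
    jumpMeasure N T (Iic t) = N (min t T) := by
  rw [h.jumpMeasure_apply, jumpTimes_inter_Iic, h.encard_jumpTimes]
  simp

lemma jumpMeasure_univ (h : IsCountingPath N) (T : ℝ≥0) : jumpMeasure N T univ = N T := by
  rw [h.jumpMeasure_apply, inter_univ, h.encard_jumpTimes]
  simp

lemma isFiniteMeasure_jumpMeasure (h : IsCountingPath N) (T : ℝ≥0) :
    IsFiniteMeasure (jumpMeasure N T) :=
  ⟨by rw [h.jumpMeasure_univ]; exact ENNReal.natCast_lt_top _⟩

lemma jumpMeasure_Ioc (h : IsCountingPath N) (T a b : ℝ≥0) :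
    jumpMeasure N T (Ioc a b) = (N (min b T) - N (min a T) : ℕ) := by
  have := h.isFiniteMeasure_jumpMeasure T
  rcases le_total a b with hab | hab
  · rw [← Iic_sdiff_Iic, measure_sdiff (Iic_subset_Iic.2 hab) (by measurability) (measure_ne_top _ _),
      h.jumpMeasure_Iic, h.jumpMeasure_Iic]
    simp
  · rw [Ioc_eq_empty (not_lt.2 hab), measure_empty,
      Nat.sub_eq_zero_of_le (h.mono (min_le_min_right T hab))]
    simp

lemma jumpMeasure_zero (h : IsCountingPath N) (T : ℝ≥0) : jumpMeasure N T {0} = 0 := by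
  rw [h.jumpMeasure_apply]
  have : jumpTimes N T ∩ {0} = ∅ := by
    ext s; simp only [jumpTimes, mem_inter_iff, mem_ofPred_eq, mem_singleton_iff, mem_empty_iff_false,
      iff_false]
    rintro ⟨⟨h0, -⟩, rfl⟩; exact h0.false
  simp [this]

end IsCountingPath

/-- Lebesgue measure on `(0, T]`, as a measure on `ℝ≥0`. -/
def lebesgueUpTo (T : ℝ≥0) : Measure ℝ≥0 :=
  (volume.restrict (Ioc (0 : ℝ) T)).map Real.toNNReal

instance (T : ℝ≥0) : IsFiniteMeasure (lebesgueUpTo T) := by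
  unfold lebesgueUpTo; infer_instance

lemma lebesgueUpTo_univ (T : ℝ≥0) : lebesgueUpTo T univ = T := by
  rw [lebesgueUpTo, Measure.map_apply measurable_real_toNNReal MeasurableSet.univ]
  simp

lemma lebesgueUpTo_zero (T : ℝ≥0) : lebesgueUpTo T {0} = 0 := by
  rw [lebesgueUpTo, Measure.map_apply measurable_real_toNNReal (measurableSet_singleton _),
    Measure.restrict_apply (measurable_real_toNNReal (measurableSet_singleton _))]
  convert! measure_empty (μ := (volume : Measure ℝ))
  ext x
  simp only [mem_inter_iff, mem_preimage, mem_singleton_iff, Real.toNNReal_eq_zero, mem_Ioc,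
    mem_empty_iff_false, iff_false]
  intro h; linarith [h.1, h.2.1]

lemma integral_lebesgueUpTo {E : Type*} [NormedAddCommGroup E] [NormedSpace ℝ E] (T : ℝ≥0)
    {f : ℝ≥0 → E} (hf : StronglyMeasurable f) :
    ∫ s, f s ∂lebesgueUpTo T = ∫ s in (0 : ℝ)..T, f s.toNNReal := by
  rw [intervalIntegral.integral_of_le T.coe_nonneg, lebesgueUpTo,
    integral_map measurable_real_toNNReal.aemeasurable hf.aestronglyMeasurable]

lemma ae_lebesgueUpTo_le (T : ℝ≥0) : ∀ᵐ s ∂lebesgueUpTo T, 0 < s ∧ s ≤ T := by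
  rw [lebesgueUpTo, ae_map_iff measurable_real_toNNReal.aemeasurable
    (measurableSet_Ioc : MeasurableSet (Ioc (0 : ℝ≥0) T))]
  filter_upwards [ae_restrict_mem measurableSet_Ioc] with s hs
  exact ⟨Real.toNNReal_pos.2 hs.1, Real.toNNReal_le_iff_le_coe.2 hs.2⟩

lemma restrict_lebesgueUpTo_Iic (t T : ℝ≥0) :
    (lebesgueUpTo T).restrict (Iic t) = lebesgueUpTo (min t T) := by
  rw [lebesgueUpTo, Measure.restrict_map measurable_real_toNNReal measurableSet_Iic,
    Measure.restrict_restrict (measurable_real_toNNReal measurableSet_Iic), lebesgueUpTo]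
  congr 2
  ext x
  simp only [mem_inter_iff, mem_preimage, mem_Iic, mem_Ioc, Real.toNNReal_le_iff_le_coe,
    NNReal.coe_min, le_min_iff]
  tauto

end DynNet

namespace DynNet

variable {Ω : Type*} [mΩ : MeasurableSpace Ω]

/-! ### Predictable integrands -/

lemma predictable_le (ℱ : Filtration ℝ≥0 mΩ) : ℱ.predictable ≤ Prod.instMeasurableSpace :=
  measurableSpace_le_predictable_of_measurableSet
    (fun _ hA => (measurableSet_singleton _).prod (ℱ.le _ _ hA))
    (fun _ _ hA => measurableSet_Ioi.prod (ℱ.le _ _ hA))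

/-- The rectangles which generate the predictable σ-algebra. -/
def predictableRectangles (ℱ : Filtration ℝ≥0 mΩ) : Set (Set (ℝ≥0 × Ω)) :=
  {s | ∃ A, MeasurableSet[ℱ ⊥] A ∧ s = {⊥} ×ˢ A} ∪
    {s | ∃ i A, MeasurableSet[ℱ i] A ∧ s = Ioi i ×ˢ A}

lemma isPiSystem_predictableRectangles (ℱ : Filtration ℝ≥0 mΩ) :
    IsPiSystem (predictableRectangles ℱ) := by
  rintro _ (⟨A, hA, rfl⟩ | ⟨i, A, hA, rfl⟩) _ (⟨B, hB, rfl⟩ | ⟨j, B, hB, rfl⟩) hne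
  · exact Or.inl ⟨A ∩ B, hA.inter hB, by rw [Set.prod_inter_prod, inter_self]⟩
  · obtain ⟨x, hx1, hx2⟩ := hne
    have h1 : x.1 = 0 := hx1.1
    have h2 : j < x.1 := hx2.1
    simp [h1] at h2
  · obtain ⟨x, hx1, hx2⟩ := hne
    have h1 : x.1 = 0 := hx2.1
    have h2 : i < x.1 := hx1.1
    simp [h1] at h2
  · exact Or.inr ⟨max i j, A ∩ B, (ℱ.mono (le_max_left _ _) _ hA).inter
      (ℱ.mono (le_max_right _ _) _ hB), by rw [Set.prod_inter_prod, Ioi_inter_Ioi]⟩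

/-- A random measure on the time axis which is adapted and does not charge `0`. -/
structure IsAdaptedMeasure (ℱ : Filtration ℝ≥0 mΩ) (ν : Ω → Measure ℝ≥0) : Prop where
  finite : ∀ ω, IsFiniteMeasure (ν ω)
  zero : ∀ ω, ν ω {0} = 0
  adapted : ∀ a b, Measurable[ℱ b] fun ω => ν ω (Ioc a b)

/-- The interval is open on the right, so `s ↦ ν (i, s)` is left-continuous and hence predictable:
it is the supremum over rational `q < s` of `ν (i, q]`, which is known at time `q` and switched on
only after `q`. -/
lemma IsAdaptedMeasure.measurable_apply_Ioo {ℱ : Filtration ℝ≥0 mΩ} {ν : Ω → Measure ℝ≥0}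
    (hν : IsAdaptedMeasure ℱ ν) (i : ℝ≥0) {A : Set Ω} (hA : MeasurableSet[ℱ i] A) :
    Measurable[ℱ.predictable] fun p : ℝ≥0 × Ω => A.indicator (fun ω => ν ω (Ioo i p.1)) p.2 := by
  have key : (fun p : ℝ≥0 × Ω => A.indicator (fun ω => ν ω (Ioo i p.1)) p.2) = fun p =>
      ⨆ q : {q : ℚ // (i : ℝ) < q}, (Ioi (q : ℝ).toNNReal ×ˢ univ).indicator (fun p : ℝ≥0 × Ω =>
        (Ioi i ×ˢ A).indicator (fun p => ν p.2 (Ioc i (q : ℝ).toNNReal)) p) p := by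
    ext ⟨s, ω⟩
    by_cases hω : ω ∈ A
    swap
    · simp [hω, Set.indicator]
    rw [indicator_of_mem hω]
    have : Ioo i s = ⋃ q : {q : ℚ // (i : ℝ) < q ∧ (q : ℝ).toNNReal < s}, Ioc i (q : ℝ).toNNReal := by
      ext r
      simp only [mem_Ioo, mem_iUnion, mem_Ioc, Subtype.exists, exists_and_left, exists_prop]
      constructor
      · rintro ⟨h1, h2⟩
        obtain ⟨q, hq1, hq2⟩ := exists_rat_btwn (NNReal.coe_lt_coe.2 h2)
        have h0 : (0 : ℝ) ≤ q := r.coe_nonneg.trans hq1.le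
        refine ⟨h1, q, ⟨(NNReal.coe_lt_coe.2 h1).trans hq1, ?_⟩, ?_⟩
        · rw [← NNReal.coe_lt_coe, Real.coe_toNNReal _ h0]; exact hq2
        · rw [← NNReal.coe_le_coe, Real.coe_toNNReal _ h0]; exact hq1.le
      · rintro ⟨h1, q, ⟨-, h2⟩, h3⟩
        exact ⟨h1, h3.trans_lt h2⟩
    show ν ω (Ioo i s) = _
    rw [this, (directed_of_isDirected_le ?_).measure_iUnion]
    · apply le_antisymm
      · refine iSup_le fun q => ?_
        refine le_iSup_of_le ⟨q.1, q.2.1⟩ ?_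
        have h2 : (s, ω) ∈ Ioi ((q : ℚ) : ℝ).toNNReal ×ˢ (univ : Set Ω) := ⟨q.2.2, mem_univ _⟩
        have h3 : (s, ω) ∈ Ioi i ×ˢ A := by
          refine ⟨lt_of_le_of_lt ?_ q.2.2, hω⟩
          rw [← NNReal.coe_le_coe]
          exact q.2.1.le.trans (Real.le_coe_toNNReal _)
        rw [indicator_of_mem h2, indicator_of_mem h3]
      · refine iSup_le fun q => ?_
        by_cases h2 : (s, ω) ∈ (Ioi ((q : ℚ) : ℝ).toNNReal ×ˢ (univ : Set Ω))
        · rw [indicator_of_mem h2]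
          refine (indicator_le_self' (by simp) _).trans ?_
          exact le_iSup_of_le ⟨q.1, q.2, h2.1⟩ le_rfl
        · rw [indicator_of_notMem h2]; exact zero_le
    · intro q q' h
      exact Ioc_subset_Ioc_right (Real.toNNReal_le_toNNReal (Rat.cast_le.2 h))
  rw [key]
  refine Measurable.iSup fun q => ?_
  have hq : i ≤ (q : ℝ).toNNReal := by
    rw [← NNReal.coe_le_coe]
    exact q.2.le.trans (Real.le_coe_toNNReal _)
  refine measurable_of_Ioi fun c => ?_
  set B : Set Ω := A ∩ {ω | c < ν ω (Ioc i (q : ℝ).toNNReal)}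
  have hB : MeasurableSet[ℱ (q : ℝ).toNNReal] B :=
    (ℱ.mono hq _ hA).inter (hν.adapted i _ measurableSet_Ioi)
  convert! measurableSet_predictable_Ioi_prod (𝓕 := ℱ) hB using 1
  ext ⟨s, ω⟩
  simp only [mem_preimage, mem_Ioi, Set.indicator, mem_prod, mem_univ, and_true, B, mem_inter_iff,
    mem_ofPred_eq]
  by_cases h1 : (q : ℝ).toNNReal < s <;> by_cases h2 : ω ∈ A <;> simp [h1, h2, hq.trans_lt]

/-- Integrals over `[0, s)` do not look at time `s`, so they stay predictable. The proof is a π-λ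
argument on the predictable rectangles followed by monotone approximation; the rectangles `{0} × A`
contribute nothing since `ν` does not charge `0`. -/
lemma IsAdaptedMeasure.measurable_lintegral_Iio {ℱ : Filtration ℝ≥0 mΩ} {ν : Ω → Measure ℝ≥0}
    (hν : IsAdaptedMeasure ℱ ν) {f : ℝ≥0 × Ω → ℝ≥0∞} (hf : Measurable[ℱ.predictable] f) :
    Measurable[ℱ.predictable] fun p : ℝ≥0 × Ω => ∫⁻ r in Iio p.1, f (r, p.2) ∂ν p.2 := by
  have hfin := hν.finite
  have hsec : ∀ ω : Ω, @Measurable _ _ _ ℱ.predictable fun r : ℝ≥0 => (r, ω) := fun ω =>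
    (measurable_prodMk_right).mono le_rfl (predictable_le ℱ)
  have hsecS : ∀ (ω : Ω) {P}, MeasurableSet[ℱ.predictable] P →
      MeasurableSet {r : ℝ≥0 | (r, ω) ∈ P} := fun ω P hP => hsec ω hP
  have hind : ∀ P, MeasurableSet[ℱ.predictable] P → Measurable[ℱ.predictable]
      fun p : ℝ≥0 × Ω => ν p.2 ({r | (r, p.2) ∈ P} ∩ Iio p.1) := by
    have hrect : ∀ P ∈ predictableRectangles ℱ, Measurable[ℱ.predictable]
      fun p : ℝ≥0 × Ω => ν p.2 ({r | (r, p.2) ∈ P} ∩ Iio p.1) := by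
      rintro _ (⟨A, hA, rfl⟩ | ⟨i, A, hA, rfl⟩)
      · convert! @measurable_const _ _ _ ℱ.predictable (0 : ℝ≥0∞) using 1
        ext p
        refine measure_mono_null ?_ (hν.zero p.2)
        rintro r ⟨hr, -⟩
        exact hr.1
      · convert! hν.measurable_apply_Ioo i hA using 1
        ext p
        by_cases hp : p.2 ∈ A
        · rw [indicator_of_mem hp]
          congr 1
          ext r; simp [hp]
        · rw [indicator_of_notMem hp]
          convert! measure_empty (μ := ν p.2)
          ext r; simp [hp]
    -- The whole space is not a rectangle but the union of two; this case is needed for complements.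
    have huniv : Measurable[ℱ.predictable] fun p : ℝ≥0 × Ω => ν p.2 (Iio p.1) := by
      have h1 := hrect _ (Or.inl ⟨univ, MeasurableSet.univ, rfl⟩)
      have h2 := hrect _ (Or.inr ⟨0, univ, MeasurableSet.univ, rfl⟩)
      convert! h1.add h2 using 1
      ext p
      rw [Pi.add_apply, ← measure_union _ ((hsecS _ (measurableSet_predictable_Ioi_prod
        MeasurableSet.univ)).inter measurableSet_Iio)]
      · congr 1
        ext r
        simp only [mem_Iio, mem_union, mem_inter_iff, mem_ofPred_eq, mem_prod, mem_univ, and_true,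
          mem_singleton_iff, mem_Ioi]
        have := eq_or_ne r 0 |>.imp id pos_iff_ne_zero.2
        have h0 : (⊥ : ℝ≥0) = 0 := rfl
        rw [h0]; tauto
      · rw [Set.disjoint_left]
        rintro r ⟨hr, -⟩ ⟨hr', -⟩
        have h1 : r = 0 := hr.1
        have h2 : 0 < r := hr'.1
        exact h2.ne' h1
    intro P hP
    induction P, hP using MeasurableSpace.induction_on_inter (m := ℱ.predictable) rfl
      (isPiSystem_predictableRectangles ℱ) with
    | empty => simp
    | basic P hP => exact hrect P hP
    | compl P hP ih =>
      convert! huniv.sub ih using 1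
      ext p
      rw [Pi.sub_apply, ← measure_sdiff inter_subset_right
        ((hsecS _ hP).inter measurableSet_Iio).nullMeasurableSet (measure_ne_top _ _)]
      congr 1
      ext r; simp; tauto
    | iUnion g hd hm ih =>
      have : (fun p : ℝ≥0 × Ω => ν p.2 ({r | (r, p.2) ∈ ⋃ i, g i} ∩ Iio p.1)) =
          fun p => ∑' i, ν p.2 ({r | (r, p.2) ∈ g i} ∩ Iio p.1) := by
        ext p
        rw [← measure_iUnion _ fun i => (hsecS _ (hm i)).inter measurableSet_Iio]
        · congr 1
          ext r; simp
        · intro i j hij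
          rw [Function.onFun, Set.disjoint_left]
          rintro r ⟨hr, -⟩ ⟨hr', -⟩
          exact Set.disjoint_left.1 (hd hij) hr hr'
      rw [this]
      exact @Measurable.ennreal_tsum _ ℱ.predictable _ _ _ ih
  refine @Measurable.ennreal_induction _ ℱ.predictable (fun f => Measurable[ℱ.predictable]
    fun p : ℝ≥0 × Ω => ∫⁻ r in Iio p.1, f (r, p.2) ∂ν p.2) ?_ ?_ ?_ f hf
  · intro c P hP
    convert! (hind P hP).const_mul c using 1
    ext p
    have : (fun r => P.indicator (fun _ => c) (r, p.2)) =
        {r | (r, p.2) ∈ P}.indicator fun _ => c := rfl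
    rw [this, lintegral_indicator_const (hsecS _ hP), Measure.restrict_apply (hsecS _ hP)]
  · intro f g _ hf _ hf' hg'
    convert! hf'.add hg' using 1
    ext p
    exact lintegral_add_left (hf.comp (hsec p.2)) _
  · intro f hf hmono hf'
    convert! Measurable.iSup hf' using 1
    ext p
    exact lintegral_iSup (fun n => (hf n).comp (hsec p.2)) fun a b hab r => hmono hab _

end DynNet

namespace DynNet

variable {Ω : Type*} [mΩ : MeasurableSpace Ω]

/-! ### The compensator of a counting process -/

lemma measurable_jumpMeasure {N : ℝ≥0 → Ω → ℕ} (hN : ∀ ω, IsCountingPath fun t => N t ω)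
    (hm : ∀ t, Measurable (N t)) (T : ℝ≥0) : Measurable fun ω => jumpMeasure (fun t => N t ω) T := by
  have := fun ω => (hN ω).isFiniteMeasure_jumpMeasure T
  refine .measure_of_isPiSystem (borel_eq_generateFrom_Iic ℝ≥0 ▸ BorelSpace.measurable_eq)
    isPiSystem_Iic ?_ ?_
  · rintro _ ⟨t, rfl⟩
    simp only [(hN _).jumpMeasure_Iic]
    exact measurable_from_top.comp (hm _)
  · simp only [(hN _).jumpMeasure_univ]
    exact measurable_from_top.comp (hm _)

/-- The total masses need not be uniformly bounded, so the parameter space is split according to the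
integer part of the mass; each piece is a finite kernel. -/
lemma isSFiniteKernel_of_isFiniteMeasure {α β : Type*} [MeasurableSpace α] [MeasurableSpace β]
    (κ : Kernel α β) (h : ∀ a, IsFiniteMeasure (κ a)) : IsSFiniteKernel κ := by
  have hA : ∀ n : ℕ, MeasurableSet {a | ⌊(κ a univ).toReal⌋₊ = n} := fun n =>
    (Nat.measurable_floor.comp (κ.measurable_coe MeasurableSet.univ).ennreal_toReal)
      (measurableSet_singleton n)
  classical
  refine ⟨fun n => Kernel.piecewise (hA n) κ 0, fun n => ⟨n + 1, by simp, fun a => ?_⟩, ?_⟩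
  · rw [Kernel.piecewise_apply']
    split_ifs with ha
    · have h1 := (Nat.lt_floor_add_one (κ a univ).toReal).le
      rw [show ⌊(κ a univ).toReal⌋₊ = n from ha] at h1
      rw [← ENNReal.ofReal_toReal (measure_ne_top (κ a) univ)]
      exact (ENNReal.ofReal_le_ofReal h1).trans (by
        rw [ENNReal.ofReal_add (by positivity) zero_le_one]; simp)
    · simp
  · ext a s hs
    rw [Kernel.sum_apply' _ _ hs, tsum_eq_single ⌊(κ a univ).toReal⌋₊]
    · simp [Kernel.piecewise_apply']
    · intro n hn
      simp [Kernel.piecewise_apply', hn.symm]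

/-- The jump times of a counting process as a random measure. -/
def jumpKernel {N : ℝ≥0 → Ω → ℕ} (hN : ∀ ω, IsCountingPath fun t => N t ω)
    (hm : ∀ t, Measurable (N t)) (T : ℝ≥0) : Kernel Ω ℝ≥0 :=
  ⟨fun ω => jumpMeasure (fun t => N t ω) T, measurable_jumpMeasure hN hm T⟩

lemma isAdaptedMeasure_jumpMeasure {ℱ : Filtration ℝ≥0 mΩ} {N : ℝ≥0 → Ω → ℕ}
    (hN : ∀ ω, IsCountingPath fun t => N t ω) (hm : Adapted ℱ N) (T : ℝ≥0) :
    IsAdaptedMeasure ℱ fun ω => jumpMeasure (fun t => N t ω) T where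
  finite ω := (hN ω).isFiniteMeasure_jumpMeasure T
  zero ω := (hN ω).jumpMeasure_zero T
  adapted a b := by
    rcases le_total a b with hab | hab
    · simp only [(hN _).jumpMeasure_Ioc]
      refine measurable_from_top.comp (Measurable.sub ?_ ?_)
      · exact (hm _).mono (ℱ.mono (min_le_left _ _)) le_rfl
      · exact (hm _).mono (ℱ.mono ((min_le_left _ _).trans hab)) le_rfl
    · simp [Ioc_eq_empty (not_lt.2 hab)]

lemma isAdaptedMeasure_lebesgueUpTo (ℱ : Filtration ℝ≥0 mΩ) (T : ℝ≥0) :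
    IsAdaptedMeasure ℱ fun _ => lebesgueUpTo T where
  finite _ := inferInstance
  zero _ := lebesgueUpTo_zero T
  adapted _ _ := measurable_const

lemma measurable_lintegral_of_predictable {ℱ : Filtration ℝ≥0 mΩ} (κ : Kernel Ω ℝ≥0)
    [IsSFiniteKernel κ] {H : ℝ≥0 × Ω → ℝ≥0∞} (hH : Measurable[ℱ.predictable] H) :
    Measurable fun ω => ∫⁻ s, H (s, ω) ∂κ ω :=
  (hH.mono (predictable_le ℱ) le_rfl).lintegral_kernel_prod_left'

/-- Two random measures with integrable total mass which agree on the sets `{0} × A`, `A ∈ ℱ 0`,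
and `(i, ∞) × A`, `A ∈ ℱ i`, have the same integrals of predictable functions. -/
lemma lintegral_predictable_congr {ℱ : Filtration ℝ≥0 mΩ} {μ : Measure Ω} [SFinite μ]
    {κ η : Kernel Ω ℝ≥0} [IsSFiniteKernel κ] [IsSFiniteKernel η]
    (hfin : ∫⁻ ω, κ ω univ ∂μ ≠ ∞) (hκ : ∀ ω, κ ω {0} = 0) (hη : ∀ ω, η ω {0} = 0)
    (h : ∀ i A, MeasurableSet[ℱ i] A → ∫⁻ ω in A, κ ω (Ioi i) ∂μ = ∫⁻ ω in A, η ω (Ioi i) ∂μ)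
    {H : ℝ≥0 × Ω → ℝ≥0∞} (hH : Measurable[ℱ.predictable] H) :
    ∫⁻ ω, ∫⁻ s, H (s, ω) ∂κ ω ∂μ = ∫⁻ ω, ∫⁻ s, H (s, ω) ∂η ω ∂μ := by
  have hle := predictable_le ℱ
  have hl : ∀ (κ : Kernel Ω ℝ≥0) [IsSFiniteKernel κ], ∀ {f : ℝ≥0 × Ω → ℝ≥0∞},
      Measurable[ℱ.predictable] f →
      ∫⁻ p, f p ∂((μ ⊗ₘ κ).map Prod.swap).trim hle = ∫⁻ ω, ∫⁻ s, f (s, ω) ∂κ ω ∂μ := by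
    intro κ _ f hf
    have hf' := hf.mono hle le_rfl
    rw [lintegral_trim hle hf, lintegral_map hf' measurable_swap]
    exact Measure.lintegral_compProd (hf'.comp measurable_swap)
  have hr : ∀ (κ : Kernel Ω ℝ≥0) [IsSFiniteKernel κ] {B : Set ℝ≥0} {A : Set Ω},
      MeasurableSet A → MeasurableSet[ℱ.predictable] (B ×ˢ A) → MeasurableSet B →
      ((μ ⊗ₘ κ).map Prod.swap).trim hle (B ×ˢ A) = ∫⁻ ω in A, κ ω B ∂μ := by
    intro κ _ B A hA hBA hB
    rw [trim_measurableSet_eq hle hBA, Measure.map_apply measurable_swap (hle _ hBA),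
      Set.preimage_swap_prod, Measure.compProd_apply_prod hA hB]
  have hz : ∀ (κ : Kernel Ω ℝ≥0) [IsSFiniteKernel κ], (∀ ω, κ ω {0} = 0) →
      ∀ ω, κ ω univ = κ ω (Ioi 0) := by
    intro κ _ hκ ω
    apply le_antisymm _ (measure_mono (subset_univ _))
    have : (univ : Set ℝ≥0) = {0} ∪ Ioi 0 := by
      ext s
      simp
    rw [this]
    exact (measure_union_le _ _).trans (by rw [hκ, zero_add])
  have huniv : ((μ ⊗ₘ κ).map Prod.swap).trim hle univ = ∫⁻ ω, κ ω univ ∂μ := by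
    rw [← Set.univ_prod_univ, hr κ MeasurableSet.univ (by simp) MeasurableSet.univ,
      Measure.restrict_univ]
  have hfinm : IsFiniteMeasure (((μ ⊗ₘ κ).map Prod.swap).trim hle) :=
    ⟨by rw [huniv]; exact hfin.lt_top⟩
  -- Both double integrals are integrals against measures on the predictable σ-algebra. These have
  -- finite mass, so agreement on the generating π-system makes them equal.
  have key : ((μ ⊗ₘ κ).map Prod.swap).trim hle = ((μ ⊗ₘ η).map Prod.swap).trim hle := by
    refine @ext_of_generate_finite _ ℱ.predictable _ _ (predictableRectangles ℱ) rfl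
      (isPiSystem_predictableRectangles ℱ) hfinm ?_ ?_
    · rintro _ (⟨A, hA, rfl⟩ | ⟨i, A, hA, rfl⟩)
      · have hm := measurableSet_predictable_singleton_bot_prod hA
        rw [hr κ (ℱ.le _ _ hA) hm (measurableSet_singleton _),
          hr η (ℱ.le _ _ hA) hm (measurableSet_singleton _)]
        simp only [bot_eq_zero, hκ, hη]
      · have hm := measurableSet_predictable_Ioi_prod hA
        rw [hr κ (ℱ.le _ _ hA) hm measurableSet_Ioi, hr η (ℱ.le _ _ hA) hm measurableSet_Ioi, h i A hA]
    · rw [huniv, ← Set.univ_prod_univ, hr η MeasurableSet.univ (by simp) MeasurableSet.univ,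
        Measure.restrict_univ]
      simp only [hz κ hκ, hz η hη]
      simpa using h 0 univ MeasurableSet.univ
  rw [← hl κ hH, ← hl η hH, key]

/-- The integral of a predictable function against the jumps of a counting process has the same
expectation as the integral against the intensity. -/
theorem lintegral_jumpMeasure_eq {ℱ : Filtration ℝ≥0 mΩ} {μ : Measure Ω} [IsProbabilityMeasure μ]
    {N : ℝ≥0 → Ω → ℕ} (hN : ∀ ω, IsCountingPath fun t => N t ω) (hNm : Adapted ℱ N)
    {lam : ℝ≥0 → Ω → ℝ} (hlam : Measurable[ℱ.predictable] (Function.uncurry lam))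
    (h0 : ∀ t ω, 0 ≤ lam t ω)
    {T : ℝ≥0} {Λ : ℝ} (hΛ0 : 0 ≤ Λ) (hΛ : ∀ᵐ ω ∂μ, ∀ t ≤ T, lam t ω ≤ Λ)
    (hM : Martingale (fun t ω => (N (min t T) ω : ℝ) -
      ∫ s in (0 : ℝ)..(min t T : ℝ≥0), lam s.toNNReal ω) ℱ μ)
    {H : ℝ≥0 × Ω → ℝ≥0∞} (hH : Measurable[ℱ.predictable] H) :
    ∫⁻ ω, ∫⁻ s, H (s, ω) ∂jumpMeasure (fun t => N t ω) T ∂μ =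
      ∫⁻ ω, ∫⁻ s, H (s, ω) * ENNReal.ofReal (lam s ω) ∂lebesgueUpTo T ∂μ := by
  have hNm' : ∀ t, Measurable (N t) := fun t => (hNm t).mono (ℱ.le _) le_rfl
  have hlam' : Measurable (Function.uncurry lam) := hlam.mono (predictable_le ℱ) le_rfl
  have hsec : ∀ ω, Measurable fun s => lam s ω := fun ω => hlam'.comp measurable_prodMk_right
  have hdens : Measurable (Function.uncurry fun ω s => ENNReal.ofReal (lam s ω)) :=
    (hlam'.comp measurable_swap).ennreal_ofReal
  set κ := jumpKernel hN hNm' T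
  have hκfin : ∀ ω, IsFiniteMeasure (κ ω) := fun ω => (hN ω).isFiniteMeasure_jumpMeasure T
  have hκs : IsSFiniteKernel κ := isSFiniteKernel_of_isFiniteMeasure κ hκfin
  set η : Kernel Ω ℝ≥0 := Kernel.withDensity (Kernel.const Ω (lebesgueUpTo T))
    fun ω s => ENNReal.ofReal (lam s ω)
  have hηs : IsSFiniteKernel η :=
    Kernel.IsSFiniteKernel.withDensity _ fun ω s => ENNReal.ofReal_ne_top
  have hη : ∀ ω, η ω = (lebesgueUpTo T).withDensity fun s => ENNReal.ofReal (lam s ω) := fun ω => by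
    rw [Kernel.withDensity_apply _ hdens, Kernel.const_apply]
  -- integrability
  have hbd : ∀ᵐ ω ∂μ, ∀ᵐ s ∂lebesgueUpTo T, ‖lam s ω‖ ≤ Λ := by
    filter_upwards [hΛ] with ω hω
    filter_upwards [ae_lebesgueUpTo_le T] with s hs
    rw [Real.norm_of_nonneg (h0 _ _)]
    exact hω s hs.2
  have hint : ∀ᵐ ω ∂μ, Integrable (fun s => lam s ω) (lebesgueUpTo T) := by
    filter_upwards [hbd] with ω hω
    exact .of_bound (hsec ω).aestronglyMeasurable Λ hω
  have hI : ∀ t, ∀ ω, ∫ s in (0 : ℝ)..(min t T : ℝ≥0), lam s.toNNReal ω =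
      ∫ s in Iic t, lam s ω ∂lebesgueUpTo T := fun t ω => by
    rw [restrict_lebesgueUpTo_Iic, integral_lebesgueUpTo _ (hsec ω).stronglyMeasurable]
  have hIint : ∀ t, Integrable (fun ω => ∫ s in Iic t, lam s ω ∂lebesgueUpTo T) μ := fun t => by
    refine Integrable.of_bound (C := Λ * T) ?_ ?_
    · exact (StronglyMeasurable.integral_prod_right (f := fun ω s => lam s ω)
        (hlam'.comp measurable_swap).stronglyMeasurable).aestronglyMeasurable
    · filter_upwards [hbd] with ω hω
      refine (norm_integral_le_of_norm_le_const (ae_restrict_of_ae hω)).trans ?_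
      refine mul_le_mul_of_nonneg_left ?_ hΛ0
      refine (measureReal_mono (μ := (lebesgueUpTo T).restrict (Iic t)) (subset_univ _)).trans ?_
      rw [measureReal_restrict_apply MeasurableSet.univ, univ_inter]
      refine (measureReal_mono (subset_univ _)).trans ?_
      rw [measureReal_def, lebesgueUpTo_univ]
      simp
  -- `N` is an integrable martingale plus a bounded compensator; no moment of `N` is assumed.
  have hNint : ∀ t, Integrable (fun ω => (N (min t T) ω : ℝ)) μ := fun t => by
    have := (hM.integrable t).add (hIint t)
    refine this.congr (ae_of_all _ fun ω => ?_)
    rw [Pi.add_apply, hI]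
    ring
  rw [show ∫⁻ ω, ∫⁻ s, H (s, ω) ∂jumpMeasure (fun t => N t ω) T ∂μ = ∫⁻ ω, ∫⁻ s, H (s, ω) ∂κ ω ∂μ
    from rfl, lintegral_predictable_congr (ℱ := ℱ) (κ := κ) (η := η) ?_ ?_ ?_ ?_ hH]
  · refine lintegral_congr fun ω => ?_
    have hHs : Measurable fun s => H (s, ω) :=
      (hH.mono (predictable_le ℱ) le_rfl).comp measurable_prodMk_right
    rw [hη, lintegral_withDensity_eq_lintegral_mul _ (hsec ω).ennreal_ofReal hHs]
    simp [mul_comm]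
  · have : ∀ ω, κ ω univ = ENNReal.ofReal (N (min T T) ω) := fun ω => by
      rw [min_self, ENNReal.ofReal_natCast]; exact (hN ω).jumpMeasure_univ T
    simp only [this]
    exact (hNint T).lintegral_lt_top.ne
  · exact fun ω => (hN ω).jumpMeasure_zero T
  · intro ω
    rw [hη]
    exact withDensity_absolutelyContinuous _ _ (lebesgueUpTo_zero T)
  · intro i A hA
    have hAm := ℱ.le _ _ hA
    have h1 : ∀ ω, κ ω (Ioi i) = ENNReal.ofReal (N (min T T) ω - N (min i T) ω) := fun ω => by
      have hmono := (hN ω).mono (min_le_right i T)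
      rw [← compl_Iic, measure_compl measurableSet_Iic (measure_ne_top _ _)]
      change jumpMeasure _ _ _ - jumpMeasure _ _ _ = _
      rw [(hN ω).jumpMeasure_univ, (hN ω).jumpMeasure_Iic, min_self,
        ENNReal.ofReal_sub _ (Nat.cast_nonneg _)]
      simp
    have h2 : ∀ᵐ ω ∂μ, η ω (Ioi i) = ENNReal.ofReal ((∫ s in Iic T, lam s ω ∂lebesgueUpTo T) -
        ∫ s in Iic i, lam s ω ∂lebesgueUpTo T) := by
      filter_upwards [hint] with ω hω
      have : (lebesgueUpTo T).restrict (Iic T) = lebesgueUpTo T := by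
        rw [restrict_lebesgueUpTo_Iic, min_self]
      rw [hη, withDensity_apply _ measurableSet_Ioi, this, ← setIntegral_compl measurableSet_Iic hω, compl_Iic,
        ofReal_integral_eq_lintegral_ofReal hω.integrableOn (ae_of_all _ fun s => h0 _ _)]
    rw [lintegral_congr_ae (ae_restrict_of_ae h2)]
    simp only [h1]
    rw [← ofReal_integral_eq_lintegral_ofReal
        (f := fun ω => (N (min T T) ω : ℝ) - N (min i T) ω)
        ((hNint T).sub (hNint i)).integrableOn,
      ← ofReal_integral_eq_lintegral_ofReal
        (f := fun ω => (∫ s in Iic T, lam s ω ∂lebesgueUpTo T) -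
          ∫ s in Iic i, lam s ω ∂lebesgueUpTo T)
        ((hIint T).sub (hIint i)).integrableOn]
    · congr 1
      -- Comparing `i` with `max i T` rather than with `T` also covers `i > T`; the stopped process
      -- takes its time-`T` value there.
      have key := hM.setIntegral_eq (le_max_left i T) hA
      have hT : min (max i T) T = min T T := by simp
      simp only [hI] at key
      rw [integral_sub (hNint i).integrableOn (hIint i).integrableOn,
        integral_sub (hNint _).integrableOn (hIint _).integrableOn] at key
      have e1 : ∀ ω, ∫ s in Iic (max i T), lam s ω ∂lebesgueUpTo T =
          ∫ s in Iic T, lam s ω ∂lebesgueUpTo T := fun ω => by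
        rw [restrict_lebesgueUpTo_Iic, restrict_lebesgueUpTo_Iic, hT]
      simp only [e1, hT] at key
      rw [integral_sub (hNint _).integrableOn (hNint i).integrableOn,
        integral_sub (hIint _).integrableOn (hIint i).integrableOn]
      linarith
    · refine ae_restrict_of_ae ?_
      filter_upwards [hint] with ω hω
      rw [Pi.zero_apply, sub_nonneg]
      have : (lebesgueUpTo T).restrict (Iic T) = lebesgueUpTo T := by
        rw [restrict_lebesgueUpTo_Iic, min_self]
      rw [this]
      exact setIntegral_le_integral hω (ae_of_all _ fun s => h0 _ _)
    · refine ae_of_all _ fun ω => ?_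
      rw [Pi.zero_apply, sub_nonneg, Nat.cast_le, min_self]
      exact (hN ω).mono (min_le_right _ _)

end DynNet

namespace DynNet

/-! ### A product formula for the exponential of a process of finite variation -/

/-- As `d` is merely bounded and measurable, its primitive is Lipschitz but not `C¹`. The
fundamental theorem is used for absolutely continuous functions, the derivative coming from Lebesgue
differentiation. -/
lemma integral_exp_neg_primitive {d : ℝ → ℝ} (hd : Measurable d) {C : ℝ} (hC : ∀ x, |d x| ≤ C)
    (a b : ℝ) : ∫ x in a..b, Real.exp (-∫ y in (0 : ℝ)..x, d y) * d x =
      Real.exp (-∫ y in (0 : ℝ)..a, d y) - Real.exp (-∫ y in (0 : ℝ)..b, d y) := by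
  have hC0 : 0 ≤ C := (abs_nonneg _).trans (hC 0)
  have hint : ∀ u v, IntervalIntegrable d volume u v := fun u v =>
    (intervalIntegrable_const (c := C)).mono_fun hd.aestronglyMeasurable
      (ae_of_all _ fun x => (hC x).trans (le_abs_self C))
  set D : ℝ → ℝ := fun x => ∫ y in (0 : ℝ)..x, d y
  have hD : LipschitzWith C.toNNReal D := by
    refine LipschitzWith.of_dist_le_mul fun x y => ?_
    rw [Real.dist_eq, Real.dist_eq, intervalIntegral.integral_interval_sub_left (hint _ _) (hint _ _),
      Real.coe_toNNReal _ hC0]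
    exact intervalIntegral.norm_integral_le_of_norm_le_const fun z _ =>
      (Real.norm_eq_abs _).trans_le (hC z)
  have hAC : AbsolutelyContinuousOnInterval (fun x => Real.exp (-D x)) a b := by
    obtain ⟨B, hB⟩ := (isCompact_uIcc (a := a) (b := b)).exists_bound_of_continuousOn
      hD.continuous.continuousOn
    have hexp : LipschitzOnWith (Real.exp B).toNNReal Real.exp (Iic B) := by
      refine (convex_Iic B).lipschitzOnWith_of_nnnorm_deriv_le (fun x _ => Real.differentiableAt_exp)
        fun x hx => ?_
      rw [Real.deriv_exp, ← NNReal.coe_le_coe, coe_nnnorm, Real.coe_toNNReal _ (Real.exp_pos _).le,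
        Real.norm_of_nonneg (Real.exp_pos _).le]
      exact Real.exp_le_exp.2 hx
    refine LipschitzOnWith.absolutelyContinuousOnInterval
      (hexp.comp (hD.neg.lipschitzOnWith (s := uIcc a b)) fun x hx => ?_)
    exact (neg_le_abs _).trans (hB x hx)
  have hder : ∀ᵐ x, deriv (fun x => Real.exp (-D x)) x = -(Real.exp (-D x) * d x) := by
    have hloc : LocallyIntegrable d volume := by
      refine (locallyIntegrable_const C).mono hd.aestronglyMeasurable
        (ae_of_all _ fun x => (hC x).trans (le_abs_self C))
    filter_upwards [_root_.LocallyIntegrable.ae_hasDerivAt_integral hloc] with x hx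
    exact ((hx 0).neg.exp).deriv.trans (mul_neg _ _)
  have := hAC.integral_deriv_eq_sub
  rw [intervalIntegral.integral_congr_ae (hder.mono fun x hx _ => hx),
    intervalIntegral.integral_neg] at this
  linarith

/-- The product formula, for finitely many jumps `exp (φ s) - 1` at the times in `J`. -/
lemma exp_sum_sub_primitive (J : Finset ℝ) (φ : ℝ → ℝ) {d : ℝ → ℝ} (hd : Measurable d) {C : ℝ}
    (hC : ∀ x, |d x| ≤ C) {T : ℝ} (hJ : ∀ s ∈ J, 0 < s ∧ s ≤ T) (hT : 0 ≤ T) :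
    Real.exp (∑ s ∈ J, φ s - ∫ y in (0 : ℝ)..T, d y) =
      1 + ∑ s ∈ J, Real.exp (∑ r ∈ J with r < s, φ r - ∫ y in (0 : ℝ)..s, d y) *
        (Real.exp (φ s) - 1) -
      ∫ s in (0 : ℝ)..T,
        Real.exp (∑ r ∈ J with r < s, φ r - ∫ y in (0 : ℝ)..s, d y) * d s := by
  have hC0 : 0 ≤ C := (abs_nonneg _).trans (hC 0)
  have hint : ∀ u v, IntervalIntegrable d volume u v := fun u v =>
    (intervalIntegrable_const (c := C)).mono_fun hd.aestronglyMeasurable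
      (ae_of_all _ fun x => (hC x).trans (le_abs_self C))
  set D : ℝ → ℝ := fun x => ∫ y in (0 : ℝ)..x, d y with hDdef
  set G : ℝ → ℝ := fun s => Real.exp (-D s) * d s
  set p : ℝ → ℝ := fun s => Real.exp (∑ r ∈ J with r < s, φ r)
  -- Expansion of `∏ (1 + a_s)` according to the largest index whose `a_s` is chosen.
  have hprod : ∀ I : Finset ℝ, Real.exp (∑ r ∈ I, φ r) =
      1 + ∑ s ∈ I, Real.exp (∑ r ∈ I with r < s, φ r) * (Real.exp (φ s) - 1) := by
    intro I
    have := Finset.prod_add_ordered I (fun _ => (1 : ℝ)) fun s => Real.exp (φ s) - 1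
    simp only [add_sub_cancel, Finset.prod_const_one, mul_one] at this
    rw [Real.exp_sum, this]
    simp only [Real.exp_sum]
    congr 1
    exact Finset.sum_congr rfl fun s _ => mul_comm _ _
  have hp : ∀ s, p s = 1 + ∑ r ∈ J with r < s, p r * (Real.exp (φ r) - 1) := by
    intro s
    change Real.exp _ = _
    rw [hprod]
    congr 1
    refine Finset.sum_congr rfl fun r hr => ?_
    congr 3
    rw [Finset.filter_filter]
    refine Finset.filter_congr fun x _ => ?_
    have := (Finset.mem_filter.1 hr).2
    exact ⟨fun h => h.2, fun h => ⟨h.trans this, h⟩⟩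
  have hDc : Continuous D := by
    exact intervalIntegral.continuous_primitive hint 0
  have hGint : ∀ u v, IntervalIntegrable G volume u v := fun u v =>
    (hint u v).continuousOn_mul (by fun_prop)
  have hsplit : ∀ s x, Real.exp (∑ r ∈ J with r < s, φ r - D x) = p s * Real.exp (-D x) :=
    fun s x => by rw [← Real.exp_add, sub_eq_add_neg]
  -- Expanding `p s` over the jumps before `s` and exchanging sum and integral leaves one `∫_r^T G`
  -- for each jump `r`, which is explicit by the preceding lemma.
  have hI : ∫ s in (0 : ℝ)..T, Real.exp (∑ r ∈ J with r < s, φ r - D s) * d s =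
      (∫ s in (0 : ℝ)..T, G s) +
        ∑ r ∈ J, p r * (Real.exp (φ r) - 1) * ∫ s in r..T, G s := by
    have h1 : ∀ s, Real.exp (∑ r ∈ J with r < s, φ r - D s) * d s =
        G s + ∑ r ∈ J, p r * (Real.exp (φ r) - 1) * (Ioi r).indicator G s := by
      intro s
      rw [hsplit, mul_assoc, hp s, add_mul, one_mul, Finset.sum_mul, Finset.sum_filter]
      congr 1
      refine Finset.sum_congr rfl fun r _ => ?_
      by_cases h : r < s
      · rw [if_pos h, indicator_of_mem (show s ∈ Ioi r from h)]
      · rw [if_neg h, indicator_of_notMem (show s ∉ Ioi r from h), mul_zero]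
    simp only [h1]
    have hii : ∀ r, IntervalIntegrable ((Ioi r).indicator G) volume 0 T := fun r => by
      rw [intervalIntegrable_iff]
      exact (intervalIntegrable_iff.1 (hGint 0 T)).indicator measurableSet_Ioi
    have hsum : IntervalIntegrable
        (fun s => ∑ r ∈ J, p r * (Real.exp (φ r) - 1) * (Ioi r).indicator G s) volume 0 T := by
      convert! IntervalIntegrable.sum J fun r _ => (hii r).const_mul (p r * (Real.exp (φ r) - 1))
        using 1
      ext s; simp
    rw [intervalIntegral.integral_add (hGint _ _) hsum,
      intervalIntegral.integral_finsetSum fun r _ => (hii r).const_mul _]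
    congr 1
    refine Finset.sum_congr rfl fun r hr => ?_
    rw [intervalIntegral.integral_const_mul]
    congr 1
    rw [intervalIntegral.integral_of_le hT, intervalIntegral.integral_of_le (hJ r hr).2,
      setIntegral_indicator measurableSet_Ioi]
    congr 2
    ext x
    simp only [mem_inter_iff, mem_Ioc, mem_Ioi]
    have := (hJ r hr).1
    constructor
    · rintro ⟨⟨-, h⟩, h'⟩; exact ⟨h', h⟩
    · rintro ⟨h, h'⟩; exact ⟨⟨this.trans h, h'⟩, h⟩
  have hG : ∀ u v, ∫ s in u..v, G s = Real.exp (-D u) - Real.exp (-D v) :=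
    integral_exp_neg_primitive hd hC
  have hD0 : D 0 = 0 := intervalIntegral.integral_same
  change Real.exp (_ - D T) = 1 + ∑ s ∈ J, Real.exp (_ - D s) * _ -
    ∫ s in (0 : ℝ)..T, Real.exp (∑ r ∈ J with r < s, φ r - D s) * d s
  rw [hI, hG 0 T, hD0, sub_eq_add_neg, Real.exp_add, hprod J]
  simp only [hG, hsplit]
  have e1 : ∀ s, Real.exp (∑ r ∈ J with r < s, φ r) = p s := fun s => rfl
  simp only [e1, neg_zero, Real.exp_zero]
  have : ∑ s ∈ J, p s * Real.exp (-D s) * (Real.exp (φ s) - 1) - ∑ r ∈ J, p r *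
      (Real.exp (φ r) - 1) * (Real.exp (-D r) - Real.exp (-D T)) =
      (∑ s ∈ J, p s * (Real.exp (φ s) - 1)) * Real.exp (-D T) := by
    rw [← Finset.sum_sub_distrib, Finset.sum_mul]
    exact Finset.sum_congr rfl fun s _ => by ring
  linarith

end DynNet

/-! ### The product formula for several counting paths -/

namespace DynNet

lemma setIntegral_Iio_lebesgueUpTo {s T : ℝ≥0} (hs : s ≤ T) {d : ℝ≥0 → ℝ} (hd : Measurable d) :
    ∫ r in Iio s, d r ∂lebesgueUpTo T = ∫ r in (0 : ℝ)..s, d r.toNNReal := by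
  rw [intervalIntegral.integral_of_le s.coe_nonneg, integral_Ioc_eq_integral_Ioo, lebesgueUpTo,
    setIntegral_map measurableSet_Iio hd.aestronglyMeasurable measurable_real_toNNReal.aemeasurable,
    Measure.restrict_restrict (measurable_real_toNNReal measurableSet_Iio)]
  congr 2
  ext x
  have hsT : (s : ℝ) ≤ T := hs
  simp only [mem_inter_iff, mem_preimage, mem_Iio, mem_Ioc, mem_Ioo]
  constructor
  · rintro ⟨h, h0, -⟩
    exact ⟨h0, (Real.toNNReal_lt_iff_lt_coe h0.le).1 h⟩
  · rintro ⟨h0, h⟩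
    exact ⟨(Real.toNNReal_lt_iff_lt_coe h0.le).2 h, h0, h.le.trans hsT⟩

lemma IsCountingPath.integral_jumpMeasure_eq_sum {N : ℝ≥0 → ℕ} (h : IsCountingPath N) (T : ℝ≥0)
    (f : ℝ≥0 → ℝ) :
    ∫ s, f s ∂jumpMeasure N T = ∑ s ∈ (h.finite_jumpTimes T).toFinset, f s := by
  rw [h.integral_jumpMeasure, finsum_mem_eq_finite_toFinset_sum _ (h.finite_jumpTimes T)]

lemma IsCountingPath.setIntegral_Iio_jumpMeasure {N : ℝ≥0 → ℕ} (h : IsCountingPath N) (T s : ℝ≥0)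
    (f : ℝ≥0 → ℝ) : ∫ r in Iio s, f r ∂jumpMeasure N T =
      ∑ r ∈ (h.finite_jumpTimes T).toFinset with r < s, f r := by
  rw [← integral_indicator measurableSet_Iio, h.integral_jumpMeasure_eq_sum, Finset.sum_filter]
  rfl

variable {ι : Type*} [Fintype ι]

/-- The exponential of `∫_0^{s-} f dN - ∫_0^s d`. -/
def leftExp (N : ι → ℝ≥0 → ℕ) (T : ℝ≥0) (f : ι → ℝ≥0 → ℝ) (d : ℝ≥0 → ℝ) (s : ℝ≥0) : ℝ :=
  Real.exp (∑ u, ∫ r in Iio s, f u r ∂jumpMeasure (N u) T - ∫ r in Iio s, d r ∂lebesgueUpTo T)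

/-- Without common jumps all paths can be merged into one finite set `J` of jump times: at each `s ∈
J` exactly one `u` jumps, so `exp (φ s) - 1` is a sum over `u` with a single nonzero term, and the
scalar formula applies. -/
lemma exp_integral_jumpMeasure {N : ι → ℝ≥0 → ℕ} (hN : ∀ u, IsCountingPath (N u)) {T : ℝ≥0}
    (hdisj : ∀ u v, u ≠ v → Disjoint (jumpTimes (N u) T) (jumpTimes (N v) T))
    (f : ι → ℝ≥0 → ℝ) {d : ℝ≥0 → ℝ} (hd : Measurable d) {C : ℝ} (hC : ∀ s, |d s| ≤ C)
    (hE : Measurable (leftExp N T f d)) :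
    Real.exp (∑ u, ∫ s, f u s ∂jumpMeasure (N u) T - ∫ s, d s ∂lebesgueUpTo T) =
      1 + ∑ u, ∫ s, leftExp N T f d s * (Real.exp (f u s) - 1) ∂jumpMeasure (N u) T -
        ∫ s, leftExp N T f d s * d s ∂lebesgueUpTo T := by
  classical
  set I : ι → Finset ℝ≥0 := fun u => ((hN u).finite_jumpTimes T).toFinset with hI
  have hmem : ∀ {u s}, s ∈ I u ↔ s ∈ jumpTimes (N u) T := fun {u s} => Set.Finite.mem_toFinset _
  set J := Finset.univ.biUnion I
  have hIJ : ∀ u, I u ⊆ J := fun u => Finset.subset_biUnion_of_mem I (Finset.mem_univ u)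
  set φ : ℝ≥0 → ℝ := fun s => ∑ u, if s ∈ I u then f u s else 0
  have hinj : Function.Injective ((↑) : ℝ≥0 → ℝ) := NNReal.coe_injective
  have hswap : ∀ (g : ι → ℝ≥0 → ℝ) (P : ℝ≥0 → Prop) [DecidablePred P],
      ∑ s ∈ J with P s, ∑ u, (if s ∈ I u then g u s else 0) = ∑ u, ∑ s ∈ I u with P s, g u s := by
    intro g P _
    rw [Finset.sum_comm]
    refine Finset.sum_congr rfl fun u _ => ?_
    rw [← Finset.sum_filter, Finset.filter_filter]
    refine Finset.sum_congr ?_ fun _ _ => rfl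
    ext s
    simp only [Finset.mem_filter]
    exact ⟨fun h => ⟨h.2.2, h.2.1⟩, fun h => ⟨hIJ u h.1, h.2, h.1⟩⟩
  have hswap' : ∀ (g : ι → ℝ≥0 → ℝ),
      ∑ s ∈ J, ∑ u, (if s ∈ I u then g u s else 0) = ∑ u, ∑ s ∈ I u, g u s := by
    intro g
    simpa using hswap g fun _ => True
  have hJT : ∀ s ∈ J, 0 < s ∧ s ≤ T := by
    intro s hs
    obtain ⟨u, -, hu⟩ := Finset.mem_biUnion.1 hs
    have := hmem.1 hu
    exact ⟨this.1, this.2.1⟩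
  have hφ : ∀ s ∈ J, Real.exp (φ s) - 1 =
      ∑ u, if s ∈ I u then Real.exp (f u s) - 1 else 0 := by
    intro s hs
    obtain ⟨u, -, hu⟩ := Finset.mem_biUnion.1 hs
    have huniq : ∀ v, v ≠ u → s ∉ I v := fun v hv hsv =>
      Set.disjoint_left.1 (hdisj v u hv) (hmem.1 hsv) (hmem.1 hu)
    have e1 : φ s = f u s := by
      change ∑ u, _ = _
      rw [Finset.sum_eq_single u (fun v _ hv => if_neg (huniq v hv)) (by simp), if_pos hu]
    rw [e1, Finset.sum_eq_single u (fun v _ hv => if_neg (huniq v hv)) (by simp), if_pos hu]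
  have hle : ∀ s ≤ T, leftExp N T f d s =
      Real.exp (∑ r ∈ J with r < s, φ r - ∫ y in (0 : ℝ)..s, d y.toNNReal) := by
    intro s hs
    rw [leftExp, setIntegral_Iio_lebesgueUpTo hs hd, hswap]
    congr 2
    exact Finset.sum_congr rfl fun u _ => (hN u).setIntegral_Iio_jumpMeasure T s (f u)
  have key := exp_sum_sub_primitive (J.map ⟨_, hinj⟩) (fun x => φ x.toNNReal)
    (d := fun x => d x.toNNReal) (hd.comp measurable_real_toNNReal) (C := C) (fun x => hC _) (T := T)
    (by simpa using fun s hs => hJT s hs) T.coe_nonneg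
  have hfil : ∀ s : ℝ, 0 ≤ s → ∑ r ∈ J.map ⟨_, hinj⟩ with r < s, φ r.toNNReal =
      ∑ r ∈ J with r < s.toNNReal, φ r := by
    intro s hs
    rw [Finset.filter_map, Finset.sum_map]
    simp only [Function.Embedding.coeFn_mk, Real.toNNReal_coe]
    refine Finset.sum_congr (Finset.filter_congr fun r _ => ?_) fun _ _ => rfl
    simp only [Function.comp_apply]
    rw [← NNReal.coe_lt_coe, Real.coe_toNNReal _ hs]
  have e1 : ∑ u, ∫ s, f u s ∂jumpMeasure (N u) T - ∫ s, d s ∂lebesgueUpTo T =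
      ∑ s ∈ J.map ⟨_, hinj⟩, φ s.toNNReal - ∫ y in (0 : ℝ)..T, d y.toNNReal := by
    rw [integral_lebesgueUpTo T hd.stronglyMeasurable, Finset.sum_map]
    simp only [Function.Embedding.coeFn_mk, Real.toNNReal_coe, φ]
    rw [hswap']
    congr 1
    exact Finset.sum_congr rfl fun u _ => (hN u).integral_jumpMeasure_eq_sum T (f u)
  have e2 : ∑ u, ∫ s, leftExp N T f d s * (Real.exp (f u s) - 1) ∂jumpMeasure (N u) T =
      ∑ s ∈ J.map ⟨_, hinj⟩, Real.exp (∑ r ∈ J.map ⟨_, hinj⟩ with r < s, φ r.toNNReal -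
        ∫ y in (0 : ℝ)..s, d y.toNNReal) * (Real.exp (φ s.toNNReal) - 1) := by
    rw [Finset.sum_map]
    simp only [Function.Embedding.coeFn_mk, hfil _ (NNReal.coe_nonneg _), Real.toNNReal_coe]
    rw [Finset.sum_congr (s₁ := J) rfl fun s hs => by
      rw [← hle s (hJT s hs).2, hφ s hs, Finset.mul_sum]]
    simp only [mul_ite, mul_zero]
    rw [hswap']
    exact Finset.sum_congr rfl fun u _ => (hN u).integral_jumpMeasure_eq_sum T _
  have e3 : ∫ s, leftExp N T f d s * d s ∂lebesgueUpTo T =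
      ∫ s in (0 : ℝ)..T, Real.exp (∑ r ∈ J.map ⟨_, hinj⟩ with r < s, φ r.toNNReal -
        ∫ y in (0 : ℝ)..s, d y.toNNReal) * d s.toNNReal := by
    rw [integral_lebesgueUpTo T (f := fun s => leftExp N T f d s * d s)
      (hE.mul hd).stronglyMeasurable]
    refine intervalIntegral.integral_congr fun s hs => ?_
    rw [uIcc_of_le T.coe_nonneg] at hs
    rw [hle _ (Real.toNNReal_le_iff_le_coe.2 hs.2), hfil s hs.1, Real.coe_toNNReal _ hs.1]
  rw [e1, e2, e3]
  exact key

end DynNet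

namespace DynNet

variable {Ω : Type*} [mΩ : MeasurableSpace Ω]

/-! ### Integrals of bounded predictable processes -/

lemma IsAdaptedMeasure.measurable_integral_Iio {ℱ : Filtration ℝ≥0 mΩ} {ν : Ω → Measure ℝ≥0}
    (hν : IsAdaptedMeasure ℱ ν) {f : ℝ≥0 → Ω → ℝ} (hf : Measurable[ℱ.predictable] (Function.uncurry f))
    {C : ℝ} (hC : ∀ s ω, |f s ω| ≤ C) :
    Measurable[ℱ.predictable] fun p : ℝ≥0 × Ω => ∫ r in Iio p.1, f r p.2 ∂ν p.2 := by
  have hfin := hν.finite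
  have hsec : ∀ ω, Measurable fun r => f r ω := fun ω =>
    (hf.mono (predictable_le ℱ) le_rfl).comp measurable_prodMk_right
  have h1 := hν.measurable_lintegral_Iio hf.ennreal_ofReal
  have h2 := hν.measurable_lintegral_Iio hf.neg.ennreal_ofReal
  convert! h1.ennreal_toReal.sub h2.ennreal_toReal using 1
  ext p
  rw [integral_eq_lintegral_pos_part_sub_lintegral_neg_part]
  · rfl
  · exact Integrable.of_bound (hsec _).aestronglyMeasurable C (ae_of_all _ fun r => hC r _)

/-- `lam` is the predictable intensity on `(0, T]` of the counting process `N`. -/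
structure HasIntensity (ℱ : Filtration ℝ≥0 mΩ) (μ : Measure Ω) (T : ℝ≥0) (N : ℝ≥0 → Ω → ℕ)
    (lam : ℝ≥0 → Ω → ℝ) (Λ : ℝ) : Prop where
  path : ∀ ω, IsCountingPath fun t => N t ω
  adapted : Adapted ℱ N
  predictable : Measurable[ℱ.predictable] (Function.uncurry lam)
  nonneg : ∀ t ω, 0 ≤ lam t ω
  le : ∀ t ω, lam t ω ≤ Λ
  lintegral_eq : ∀ {H : ℝ≥0 × Ω → ℝ≥0∞}, Measurable[ℱ.predictable] H →
    ∫⁻ ω, ∫⁻ s, H (s, ω) ∂jumpMeasure (fun t => N t ω) T ∂μ =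
      ∫⁻ ω, ∫⁻ s, H (s, ω) * ENNReal.ofReal (lam s ω) ∂lebesgueUpTo T ∂μ

namespace HasIntensity

variable {ℱ : Filtration ℝ≥0 mΩ} {μ : Measure Ω} {T : ℝ≥0} {N : ℝ≥0 → Ω → ℕ}
  {lam : ℝ≥0 → Ω → ℝ} {Λ : ℝ}

lemma measurable_lintegral (h : HasIntensity ℱ μ T N lam Λ) {H : ℝ≥0 × Ω → ℝ≥0∞}
    (hH : Measurable[ℱ.predictable] H) :
    Measurable fun ω => ∫⁻ s, H (s, ω) ∂jumpMeasure (fun t => N t ω) T := by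
  have hm : ∀ t, Measurable (N t) := fun t => (h.adapted t).mono (ℱ.le _) le_rfl
  have := isSFiniteKernel_of_isFiniteMeasure (jumpKernel h.path hm T)
    fun ω => (h.path ω).isFiniteMeasure_jumpMeasure T
  exact measurable_lintegral_of_predictable (jumpKernel h.path hm T) hH

lemma measurable_integral (h : HasIntensity ℱ μ T N lam Λ) {f : ℝ≥0 → Ω → ℝ}
    (hf : Measurable[ℱ.predictable] (Function.uncurry f)) :
    Measurable fun ω => ∫ s, f s ω ∂jumpMeasure (fun t => N t ω) T := by
  have hm : ∀ t, Measurable (N t) := fun t => (h.adapted t).mono (ℱ.le _) le_rfl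
  have := isSFiniteKernel_of_isFiniteMeasure (jumpKernel h.path hm T)
    fun ω => (h.path ω).isFiniteMeasure_jumpMeasure T
  exact (StronglyMeasurable.integral_kernel_prod_right (κ := jumpKernel h.path hm T)
    (f := fun ω s => f s ω)
    ((hf.mono (predictable_le ℱ) le_rfl).comp measurable_swap).stronglyMeasurable).measurable

lemma measurable_integral_lebesgue {ℱ : Filtration ℝ≥0 mΩ} {f : ℝ≥0 → Ω → ℝ} (T : ℝ≥0)
    (hf : Measurable[ℱ.predictable] (Function.uncurry f)) :
    Measurable fun ω => ∫ s, f s ω ∂lebesgueUpTo T :=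
  (StronglyMeasurable.integral_prod_right (f := fun ω s => f s ω)
    ((hf.mono (predictable_le ℱ) le_rfl).comp measurable_swap).stronglyMeasurable).measurable

lemma nonneg_bound [hne : Nonempty Ω] (h : HasIntensity ℱ μ T N lam Λ) : 0 ≤ Λ :=
  hne.elim fun ω => (h.nonneg 0 ω).trans (h.le 0 ω)

/-- Integrals of bounded predictable processes against the jumps and against the intensity are
integrable and have the same expectation. -/
lemma integral_eq [IsProbabilityMeasure μ] (h : HasIntensity ℱ μ T N lam Λ) {f : ℝ≥0 → Ω → ℝ}
    (hf : Measurable[ℱ.predictable] (Function.uncurry f)) {C : ℝ} (hC : ∀ s ω, |f s ω| ≤ C) :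
    Integrable (fun ω => ∫ s, f s ω ∂jumpMeasure (fun t => N t ω) T) μ ∧
    Integrable (fun ω => ∫ s, f s ω * lam s ω ∂lebesgueUpTo T) μ ∧
    ∫ ω, ∫ s, f s ω ∂jumpMeasure (fun t => N t ω) T ∂μ =
      ∫ ω, ∫ s, f s ω * lam s ω ∂lebesgueUpTo T ∂μ := by
  have hne : Nonempty Ω := μ.nonempty_of_neZero
  have hfin := fun ω => (h.path ω).isFiniteMeasure_jumpMeasure T
  have hΛ := h.nonneg_bound
  have hC0 : 0 ≤ C := hne.elim fun ω => (abs_nonneg _).trans (hC 0 ω)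
  have hsec : ∀ {g : ℝ≥0 → Ω → ℝ} (_ : Measurable[ℱ.predictable] (Function.uncurry g)) ω,
      Measurable fun r => g r ω := fun hg ω =>
    (hg.mono (predictable_le ℱ) le_rfl).comp measurable_prodMk_right
  -- the nonnegative case
  have pos : ∀ {g : ℝ≥0 → Ω → ℝ}, Measurable[ℱ.predictable] (Function.uncurry g) →
      (∀ s ω, 0 ≤ g s ω) → (∀ s ω, g s ω ≤ C) →
      Integrable (fun ω => ∫ s, g s ω ∂jumpMeasure (fun t => N t ω) T) μ ∧
      Integrable (fun ω => ∫ s, g s ω * lam s ω ∂lebesgueUpTo T) μ ∧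
      ∫ ω, ∫ s, g s ω ∂jumpMeasure (fun t => N t ω) T ∂μ =
        ∫ ω, ∫ s, g s ω * lam s ω ∂lebesgueUpTo T ∂μ := by
    intro g hg hg0 hgC
    have hbd : ∀ s ω, |g s ω| ≤ C := fun s ω => (abs_of_nonneg (hg0 s ω)).trans_le (hgC s ω)
    have e1 : ∀ ω, ENNReal.ofReal (∫ s, g s ω ∂jumpMeasure (fun t => N t ω) T) =
        ∫⁻ s, ENNReal.ofReal (g s ω) ∂jumpMeasure (fun t => N t ω) T := fun ω =>
      ofReal_integral_eq_lintegral_ofReal (Integrable.of_bound (hsec hg ω).aestronglyMeasurable C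
        (ae_of_all _ fun r => hbd r _)) (ae_of_all _ fun s => hg0 s ω)
    have hbd2 : ∀ s ω, |g s ω * lam s ω| ≤ C * Λ := fun s ω => by
      rw [abs_mul, abs_of_nonneg (h.nonneg s ω)]
      exact mul_le_mul (hbd s ω) (h.le s ω) (h.nonneg s ω) hC0
    have hint2 : ∀ ω, Integrable (fun s => g s ω * lam s ω) (lebesgueUpTo T) := fun ω =>
      Integrable.of_bound ((hsec hg ω).mul (hsec h.predictable ω)).aestronglyMeasurable _
        (ae_of_all _ fun r => hbd2 r _)
    have e2 : ∀ ω, ENNReal.ofReal (∫ s, g s ω * lam s ω ∂lebesgueUpTo T) =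
        ∫⁻ s, ENNReal.ofReal (g s ω) * ENNReal.ofReal (lam s ω) ∂lebesgueUpTo T := fun ω => by
      rw [ofReal_integral_eq_lintegral_ofReal (hint2 ω)
        (ae_of_all _ fun s => mul_nonneg (hg0 s ω) (h.nonneg s ω))]
      exact lintegral_congr fun s => ENNReal.ofReal_mul (hg0 s ω)
    have hm1 := h.measurable_integral hg
    have hm2 := measurable_integral_lebesgue T (f := fun s ω => g s ω * lam s ω)
      (hg.mul h.predictable)
    have hI2 : Integrable (fun ω => ∫ s, g s ω * lam s ω ∂lebesgueUpTo T) μ :=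
      Integrable.of_bound hm2.aestronglyMeasurable (C * Λ * (lebesgueUpTo T).real univ)
        (ae_of_all _ fun ω => norm_integral_le_of_norm_le_const (ae_of_all _ fun s => hbd2 s ω))
    have key := h.lintegral_eq hg.ennreal_ofReal
    simp only [Function.uncurry_apply_pair, ← e1, ← e2] at key
    have n1 : ∀ ω, 0 ≤ ∫ s, g s ω ∂jumpMeasure (fun t => N t ω) T := fun ω =>
      integral_nonneg fun s => hg0 s ω
    have n2 : ∀ ω, 0 ≤ ∫ s, g s ω * lam s ω ∂lebesgueUpTo T := fun ω =>
      integral_nonneg fun s => mul_nonneg (hg0 s ω) (h.nonneg s ω)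
    have hI1 : Integrable (fun ω => ∫ s, g s ω ∂jumpMeasure (fun t => N t ω) T) μ := by
      refine ⟨hm1.aestronglyMeasurable, ?_⟩
      rw [hasFiniteIntegral_iff_ofReal (ae_of_all _ n1), key]
      exact hI2.lintegral_lt_top
    refine ⟨hI1, hI2, ?_⟩
    rw [integral_eq_lintegral_of_nonneg_ae (ae_of_all _ n1) hm1.aestronglyMeasurable, key,
      ← integral_eq_lintegral_of_nonneg_ae (ae_of_all _ n2) hm2.aestronglyMeasurable]
  obtain ⟨p1, p2, p3⟩ := pos (g := fun s ω => max (f s ω) 0) (hf.max measurable_const)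
    (fun s ω => le_max_right _ _) (fun s ω => max_le ((le_abs_self _).trans (hC s ω)) hC0)
  obtain ⟨q1, q2, q3⟩ := pos (g := fun s ω => max (-f s ω) 0) (hf.neg.max measurable_const)
    (fun s ω => le_max_right _ _) (fun s ω => max_le ((neg_le_abs _).trans (hC s ω)) hC0)
  have hdec : ∀ s ω, f s ω = max (f s ω) 0 - max (-f s ω) 0 := fun s ω => by
    rcases le_total 0 (f s ω) with h | h
    · rw [max_eq_left h, max_eq_right (by linarith)]; ring
    · rw [max_eq_right h, max_eq_left (by linarith)]; ring
  have b1 : ∀ s ω, |max (f s ω) 0| ≤ C := fun s ω => by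
    rw [abs_of_nonneg (le_max_right _ _)]; exact max_le ((le_abs_self _).trans (hC s ω)) hC0
  have b2 : ∀ s ω, |max (-f s ω) 0| ≤ C := fun s ω => by
    rw [abs_of_nonneg (le_max_right _ _)]; exact max_le ((neg_le_abs _).trans (hC s ω)) hC0
  have bl : ∀ s ω, |lam s ω| ≤ Λ := fun s ω => by
    rw [abs_of_nonneg (h.nonneg s ω)]; exact h.le s ω
  have m1 : ∀ ω, Measurable fun s => max (f s ω) 0 := fun ω => (hsec hf ω).max measurable_const
  have m2 : ∀ ω, Measurable fun s => max (-f s ω) 0 := fun ω => (hsec hf ω).neg.max measurable_const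
  have ml := hsec h.predictable
  have i1 : ∀ ω, ∫ s, f s ω ∂jumpMeasure (fun t => N t ω) T =
      ∫ s, max (f s ω) 0 ∂jumpMeasure (fun t => N t ω) T -
        ∫ s, max (-f s ω) 0 ∂jumpMeasure (fun t => N t ω) T := fun ω => by
    rw [← integral_sub]
    · exact integral_congr_ae (ae_of_all _ fun s => hdec s ω)
    · exact Integrable.of_bound (m1 ω).aestronglyMeasurable C (ae_of_all _ fun s => b1 s ω)
    · exact Integrable.of_bound (m2 ω).aestronglyMeasurable C (ae_of_all _ fun s => b2 s ω)
  have i2 : ∀ ω, ∫ s, f s ω * lam s ω ∂lebesgueUpTo T =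
      ∫ s, max (f s ω) 0 * lam s ω ∂lebesgueUpTo T -
        ∫ s, max (-f s ω) 0 * lam s ω ∂lebesgueUpTo T := fun ω => by
    rw [← integral_sub]
    · exact integral_congr_ae (ae_of_all _ fun s => by
        simp only [← sub_mul, ← hdec])
    · exact Integrable.of_bound ((m1 ω).mul (ml ω)).aestronglyMeasurable (C * Λ) (ae_of_all _ fun s =>
        (norm_mul _ _).trans_le (mul_le_mul (b1 s ω) (bl s ω) (norm_nonneg _) hC0))
    · exact Integrable.of_bound ((m2 ω).mul (ml ω)).aestronglyMeasurable (C * Λ) (ae_of_all _ fun s =>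
        (norm_mul _ _).trans_le (mul_le_mul (b2 s ω) (bl s ω) (norm_nonneg _) hC0))
  simp only [i1, i2]
  refine ⟨p1.sub q1, p2.sub q2, ?_⟩
  rw [integral_sub p1 q1, integral_sub p2 q2, p3, q3]

end HasIntensity

end DynNet

namespace DynNet

variable {Ω : Type*} [mΩ : MeasurableSpace Ω] {ι : Type*} [Fintype ι]
  {ℱ : Filtration ℝ≥0 mΩ} {μ : Measure Ω} {T : ℝ≥0} {N : ι → ℝ≥0 → Ω → ℕ}
  {lam : ι → ℝ≥0 → Ω → ℝ} {Λ : ℝ}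

/-! ### The exponential martingale -/

/-- `∑_u ∫_0^T f_u dN_u - ∫_0^T ∑_u (exp f_u - 1) λ_u ds`. -/
def expExponent (T : ℝ≥0) (N : ι → ℝ≥0 → Ω → ℕ) (lam : ι → ℝ≥0 → Ω → ℝ) (f : ι → ℝ≥0 → Ω → ℝ)
    (ω : Ω) : ℝ :=
  ∑ u, ∫ s, f u s ω ∂jumpMeasure (fun t => N u t ω) T -
    ∫ s, ∑ u, (Real.exp (f u s ω) - 1) * lam u s ω ∂lebesgueUpTo T

lemma measurable_expExponent (h : ∀ u, HasIntensity ℱ μ T (N u) (lam u) Λ) {f : ι → ℝ≥0 → Ω → ℝ}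
    (hf : ∀ u, Measurable[ℱ.predictable] (Function.uncurry (f u))) :
    Measurable (expExponent T N lam f) := by
  refine Measurable.sub ?_ ?_
  · exact Finset.measurable_fun_sum _ fun u _ => (h u).measurable_integral (hf u)
  · refine HasIntensity.measurable_integral_lebesgue (ℱ := ℱ) T ?_
    exact Finset.measurable_fun_sum (f := fun u (p : ℝ≥0 × Ω) => (Real.exp (f u p.1 p.2) - 1) * lam u p.1 p.2) _
      fun u _ => ((hf u).exp.sub_const 1).mul (h u).predictable

/-- The product formula expresses the exponential as `1` plus integrals of the left limit `E` times
`exp f - 1` against the compensated processes. The bound `B` keeps `E` bounded, so these predictable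
integrals have mean zero and a true martingale identity results. -/
lemma integral_exp_eq_one [IsProbabilityMeasure μ]
    (h : ∀ u, HasIntensity ℱ μ T (N u) (lam u) Λ)
    (hdisj : ∀ᵐ ω ∂μ, ∀ u v, u ≠ v →
      Disjoint (jumpTimes (fun t => N u t ω) T) (jumpTimes (fun t => N v t ω) T))
    {f : ι → ℝ≥0 → Ω → ℝ} (hf : ∀ u, Measurable[ℱ.predictable] (Function.uncurry (f u)))
    {a : ℝ} (ha : ∀ u s ω, |f u s ω| ≤ a) {B : ℝ}
    (hB : ∀ s ω, |∑ u, ∫ r in Iio s, f u r ω ∂jumpMeasure (fun t => N u t ω) T| ≤ B) :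
    Integrable (fun ω => Real.exp (expExponent T N lam f ω)) μ ∧
      ∫ ω, Real.exp (expExponent T N lam f ω) ∂μ = 1 := by
  set g : ι → ℝ≥0 → Ω → ℝ := fun u s ω => Real.exp (f u s ω) - 1 with hg
  have hgm : ∀ u, Measurable[ℱ.predictable] (Function.uncurry (g u)) := fun u =>
    (hf u).exp.sub_const 1
  have hgb : ∀ u s ω, |g u s ω| ≤ Real.exp a + 1 := fun u s ω => by
    have h1 := Real.exp_le_exp.2 ((le_abs_self _).trans (ha u s ω))
    have h2 := Real.exp_pos (f u s ω)
    rw [abs_le]; constructor <;> simp only [hg] <;> linarith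
  have hea : 0 ≤ Real.exp a + 1 := by positivity
  have hlb : ∀ u s ω, |lam u s ω| ≤ Λ := fun u s ω => by
    rw [abs_of_nonneg ((h u).nonneg s ω)]; exact (h u).le s ω
  set d : ℝ≥0 → Ω → ℝ := fun s ω => ∑ u, g u s ω * lam u s ω with hd
  have hdm : Measurable[ℱ.predictable] (Function.uncurry d) :=
    Finset.measurable_fun_sum (f := fun u (p : ℝ≥0 × Ω) => g u p.1 p.2 * lam u p.1 p.2) _
      fun u _ => (hgm u).mul (h u).predictable
  set Cd : ℝ := ∑ _u : ι, (Real.exp a + 1) * Λ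
  have hdb : ∀ s ω, |d s ω| ≤ Cd := fun s ω => by
    refine (Finset.abs_sum_le_sum_abs _ _).trans (Finset.sum_le_sum fun u _ => ?_)
    rw [abs_mul]
    exact mul_le_mul (hgb u s ω) (hlb u s ω) (abs_nonneg _) hea
  set E : ℝ≥0 → Ω → ℝ := fun s ω =>
    leftExp (fun u t => N u t ω) T (fun u s => f u s ω) (fun s => d s ω) s with hE
  have hEm : Measurable[ℱ.predictable] (Function.uncurry E) := by
    refine Measurable.exp (Measurable.sub ?_ ?_)
    · exact Finset.measurable_fun_sum (f := fun u (p : ℝ≥0 × Ω) =>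
        ∫ r in Iio p.1, f u r p.2 ∂jumpMeasure (fun t => N u t p.2) T) _
        fun u _ => (isAdaptedMeasure_jumpMeasure (h u).path (h u).adapted T).measurable_integral_Iio
          (hf u) (ha u)
    · exact (isAdaptedMeasure_lebesgueUpTo ℱ T).measurable_integral_Iio hdm hdb
  set CE : ℝ := Real.exp (B + Cd * (lebesgueUpTo T).real univ)
  have hEb : ∀ s ω, |E s ω| ≤ CE := fun s ω => by
    refine (abs_of_pos (Real.exp_pos _)).trans_le ?_
    refine Real.exp_le_exp.2 ?_
    rw [sub_eq_add_neg]
    refine add_le_add ((le_abs_self _).trans (hB s ω)) ((neg_le_abs _).trans ?_)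
    refine (norm_integral_le_of_norm_le_const (μ := (lebesgueUpTo T).restrict (Iio s))
      (f := fun r => d r ω) (ae_of_all _ fun r => hdb r ω)).trans ?_
    have hCd : 0 ≤ Cd := (abs_nonneg _).trans (hdb 0 ω)
    refine mul_le_mul_of_nonneg_left ?_ hCd
    rw [measureReal_restrict_apply MeasurableSet.univ, univ_inter]
    exact measureReal_mono (subset_univ _)
  have hCE : 0 ≤ CE := (Real.exp_pos _).le
  have hsec : ∀ {k : ℝ≥0 → Ω → ℝ} (_ : Measurable[ℱ.predictable] (Function.uncurry k)) ω,
      Measurable fun r => k r ω := fun hk ω =>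
    (hk.mono (predictable_le ℱ) le_rfl).comp measurable_prodMk_right
  have hI := fun u => (h u).integral_eq (f := fun s ω => E s ω * g u s ω) (hEm.mul (hgm u))
    (C := CE * (Real.exp a + 1)) fun s ω => by
      rw [abs_mul]; exact mul_le_mul (hEb s ω) (hgb u s ω) (abs_nonneg _) hCE
  have hpath : ∀ᵐ ω ∂μ, Real.exp (expExponent T N lam f ω) =
      1 + ∑ u, ∫ s, E s ω * g u s ω ∂jumpMeasure (fun t => N u t ω) T -
        ∑ u, ∫ s, E s ω * g u s ω * lam u s ω ∂lebesgueUpTo T := by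
    filter_upwards [hdisj] with ω hω
    have := exp_integral_jumpMeasure (fun u => (h u).path ω) hω (fun u s => f u s ω)
      (d := fun s => d s ω) (hsec hdm ω) (fun s => hdb s ω) (hsec hEm ω)
    refine this.trans ?_
    congr 1
    rw [← integral_finsetSum]
    · refine integral_congr_ae (ae_of_all _ fun s => ?_)
      simp only [hd, Finset.mul_sum, mul_assoc]
      rfl
    · intro u _
      refine Integrable.of_bound (((hsec hEm ω).mul (hsec (hgm u) ω)).mul
        (hsec (h u).predictable ω)).aestronglyMeasurable (CE * (Real.exp a + 1) * Λ)
        (ae_of_all _ fun s => ?_)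
      rw [norm_mul, norm_mul]
      exact mul_le_mul (mul_le_mul (hEb s ω) (hgb u s ω) (norm_nonneg _) hCE) (hlb u s ω)
        (norm_nonneg _) (mul_nonneg hCE hea)
  have i1 : Integrable (fun ω => ∑ u, ∫ s, E s ω * g u s ω ∂jumpMeasure (fun t => N u t ω) T) μ :=
    integrable_finsetSum _ fun u _ => (hI u).1
  have i2 : Integrable (fun ω => ∑ u, ∫ s, E s ω * g u s ω * lam u s ω ∂lebesgueUpTo T) μ :=
    integrable_finsetSum _ fun u _ => (hI u).2.1
  have i0 : Integrable (fun ω => 1 + ∑ u, ∫ s, E s ω * g u s ω ∂jumpMeasure (fun t => N u t ω) T) μ :=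
    (integrable_const (1 : ℝ)).add i1
  refine ⟨(i0.sub i2).congr (hpath.mono fun ω hω => hω.symm), ?_⟩
  rw [integral_congr_ae hpath, integral_sub i0 i2,
    integral_add (integrable_const _) i1, integral_finsetSum _ fun u _ => (hI u).1,
    integral_finsetSum _ fun u _ => (hI u).2.1]
  simp only [(hI _).2.2]
  simp

/-- An integrand that is switched off after `m` jumps is charged at most `m` times: distinct jump
times have distinct numbers of predecessors, so at most `m` of them have fewer than `m`. -/
lemma IsCountingPath.sum_abs_truncated_le {N : ℝ≥0 → ℕ} (hN : IsCountingPath N) (T : ℝ≥0)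
    {f : ℝ≥0 → ℝ} {a : ℝ} (ha : ∀ s, |f s| ≤ a) (m : ℕ)
    (hf : ∀ s, (m : ℝ≥0∞) ≤ jumpMeasure N T (Iio s) → f s = 0) (s : ℝ≥0) :
    |∫ r in Iio s, f r ∂jumpMeasure N T| ≤ m * a := by
  classical
  have ha0 : 0 ≤ a := (abs_nonneg _).trans (ha 0)
  set J := (hN.finite_jumpTimes T).toFinset
  have hcount : ∀ s, jumpMeasure N T (Iio s) = (J.filter (· < s)).card := by
    intro s
    rw [hN.jumpMeasure_apply]
    have : jumpTimes N T ∩ Iio s = ((J.filter (· < s) : Finset ℝ≥0) : Set ℝ≥0) := by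
      ext; simp [J]
    rw [this, Set.encard_coe_eq_coe_finsetCard]
    simp
  set F := J.filter fun x => (J.filter (· < x)).card < m
  have hF : F.card ≤ m := by
    rw [← Finset.card_range m]
    refine Finset.card_le_card_of_injOn (fun x => (J.filter (· < x)).card)
      (fun x hx => by simpa using (Finset.mem_filter.1 hx).2) ?_
    intro x hx y hy hxy
    have hx' : x ∈ J := (Finset.mem_filter.1 hx).1
    have hy' : y ∈ J := (Finset.mem_filter.1 hy).1
    have aux : ∀ {x y}, x ∈ J → x < y → (J.filter (· < x)).card < (J.filter (· < y)).card := by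
      intro x y hx hlt
      refine Finset.card_lt_card ⟨fun z hz => ?_, fun hc => ?_⟩
      · rw [Finset.mem_filter] at hz ⊢
        exact ⟨hz.1, hz.2.trans hlt⟩
      · have := hc (Finset.mem_filter.2 ⟨hx, hlt⟩)
        exact (Finset.mem_filter.1 this).2.false
    rcases lt_trichotomy x y with hl | hl | hl
    · exact absurd hxy (aux hx' hl).ne
    · exact hl
    · exact absurd hxy (aux hy' hl).ne'
  rw [hN.setIntegral_Iio_jumpMeasure]
  calc |∑ r ∈ J with r < s, f r| ≤ ∑ r ∈ J with r < s, |f r| := Finset.abs_sum_le_sum_abs _ _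
    _ ≤ ∑ r ∈ J, |f r| := Finset.sum_le_sum_of_subset_of_nonneg (Finset.filter_subset _ _)
        fun _ _ _ => abs_nonneg _
    _ = ∑ r ∈ F, |f r| := by
        refine (Finset.sum_subset (Finset.filter_subset _ _) fun r hr hrF => ?_).symm
        rw [hf r, abs_zero]
        rw [hcount]
        simp only [Finset.mem_filter, not_and, not_lt] at hrF
        exact_mod_cast hrF hr
    _ ≤ ∑ _r ∈ F, a := Finset.sum_le_sum fun r _ => ha r
    _ = F.card * a := by rw [Finset.sum_const, nsmul_eq_mul]
    _ ≤ m * a := mul_le_mul_of_nonneg_right (Nat.cast_le.2 hF) ha0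

/-- The exponential supermartingale inequality. -/
theorem lintegral_exp_le_one [IsProbabilityMeasure μ]
    (h : ∀ u, HasIntensity ℱ μ T (N u) (lam u) Λ)
    (hdisj : ∀ᵐ ω ∂μ, ∀ u v, u ≠ v →
      Disjoint (jumpTimes (fun t => N u t ω) T) (jumpTimes (fun t => N v t ω) T))
    {f : ι → ℝ≥0 → Ω → ℝ} (hf : ∀ u, Measurable[ℱ.predictable] (Function.uncurry (f u)))
    {a : ℝ} (ha : ∀ u s ω, |f u s ω| ≤ a) :
    ∫⁻ ω, ENNReal.ofReal (Real.exp (expExponent T N lam f ω)) ∂μ ≤ 1 := by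
  classical
  -- Counting only the jumps strictly before `s` keeps the truncation predictable.
  set A : ι → ℕ → Set (ℝ≥0 × Ω) := fun u m =>
    {p | jumpMeasure (fun t => N u t p.2) T (Iio p.1) < m}
  have hA : ∀ u m, MeasurableSet[ℱ.predictable] (A u m) := fun u m => by
    have := (isAdaptedMeasure_jumpMeasure (h u).path (h u).adapted T).measurable_lintegral_Iio
      (f := fun _ => 1) measurable_const
    simp only [lintegral_one, Measure.restrict_apply_univ] at this
    exact this measurableSet_Iio
  set fm : ℕ → ι → ℝ≥0 → Ω → ℝ := fun m u s ω => (A u m).indicator (Function.uncurry (f u)) (s, ω)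
  have hfm : ∀ m u, Measurable[ℱ.predictable] (Function.uncurry (fm m u)) := fun m u =>
    (hf u).indicator (hA u m)
  have hfb : ∀ m u s ω, |fm m u s ω| ≤ a := fun m u s ω => by
    by_cases hp : (s, ω) ∈ A u m
    · simp only [fm, indicator_of_mem hp]; exact ha u s ω
    · simp only [fm, indicator_of_notMem hp, abs_zero]; exact (abs_nonneg _).trans (ha u s ω)
  have hone : ∀ m, ∫⁻ ω, ENNReal.ofReal (Real.exp (expExponent T N lam (fm m) ω)) ∂μ = 1 := by
    intro m
    obtain ⟨h1, h2⟩ := integral_exp_eq_one h hdisj (hfm m) (hfb m) (B := ∑ _u : ι, m * a)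
      fun s ω => (Finset.abs_sum_le_sum_abs _ _).trans (Finset.sum_le_sum fun u _ =>
        ((h u).path ω).sum_abs_truncated_le T (fun s => hfb m u s ω) m
          (fun s hs => indicator_of_notMem
            (show (s, ω) ∉ A u m from fun hc => absurd hc (not_lt.2 hs)) _) s)
    rw [← ofReal_integral_eq_lintegral_ofReal h1 (ae_of_all _ fun ω => (Real.exp_pos _).le), h2,
      ENNReal.ofReal_one]
  -- On each path the truncation is inactive once `m` exceeds all the terminal values `N u T ω`.
  -- Fatou's lemma removes the truncation at the price of an inequality.
  have hlim : ∀ ω, ∀ᶠ m in atTop, expExponent T N lam (fm m) ω = expExponent T N lam f ω := by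
    intro ω
    have : ∀ᶠ m : ℕ in atTop, ∀ u, N u T ω < m :=
      Filter.eventually_all.2 fun u => eventually_gt_atTop _
    filter_upwards [this] with m hm
    have e : ∀ u s, fm m u s ω = f u s ω := fun u s => by
      refine indicator_of_mem (show (s, ω) ∈ A u m from ?_) _
      refine (measure_mono (subset_univ _)).trans_lt ?_
      rw [((h u).path ω).jumpMeasure_univ]
      exact_mod_cast hm u
    simp only [expExponent, e]
  calc ∫⁻ ω, ENNReal.ofReal (Real.exp (expExponent T N lam f ω)) ∂μ
      = ∫⁻ ω, liminf (fun m => ENNReal.ofReal (Real.exp (expExponent T N lam (fm m) ω))) atTop ∂μ := by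
        refine lintegral_congr fun ω => ?_
        rw [liminf_congr (v := fun _ => ENNReal.ofReal (Real.exp (expExponent T N lam f ω)))
          ((hlim ω).mono fun m hm => by rw [hm]), liminf_const]
    _ ≤ liminf (fun m => ∫⁻ ω, ENNReal.ofReal (Real.exp (expExponent T N lam (fm m) ω)) ∂μ) atTop :=
        lintegral_liminf_le fun m => (measurable_expExponent h (hfm m)).exp.ennreal_ofReal
    _ = 1 := by simp only [hone, liminf_const]

end DynNet

namespace DynNet

/-! ### Moment generating functions -/

/-- `5/2` is the value of `A` at which two regimes of `holder_constant_le` are separated; Taylor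
sums of order six suffice. -/
lemma log_five_halves_bounds : 0.91 ≤ Real.log (5 / 2) ∧ Real.log (5 / 2) ≤ 0.92 := by
  constructor
  · rw [Real.le_log_iff_exp_le (by norm_num)]
    refine (Real.exp_bound' (x := 0.91) (by norm_num) (by norm_num) (n := 6) (by norm_num)).trans ?_
    norm_num [Finset.sum_range_succ, Nat.factorial]
  · rw [Real.log_le_iff_le_exp (by norm_num)]
    refine le_trans ?_ (Real.sum_le_exp_of_nonneg (x := 0.92) (by norm_num) 6)
    norm_num [Finset.sum_range_succ, Nat.factorial]

/-- Polynomial facts on `s = τ (1 + τ)` and `t = τ (1 + τ)²`. The factors `0.91` and `0.92` are the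
lower and upper bounds for `log (5/2)`, for use when `A ≥ 5/2` and `A ≤ 5/2` respectively. -/
lemma exponent_poly_bounds {τ : ℝ} (h0 : 0 < τ) (h1 : τ ≤ 1 / 2) :
    1 - τ ^ 2 + 2 / 5 * (τ * (1 + τ) ^ 2) ≤ 1 + (1 - τ * (1 + τ)) * 0.91 ∧
    (τ * (1 + τ) + 5 / 16 * (τ * (1 + τ) ^ 2) - 1) * 0.92 ≤ τ ^ 2 ∧
    τ * (1 + τ) ≤ 3 / 4 ∧ τ * (1 + τ) ^ 2 ≤ 9 / 8 ∧ τ * (1 + τ) ^ 2 ≤ 1 + τ ^ 2 := by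
  have h2 : τ ^ 2 ≤ τ / 2 := by nlinarith
  have h3 : τ ^ 3 ≤ τ ^ 2 / 2 := by nlinarith [mul_nonneg (sq_nonneg τ) (sub_nonneg.2 h1)]
  have h4 : 0 ≤ τ ^ 3 := by positivity
  refine ⟨?_, ?_, ?_, ?_, ?_⟩ <;> ring_nf <;> nlinarith

/-- The elementary inequality behind the choice of the Hölder exponent `1 + τ`. -/
lemma holder_constant_le {τ A ρ F : ℝ} (hτ0 : 0 < τ) (hτ : τ ≤ 1 / 2) (hA : 1 < A) (hρ : A ≤ ρ)
    (hF0 : 0 ≤ F) (hF1 : A * F ≤ 1) (hF2 : A ^ 2 * F ≤ 2) (hF3 : 4 * A * F ≤ ρ * Real.log A) :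
    τ * (1 + τ) ^ 2 * A ^ (τ * (1 + τ)) * F < 2 ∧
    (1 - τ ^ 2) * A ^ (τ * (1 + τ)) ≤
      ρ * (1 - τ * (1 + τ) ^ 2 * A ^ (τ * (1 + τ)) * F / 2) := by
  have hA0 : 0 < A := by linarith
  set s := τ * (1 + τ) with hs
  set t := τ * (1 + τ) ^ 2 with ht
  set l := Real.log A with hl
  obtain ⟨q1, q2, hs1, ht1, ht2⟩ := exponent_poly_bounds hτ0 hτ
  rw [← hs, ← ht] at q1 q2
  rw [← hs] at hs1
  rw [← ht] at ht1 ht2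
  have ht0 : 0 < t := by positivity
  clear_value s t
  have hl0 : 0 < l := Real.log_pos hA
  set P := A ^ s with hP
  have hP0 : 0 < P := Real.rpow_pos_of_pos hA0 _
  -- Since `P * Q = A`, dividing the second claim by `P` leaves the inequality `main`, in which the
  -- power of `A` enters only through `Q ≥ 1 + (1 - s) log A`.
  set Q := A ^ (1 - s) with hQ
  have hPQ : P * Q = A := by
    rw [hP, hQ, ← Real.rpow_add hA0]; simp
  have hQ1 : 1 + (1 - s) * l ≤ Q := by
    rw [hQ, Real.rpow_def_of_pos hA0]
    have := Real.add_one_le_exp (l * (1 - s))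
    linarith
  have hQone : 1 ≤ Q := by
    have : 0 ≤ (1 - s) * l := mul_nonneg (by linarith) hl0.le
    linarith
  clear_value P Q
  set y := A * F with hy
  have hF1' : y ≤ 1 := hF1
  have hy0 : 0 ≤ y := mul_nonneg hA0.le hF0
  set r := ρ / A with hr
  have hr1 : 1 ≤ r := by rw [hr, le_div_iff₀ hA0]; linarith
  have hρr : ρ = r * A := by rw [hr]; field_simp
  have hyA : A * y ≤ 2 := by rw [hy]; linarith [hF2, sq A, mul_assoc A A F]
  have hyr : 4 * y ≤ r * A * l := by rw [← hρr, hy]; linarith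
  have hPF : P * F ≤ 1 := by
    have : P ≤ A := by rw [← hPQ]; exact le_mul_of_one_le_right hP0.le hQone
    exact (mul_le_mul_of_nonneg_right this hF0).trans hF1
  have hPF0 : 0 ≤ P * F := mul_nonneg hP0.le hF0
  refine ⟨?_, ?_⟩
  · rw [mul_assoc]
    have := mul_le_mul ht1 hPF hPF0 (by norm_num)
    linarith
  have htl : 0 ≤ t * l := mul_nonneg ht0.le hl0.le
  have hτ2 : 0 ≤ 1 - τ ^ 2 := by nlinarith
  -- Three regimes: `r ≥ 2`, where `y ≤ 1` is enough; `r < 2` and `A ≥ 5/2`, where `A y ≤ 2` gives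
  -- `y ≤ 4/5`; and `r < 2` and `A ≤ 5/2`, where `y` is controlled by `log A`.
  have main : (1 - τ ^ 2) + r * (t * y / 2) ≤ r * Q := by
    clear_value y r l
    clear hρr hPF hPF0 hF1 hF2 hF3 hP hQ hPQ
    rcases le_or_gt 2 r with h2 | h2
    · have h3 : t * y ≤ t := mul_le_of_le_one_right ht0.le hF1'
      have h4 : 2 * (1 - t / 2) ≤ r * (Q - t * y / 2) :=
        mul_le_mul h2 (by linarith) (by linarith) (by linarith)
      linarith
    obtain ⟨b1, b2⟩ := log_five_halves_bounds
    rcases le_total (5 / 2) A with hA2 | hA2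
    · have hl1 : 0.91 ≤ l := b1.trans (hl ▸ Real.log_le_log (by norm_num) hA2)
      have hy2 : y ≤ 4 / 5 := by nlinarith
      have h1 : t * y ≤ t * (4 / 5) := mul_le_mul_of_nonneg_left hy2 ht0.le
      have h3 : (1 - s) * 0.91 ≤ (1 - s) * l := mul_le_mul_of_nonneg_left hl1 (by linarith)
      have h4 : 1 - τ ^ 2 ≤ Q - t * y / 2 := by linarith
      have h5 := mul_le_mul hr1 h4 hτ2 (by linarith)
      linarith
    · have hl1 : l ≤ 0.92 := (hl ▸ Real.log_le_log hA0 hA2).trans b2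
      have hy3 : y ≤ 5 / 8 * (r * l) := by
        have : A * (r * l) ≤ 5 / 2 * (r * l) :=
          mul_le_mul_of_nonneg_right hA2 (mul_nonneg (by linarith) hl0.le)
        linarith
      -- With `y ≤ 5/8 r l` inserted, the right side minus the coupling term is bounded below by a
      -- concave quadratic in `r ∈ [1, 2]`; `g1` and `g2` are its values at the two endpoints.
      have g1 : 1 - τ ^ 2 ≤ 1 + (1 - s) * l - 5 / 16 * (t * l) := by
        have : (s + 5 / 16 * t - 1) * l ≤ τ ^ 2 := by
          rcases le_total (s + 5 / 16 * t - 1) 0 with hn | hp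
          · exact (mul_nonpos_of_nonpos_of_nonneg hn hl0.le).trans (sq_nonneg τ)
          · exact (mul_le_mul_of_nonneg_left hl1 hp).trans q2
        linarith
      have g2 : 1 - τ ^ 2 ≤ 2 * (1 + (1 - s) * l) - 5 / 4 * (t * l) := by
        have h6 : t * l ≤ 9 / 8 * l := mul_le_mul_of_nonneg_right ht1 hl0.le
        have h7 : (1 / 4) * l ≤ (1 - s) * l := mul_le_mul_of_nonneg_right (by linarith) hl0.le
        linarith [sq_nonneg τ]
      have h6 : r * (t * y / 2) ≤ 5 / 16 * (t * l) * r ^ 2 := by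
        have := mul_le_mul_of_nonneg_left hy3 (mul_nonneg (by linarith : 0 ≤ r) ht0.le)
        linarith
      have h7 : r * (1 + (1 - s) * l) ≤ r * Q := mul_le_mul_of_nonneg_left hQ1 (by linarith)
      have h8 : 0 ≤ t * l * ((r - 1) * (2 - r)) :=
        mul_nonneg htl (mul_nonneg (by linarith) (by linarith))
      have h9 := mul_le_mul_of_nonneg_left g1 (by linarith : 0 ≤ 2 - r)
      have h10 := mul_le_mul_of_nonneg_left g2 (by linarith : 0 ≤ r - 1)
      linarith
  have h1 := mul_le_mul_of_nonneg_left main hP0.le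
  have e1 : P * (r * Q) = ρ := by rw [hρr, ← hPQ]; ring
  have e2 : P * (r * (t * y / 2)) = ρ * (t * P * F / 2) := by rw [hρr, hy]; ring
  rw [mul_add, e1, e2] at h1
  linarith

/-- Equivalent to the Padé bound `exp X ≤ (1 + X/2) / (1 - X/2)`; the difference has derivative
`(exp x (1 - x) - 1) / 2 ≤ 0`. -/
lemma exp_sub_one_le_of_lt_two {X : ℝ} (h0 : 0 ≤ X) (h2 : X < 2) :
    (Real.exp X - 1) * (1 - X / 2) ≤ X := by
  have key : ∀ x ∈ Icc (0 : ℝ) 2, Real.exp x * (1 - x / 2) ≤ 1 + x / 2 := by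
    have hmono : AntitoneOn (fun x : ℝ => Real.exp x * (1 - x / 2) - x / 2) (Icc 0 2) := by
      refine antitoneOn_of_deriv_nonpos (convex_Icc 0 2) (by fun_prop) (by fun_prop) ?_
      intro x hx
      have hd : HasDerivAt (fun x : ℝ => Real.exp x * (1 - x / 2) - x / 2)
          (Real.exp x * (1 - x / 2) + Real.exp x * (-(1 / 2)) - 1 / 2) x := by
        have h1 : HasDerivAt (fun x : ℝ => x / 2) (1 / 2) x := (hasDerivAt_id x).div_const 2
        have h2 : HasDerivAt (fun x : ℝ => 1 - x / 2) (-(1 / 2)) x := by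
          simpa using h1.const_sub 1
        exact ((Real.hasDerivAt_exp x).mul h2).sub h1
      rw [hd.deriv]
      have h3 := Real.add_one_le_exp (-x)
      have h4 : Real.exp x * Real.exp (-x) = 1 := by rw [← Real.exp_add]; simp
      have h5 := mul_le_mul_of_nonneg_left h3 (Real.exp_pos x).le
      rw [h4] at h5
      nlinarith
    intro x hx
    have := hmono (left_mem_Icc.2 (by norm_num)) hx hx.1
    simp at this
    linarith
  have := key X ⟨h0, h2.le⟩
  nlinarith

/-- For `x ≥ 0` the difference of the two sides is monotone. For `x = -y ≤ 0` the left side is no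
larger than its value at `y`, which is `y ≤ sinh y`. -/
lemma exp_sub_one_sub_le (x : ℝ) : Real.exp x - 1 - x ≤ x ^ 2 / 2 * Real.exp |x| := by
  have key : ∀ y : ℝ, 0 ≤ y → Real.exp y - 1 - y ≤ y ^ 2 / 2 * Real.exp y := by
    have hmono : MonotoneOn (fun y : ℝ => y ^ 2 / 2 * Real.exp y - (Real.exp y - 1 - y)) (Ici 0) := by
      refine monotoneOn_of_deriv_nonneg (convex_Ici 0) (by fun_prop) (by fun_prop) ?_
      intro y hy
      rw [interior_Ici, mem_Ioi] at hy
      have hd : HasDerivAt (fun y : ℝ => y ^ 2 / 2 * Real.exp y - (Real.exp y - 1 - y))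
          (y * Real.exp y + y ^ 2 / 2 * Real.exp y - (Real.exp y - 1)) y := by
        have h1 : HasDerivAt (fun y : ℝ => y ^ 2 / 2) y y := by
          convert! (hasDerivAt_pow 2 y).div_const 2 using 1
          simp
        exact (h1.mul (Real.hasDerivAt_exp y)).sub
          (((Real.hasDerivAt_exp y).sub_const 1).sub (hasDerivAt_id y))
      rw [hd.deriv]
      have h3 := Real.add_one_le_exp (-y)
      have h4 : Real.exp y * Real.exp (-y) = 1 := by rw [← Real.exp_add]; simp
      have h5 := mul_le_mul_of_nonneg_left h3 (Real.exp_pos y).le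
      rw [h4] at h5
      have h6 : 0 ≤ y ^ 2 / 2 * Real.exp y := by positivity
      linarith
    intro y hy
    have := hmono (self_mem_Ici (a := (0 : ℝ))) hy hy
    simp at this
    linarith
  rcases le_total 0 x with hx | hx
  · rw [abs_of_nonneg hx]; exact key x hx
  · rw [abs_of_nonpos hx]
    have h1 := key (-x) (by linarith)
    have h2 := Real.self_le_sinh_iff.2 (by linarith : 0 ≤ -x)
    rw [Real.sinh_eq, neg_neg] at h2
    rw [neg_sq] at h1
    linarith

/-- A Hölder bound for an exponential moment in terms of the compensator. -/
lemma lintegral_exp_le_of_compensator {Ω : Type*} [MeasurableSpace Ω] {μ : Measure Ω}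
    [IsProbabilityMeasure μ] {Y Ψ W : Ω → ℝ} (hY : Measurable Y) (hΨ : Measurable Ψ)
    (hW : Measurable W) {τ g B e : ℝ} (hτ : 0 < τ) (hg : 0 ≤ g) (hB : 0 < B)
    (hexp : ∫⁻ ω, ENNReal.ofReal (Real.exp ((1 + τ) * Y ω - Ψ ω)) ∂μ ≤ 1)
    (hΨW : ∀ᵐ ω ∂μ, Ψ ω ≤ g * W ω) (hW0 : ∀ᵐ ω ∂μ, 0 ≤ W ω) (hWB : ∀ᵐ ω ∂μ, W ω ≤ B)
    (he : ∫ ω, W ω ∂μ ≤ e) :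
    ∫⁻ ω, ENNReal.ofReal (Real.exp (Y ω)) ∂μ ≤
      ENNReal.ofReal (1 + τ / (1 + τ) * ((Real.exp (g / τ * B) - 1) / B * e)) := by
  have hWint : Integrable W μ := Integrable.of_bound hW.aestronglyMeasurable B (by
    filter_upwards [hW0, hWB] with ω h0 h1
    rwa [Real.norm_of_nonneg h0])
  have hpq : (1 + τ).HolderConjugate ((1 + τ) / τ) := by
    rw [Real.holderConjugate_iff]
    refine ⟨by linarith, ?_⟩
    field_simp
  set k := (Real.exp (g / τ * B) - 1) / B
  have hk : 0 ≤ k := div_nonneg (by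
    have := Real.add_one_le_exp (g / τ * B)
    have : 0 ≤ g / τ * B := by positivity
    linarith) hB.le
  have he0 : 0 ≤ e := (integral_nonneg_of_ae hW0).trans he
  have hexpW : ∫⁻ ω, ENNReal.ofReal (Real.exp (g / τ * W ω)) ∂μ ≤ ENNReal.ofReal (1 + k * e) := by
    -- On `[0, B]` the convex exponential lies below its chord. This makes the bound linear in `W`,
    -- so that only the mean of `W` matters.
    have h1 : ∀ᵐ ω ∂μ, Real.exp (g / τ * W ω) ≤ 1 + k * W ω := by
      filter_upwards [hW0, hWB] with ω h0 h1
      have hc := convexOn_exp.2 (mem_univ 0) (mem_univ (g / τ * B))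
        (by rw [sub_nonneg, div_le_one hB]; exact h1 : 0 ≤ 1 - W ω / B)
        (by positivity : 0 ≤ W ω / B) (by ring)
      simp only [smul_eq_mul, mul_zero, zero_add, Real.exp_zero, mul_one] at hc
      have e1 : W ω / B * (g / τ * B) = g / τ * W ω := by field_simp
      rw [e1] at hc
      refine hc.trans (le_of_eq ?_)
      simp only [k]
      field_simp
      ring
    calc ∫⁻ ω, ENNReal.ofReal (Real.exp (g / τ * W ω)) ∂μ
        ≤ ∫⁻ ω, ENNReal.ofReal (1 + k * W ω) ∂μ :=
          lintegral_mono_ae (h1.mono fun ω h => ENNReal.ofReal_le_ofReal h)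
      _ = ENNReal.ofReal (∫ ω, (1 + k * W ω) ∂μ) := by
          rw [ofReal_integral_eq_lintegral_ofReal (f := fun ω => 1 + k * W ω)
            ((integrable_const _).add (hWint.const_mul k))]
          filter_upwards [hW0] with ω h0
          simp only [Pi.zero_apply]
          positivity
      _ ≤ ENNReal.ofReal (1 + k * e) := by
          refine ENNReal.ofReal_le_ofReal ?_
          rw [integral_add (integrable_const _) (hWint.const_mul k), integral_const_mul]
          simp only [integral_const, probReal_univ, smul_eq_mul, one_mul, add_le_add_iff_left]
          exact mul_le_mul_of_nonneg_left he hk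
  -- `exp Y` is bounded by the `(1 + τ)`-th root of the exponential martingale times `exp (g W / (1
  -- + τ))`; the conjugate exponent `(1 + τ) / τ` turns the latter into `exp (g W / τ)`.
  have hHol := ENNReal.lintegral_mul_le_Lp_mul_Lq μ hpq
    (f := fun ω => ENNReal.ofReal (Real.exp (((1 + τ) * Y ω - Ψ ω) / (1 + τ))))
    (g := fun ω => ENNReal.ofReal (Real.exp (g * W ω / (1 + τ))))
    (by fun_prop) (by fun_prop)
  have hτ1 : (1 + τ) ≠ 0 := by positivity
  have e1 : ∀ ω, ENNReal.ofReal (Real.exp (((1 + τ) * Y ω - Ψ ω) / (1 + τ))) ^ (1 + τ) =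
      ENNReal.ofReal (Real.exp ((1 + τ) * Y ω - Ψ ω)) := fun ω => by
    rw [ENNReal.ofReal_rpow_of_pos (Real.exp_pos _), ← Real.exp_mul, div_mul_cancel₀ _ hτ1]
  have e2 : ∀ ω, ENNReal.ofReal (Real.exp (g * W ω / (1 + τ))) ^ ((1 + τ) / τ) =
      ENNReal.ofReal (Real.exp (g / τ * W ω)) := fun ω => by
    rw [ENNReal.ofReal_rpow_of_pos (Real.exp_pos _), ← Real.exp_mul]
    congr 2
    field_simp
  simp only [e1, e2] at hHol
  calc ∫⁻ ω, ENNReal.ofReal (Real.exp (Y ω)) ∂μ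
      ≤ ∫⁻ ω, ENNReal.ofReal (Real.exp (((1 + τ) * Y ω - Ψ ω) / (1 + τ))) *
          ENNReal.ofReal (Real.exp (g * W ω / (1 + τ))) ∂μ := by
        refine lintegral_mono_ae (hΨW.mono fun ω h => ?_)
        rw [← ENNReal.ofReal_mul (Real.exp_pos _).le, ← Real.exp_add]
        refine ENNReal.ofReal_le_ofReal (Real.exp_le_exp.2 ?_)
        rw [← add_div, le_div_iff₀ (by positivity)]
        linarith
    _ ≤ _ := hHol
    _ ≤ 1 ^ (1 / (1 + τ)) * ENNReal.ofReal (1 + k * e) ^ (1 / ((1 + τ) / τ)) := by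
        gcongr
    _ = ENNReal.ofReal ((1 + k * e) ^ (τ / (1 + τ))) := by
        rw [ENNReal.one_rpow, one_mul, one_div_div, ENNReal.ofReal_rpow_of_pos (by positivity)]
    -- Bernoulli's inequality for the exponent `τ / (1 + τ) ≤ 1`.
    _ ≤ ENNReal.ofReal (1 + τ / (1 + τ) * (k * e)) := by
        refine ENNReal.ofReal_le_ofReal ?_
        refine rpow_one_add_le_one_add_mul_self (by nlinarith [mul_nonneg hk he0])
          (by positivity) ?_
        rw [div_le_one (by positivity)]
        linarith

end DynNet

/-! ### The constants in the Bernstein bound -/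

namespace DynNet

/-- The condition with the exponential says `√2 / (A √Λ) ≤ log A`. Multiplying the size of one jump
in the exponent by `B √h ≥ 1` and inserting the definition of `τ` produces exactly `√2 / (A √Λ) *
τ`, so a single jump costs at most a power of `A`. -/
lemma jump_bound_le {Kb Khat Λ h A B τ θ : ℝ} (hKb : 0 < Kb) (hKhat : 0 < Khat) (hΛ : 0 < Λ)
    (hh : 0 < h) (hA : 0 < A) (hA2 : 1 / A * Real.exp (√2 / (A * √Λ)) ≤ 1)
    (hB : 1 ≤ B * √h) (hθ : |θ| * (√(Λ / (2 * h)) * Kb * Khat * A * B) = τ) :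
    √2 / (A * √Λ) ≤ Real.log A ∧
      Real.exp ((1 + τ) * |θ| * (Kb * Khat / h)) ≤ A ^ (τ * (1 + τ)) := by
  have hlog : √2 / (A * √Λ) ≤ Real.log A := by
    rw [Real.le_log_iff_exp_le hA]
    rwa [one_div, inv_mul_le_iff₀ hA, mul_one] at hA2
  refine ⟨hlog, ?_⟩
  have hsh : 0 < √h := Real.sqrt_pos.2 hh
  have hsL : 0 < √Λ := Real.sqrt_pos.2 hΛ
  have hs2 : 0 < √(2 : ℝ) := by positivity
  have hB0 : 0 < B := pos_of_mul_pos_left (by linarith) hsh.le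
  have hroot : √(Λ / (2 * h)) = √Λ / (√2 * √h) := by
    rw [Real.sqrt_div hΛ.le, Real.sqrt_mul (by norm_num)]
  have hhh : √h * √h = h := Real.mul_self_sqrt hh.le
  have h22 : √2 * √2 = (2 : ℝ) := Real.mul_self_sqrt (by norm_num)
  have hτ : 0 ≤ τ := by rw [← hθ]; positivity
  rw [Real.rpow_def_of_pos hA, Real.exp_le_exp]
  have key : |θ| * (Kb * Khat / h) ≤ Real.log A * τ := by
    calc |θ| * (Kb * Khat / h) = |θ| * (Kb * Khat / h) * 1 := by ring
      _ ≤ |θ| * (Kb * Khat / h) * (B * √h) := by gcongr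
      _ = √2 / (A * √Λ) * τ := by
          rw [← hθ, hroot]
          field_simp
          rw [sq, hhh]
      _ ≤ Real.log A * τ := by gcongr
  nlinarith

/-- The Bernstein form of the bound of `lintegral_exp_le_of_compensator`. -/
lemma holder_bound_le_exp {Kb Khat Λ h A B τ θ E : ℝ} (hKb : 1 / 2 ≤ Kb) (hKhat : 0 < Khat)
    (hΛ : 0 < Λ) (hh : 0 < h) (hh1 : h ≤ 1) (hA : 0 < A)
    (hA1 : max (max √Khat Khat) (max (1 / Kb) √((2 : ℝ) ^ (3 / 2 : ℝ) * √Λ * (Khat / Kb))) ≤ A)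
    (hA2 : 1 / A * Real.exp (√2 / (A * √Λ)) ≤ 1) (hB : 1 ≤ B * √h) (hE : 0 ≤ E)
    (hτ0 : 0 < τ) (hτ : τ ≤ 1 / 2) (hθ : |θ| * (√(Λ / (2 * h)) * Kb * Khat * A * B) = τ) :
    1 + τ / (1 + τ) * ((Real.exp (((1 + τ) ^ 2 * θ ^ 2 / 2 * A ^ (τ * (1 + τ)) *
      (Kb * Khat ^ 2 * Λ / h)) / τ * B) - 1) / B * E) ≤
      Real.exp (θ ^ 2 * (1 / h * Λ * A ^ 2 * Kb * Khat * E) / (2 * (1 - τ))) := by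
  have hKb0 : 0 < Kb := by linarith
  obtain ⟨hlog, -⟩ := jump_bound_le hKb0 hKhat hΛ hh hA hA2 hB hθ
  simp only [max_le_iff] at hA1
  obtain ⟨⟨-, hAK⟩, hAKb, hA3⟩ := hA1
  have hsh : 0 < √h := Real.sqrt_pos.2 hh
  have hsL : 0 < √Λ := Real.sqrt_pos.2 hΛ
  have hB0 : 0 < B := pos_of_mul_pos_left (by linarith) hsh.le
  have hB1 : 1 ≤ B := by
    have : √h ≤ 1 := Real.sqrt_le_one.2 hh1
    nlinarith
  have hAgt : 1 < A := by
    have : 0 < Real.log A := lt_of_lt_of_le (by positivity) hlog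
    exact (Real.log_pos_iff hA.le).1 this
  -- With these parameters the conditions become the hypotheses of `holder_constant_le`: `Khat ≤ A`
  -- gives `A ≤ ρ`, `1 / Kb ≤ A` gives `A F ≤ 1`, `Kb ≥ 1/2` gives `A² F ≤ 2`, and the square-root
  -- condition combined with `hlog` gives `4 A F ≤ ρ log A`.
  set ρ := A ^ 2 / Khat with hρ
  set F := 1 / (Kb * A ^ 2) with hF
  have hρA : A ≤ ρ := by rw [hρ, le_div_iff₀ hKhat]; nlinarith
  have hF0 : 0 ≤ F := by positivity
  have hF1 : A * F ≤ 1 := by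
    have : A * F = 1 / Kb / A := by rw [hF]; field_simp
    rw [this, div_le_one hA]; exact hAKb
  have hF2 : A ^ 2 * F ≤ 2 := by
    have : A ^ 2 * F = 1 / Kb := by rw [hF]; field_simp
    rw [this, div_le_iff₀ hKb0]; linarith
  have hF3 : 4 * A * F ≤ ρ * Real.log A := by
    have h32 : (2 : ℝ) ^ (3 / 2 : ℝ) = 2 * √2 := by
      rw [Real.sqrt_eq_rpow, ← Real.rpow_one_add' (by norm_num) (by norm_num)]; norm_num
    rw [Real.sqrt_le_left hA.le, h32] at hA3
    have h22 : √2 * √2 = (2 : ℝ) := Real.mul_self_sqrt (by norm_num)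
    calc 4 * A * F = (2 * √2 * √Λ * (Khat / Kb)) / Khat * (√2 / (A * √Λ)) := by
          rw [hF]; field_simp; rw [sq, h22]; norm_num
      _ ≤ ρ * Real.log A := by rw [hρ]; gcongr
  obtain ⟨hX2, hX⟩ := holder_constant_le hτ0 hτ hAgt hρA hF0 hF1 hF2 hF3
  set P := A ^ (τ * (1 + τ)) with hP
  have hP0 : 0 < P := Real.rpow_pos_of_pos hA _
  set X := τ * (1 + τ) ^ 2 * P * F with hXdef
  set v := Kb * Khat ^ 2 * Λ / h with hv
  have hv0 : 0 < v := by positivity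
  have hθ2 : θ ^ 2 * v / 2 = τ ^ 2 * F / B ^ 2 := by
    have h1 : √(Λ / (2 * h)) ^ 2 = Λ / (2 * h) := Real.sq_sqrt (by positivity)
    rw [← hθ, mul_pow, sq_abs, mul_pow, mul_pow, mul_pow, mul_pow, h1, hv, hF]
    field_simp
  -- The Hölder exponent is `X / B`. It is at most `X < 2` because `B ≥ 1`, which puts it in the
  -- range of the Padé bound.
  have hY : (1 + τ) ^ 2 * θ ^ 2 / 2 * P * v / τ * B = X / B := by
    have : (1 + τ) ^ 2 * θ ^ 2 / 2 * P * v = (1 + τ) ^ 2 * P * (θ ^ 2 * v / 2) := by ring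
    rw [this, hθ2, hXdef]
    field_simp
  rw [hY]
  have hX0 : 0 ≤ X := by positivity
  have hYX : X / B ≤ X := div_le_self hX0 hB1
  have h1X : 0 < 1 - X / 2 := by linarith
  have hexp : Real.exp (X / B) - 1 ≤ X / B / (1 - X / 2) := by
    rw [le_div_iff₀ h1X]
    have h0 : 0 ≤ Real.exp (X / B) - 1 := by
      have := Real.add_one_le_exp (X / B)
      have : 0 ≤ X / B := by positivity
      linarith
    refine le_trans ?_ (exp_sub_one_le_of_lt_two (by positivity) (hYX.trans_lt hX2))
    gcongr
  have hmain : (1 + τ) * P / (1 - X / 2) ≤ ρ / (1 - τ) := by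
    rw [div_le_div_iff₀ h1X (by linarith)]
    nlinarith
  have hfin : τ / (1 + τ) * ((Real.exp (X / B) - 1) / B * E) ≤
      θ ^ 2 * (1 / h * Λ * A ^ 2 * Kb * Khat * E) / (2 * (1 - τ)) := by
    calc τ / (1 + τ) * ((Real.exp (X / B) - 1) / B * E)
        ≤ τ / (1 + τ) * (X / B / (1 - X / 2) / B * E) := by gcongr
      _ = (τ ^ 2 * F / B ^ 2) * E * ((1 + τ) * P / (1 - X / 2)) := by
          rw [hXdef]; field_simp
      _ ≤ (τ ^ 2 * F / B ^ 2) * E * (ρ / (1 - τ)) := by gcongr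
      _ = θ ^ 2 * (1 / h * Λ * A ^ 2 * Kb * Khat * E) / (2 * (1 - τ)) := by
          have : 1 - τ ≠ 0 := by linarith
          rw [← hθ2, hρ, hv]; field_simp
  have := Real.add_one_le_exp (θ ^ 2 * (1 / h * Λ * A ^ 2 * Kb * Khat * E) / (2 * (1 - τ)))
  linarith

end DynNet

namespace DynNet

/-! ### Sums of weakly dependent variables -/

section Mixing

lemma abs_sub_le_betaMixing {Ω : Type*} {𝒜 ℬ : MeasurableSpace Ω} [mΩ : MeasurableSpace Ω]
    {μ : Measure Ω} [IsProbabilityMeasure μ] {S : Set (Ω × Ω)}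
    (hS : MeasurableSet[𝒜.prod ℬ] S) :
    |μ.real {ω | (ω, ω) ∈ S} - (μ.prod μ).real S| ≤ betaMixing 𝒜 ℬ μ := by
  refine le_ciSup (f := fun S : {S : Set (Ω × Ω) // MeasurableSet[𝒜.prod ℬ] S} =>
    |μ.real {ω | (ω, ω) ∈ S.1} - (μ.prod μ).real S.1|) ⟨1, ?_⟩ ⟨S, hS⟩
  rintro _ ⟨S, rfl⟩
  rw [abs_le]
  have h1 : μ.real {ω | (ω, ω) ∈ S.1} ≤ 1 := measureReal_le_one
  have h2 : (μ.prod μ).real S.1 ≤ 1 := measureReal_le_one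
  have h3 : 0 ≤ μ.real {ω | (ω, ω) ∈ S.1} := measureReal_nonneg
  have h4 : 0 ≤ (μ.prod μ).real S.1 := measureReal_nonneg
  constructor <;> linarith

lemma betaMixing_nonneg {Ω : Type*} (𝒜 ℬ : MeasurableSpace Ω) [mΩ : MeasurableSpace Ω]
    {μ : Measure Ω} [IsProbabilityMeasure μ] : 0 ≤ betaMixing 𝒜 ℬ μ :=
  (abs_nonneg _).trans (abs_sub_le_betaMixing (𝒜 := 𝒜) (ℬ := ℬ) (@MeasurableSet.empty _ (𝒜.prod ℬ)))

variable {Ω : Type*} [mΩ : MeasurableSpace Ω] {μ : Measure Ω} [IsProbabilityMeasure μ]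

/-- The distribution of the sum of independent copies of `V 0, …, V (j - 1)`. -/
def convLaw (μ : Measure Ω) (V : ℕ → Ω → ℝ) : ℕ → Measure ℝ
  | 0 => Measure.dirac 0
  | j + 1 => (convLaw μ V j).conv (μ.map (V j))

lemma isProbabilityMeasure_convLaw {V : ℕ → Ω → ℝ} (hV : ∀ j, Measurable (V j)) (j : ℕ) :
    IsProbabilityMeasure (convLaw μ V j) := by
  induction j with
  | zero => exact Measure.dirac.isProbabilityMeasure
  | succ j ih =>
    have := Measure.isProbabilityMeasure_map (μ := μ) (hV j).aemeasurable
    exact inferInstanceAs (IsProbabilityMeasure ((convLaw μ V j).conv (μ.map (V j))))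

lemma lintegral_exp_convLaw_le {V : ℕ → Ω → ℝ} (hV : ∀ j, Measurable (V j)) (θ : ℝ) {e : ℕ → ℝ}
    {r : ℕ} (he : ∀ j < r, ∫⁻ ω, ENNReal.ofReal (Real.exp (θ * V j ω)) ∂μ ≤
      ENNReal.ofReal (Real.exp (e j))) :
    ∫⁻ x, ENNReal.ofReal (Real.exp (θ * x)) ∂convLaw μ V r ≤
      ENNReal.ofReal (Real.exp (∑ j ∈ Finset.range r, e j)) := by
  induction r with
  | zero => simp [convLaw]
  | succ r ih =>
    have h1 := isProbabilityMeasure_convLaw (μ := μ) hV r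
    have h2 := Measure.isProbabilityMeasure_map (μ := μ) (hV r).aemeasurable
    rw [convLaw, Measure.lintegral_conv (by fun_prop)]
    simp only [mul_add, Real.exp_add, ENNReal.ofReal_mul (Real.exp_pos _).le]
    have h3 : ∀ x, ∫⁻ y, ENNReal.ofReal (Real.exp (θ * x)) * ENNReal.ofReal (Real.exp (θ * y))
        ∂μ.map (V r) = ENNReal.ofReal (Real.exp (θ * x)) *
          ∫⁻ ω, ENNReal.ofReal (Real.exp (θ * V r ω)) ∂μ := fun x => by
      rw [lintegral_const_mul _ (by fun_prop), lintegral_map (by fun_prop) (hV r)]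
    simp only [h3]
    rw [lintegral_mul_const _ (by fun_prop), Finset.sum_range_succ, Real.exp_add,
      ENNReal.ofReal_mul (Real.exp_pos _).le]
    exact mul_le_mul' (ih fun j hj => he j (hj.trans (Nat.lt_succ_self r)))
      (he r (Nat.lt_succ_self r))

/-- The last summand is decoupled from the past at cost `β`, since `{A + V_r ∈ S}` pulls back an
event of the product σ-algebra. Given the value `y` of the decoupled summand, the induction
hypothesis applies to the shifted set `S - y`. That hypothesis must therefore hold for all Borel
sets, with an error uniform in them. -/
lemma abs_sub_convLaw_le {V : ℕ → Ω → ℝ} (hV : ∀ j, Measurable (V j)) {β : ℝ} {r : ℕ}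
    (hβ : ∀ j < r, betaMixing (⨆ i, ⨆ (_ : i < j), MeasurableSpace.comap (V i) inferInstance)
      (MeasurableSpace.comap (V j) inferInstance) μ ≤ β) {S : Set ℝ} (hS : MeasurableSet S) :
    |μ.real {ω | ∑ i ∈ Finset.range r, V i ω ∈ S} - (convLaw μ V r).real S| ≤ r * β := by
  induction r generalizing S with
  | zero =>
    by_cases h : (0 : ℝ) ∈ S
    · simp [convLaw, h, measureReal_def, hS]
    · simp [convLaw, h, measureReal_def, hS]
  | succ r ih =>
    have h1 := isProbabilityMeasure_convLaw (μ := μ) hV r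
    have h2 := Measure.isProbabilityMeasure_map (μ := μ) (hV r).aemeasurable
    set A : Ω → ℝ := fun ω => ∑ i ∈ Finset.range r, V i ω with hA
    have hAm : Measurable A := Finset.measurable_fun_sum _ fun i _ => hV i
    have h3 := Measure.isProbabilityMeasure_map (μ := μ) hAm.aemeasurable
    have step1 : |μ.real {ω | ∑ i ∈ Finset.range (r + 1), V i ω ∈ S} -
        ((μ.map A).conv (μ.map (V r))).real S| ≤ β := by
      have hA' : Measurable[⨆ i, ⨆ (_ : i < r), MeasurableSpace.comap (V i) inferInstance] A := by
        refine Finset.measurable_fun_sum _ fun i hi => ?_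
        refine (comap_measurable (V i)).mono ?_ le_rfl
        exact le_iSup₂_of_le (f := fun i (_ : i < r) =>
          MeasurableSpace.comap (V i) inferInstance) i (Finset.mem_range.1 hi) le_rfl
      have hSm : MeasurableSet[MeasurableSpace.prod
          (⨆ i, ⨆ (_ : i < r), MeasurableSpace.comap (V i) inferInstance)
          (MeasurableSpace.comap (V r) inferInstance)] {p : Ω × Ω | A p.1 + V r p.2 ∈ S} := by
        have m1 : Measurable[MeasurableSpace.prod
          (⨆ i, ⨆ (_ : i < r), MeasurableSpace.comap (V i) inferInstance)
          (MeasurableSpace.comap (V r) inferInstance)] fun p : Ω × Ω => A p.1 :=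
            hA'.comp (@measurable_fst Ω Ω _ _)
        have m2 : Measurable[MeasurableSpace.prod
          (⨆ i, ⨆ (_ : i < r), MeasurableSpace.comap (V i) inferInstance)
          (MeasurableSpace.comap (V r) inferInstance)] fun p : Ω × Ω => V r p.2 :=
            (comap_measurable (V r)).comp (@measurable_snd Ω Ω _ _)
        exact (m1.add m2) hS
      refine le_trans (le_of_eq ?_) ((abs_sub_le_betaMixing (μ := μ) hSm).trans
        (hβ r (Nat.lt_succ_self r)))
      congr 2
      · simp only [Finset.sum_range_succ, mem_ofPred_eq, hA]
      · rw [Measure.conv, measureReal_def, Measure.map_apply (by fun_prop) hS,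
          Measure.map_prod_map _ _ hAm (hV r), Measure.map_apply (hAm.prodMap (hV r))
          ((by fun_prop : Measurable fun p : ℝ × ℝ => p.1 + p.2) hS)]
        rfl
    have hconv : ∀ ρ : Measure ℝ, IsProbabilityMeasure ρ → (ρ.conv (μ.map (V r))).real S =
        ∫ y, ρ.real {x | x + y ∈ S} ∂μ.map (V r) ∧
        Integrable (fun y => ρ.real {x | x + y ∈ S}) (μ.map (V r)) := by
      intro ρ hρ
      have hm : MeasurableSet {p : ℝ × ℝ | p.1 + p.2 ∈ S} :=
        (by fun_prop : Measurable fun p : ℝ × ℝ => p.1 + p.2) hS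
      have hm2 : Measurable fun y => ρ {x | x + y ∈ S} := measurable_measure_prodMk_right hm
      constructor
      · rw [Measure.conv, measureReal_def, Measure.map_apply (by fun_prop) hS,
          Measure.prod_apply_symm (by exact hm)]
        simp only [measureReal_def]
        rw [integral_toReal (by exact hm2.aemeasurable) (ae_of_all _ fun y => measure_lt_top _ _)]
        rfl
      · refine Integrable.of_bound hm2.ennreal_toReal.aestronglyMeasurable 1
          (ae_of_all _ fun y => ?_)
        rw [Real.norm_of_nonneg measureReal_nonneg]
        exact measureReal_le_one
    have step2 : |((μ.map A).conv (μ.map (V r))).real S - (convLaw μ V (r + 1)).real S| ≤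
        r * β := by
      obtain ⟨e1, i1⟩ := hconv _ h3
      obtain ⟨e2, i2⟩ := hconv _ h1
      rw [convLaw, e1, e2, ← integral_sub i1 i2]
      have := norm_integral_le_of_norm_le_const (μ := μ.map (V r))
        (f := fun y => (μ.map A).real {x | x + y ∈ S} - (convLaw μ V r).real {x | x + y ∈ S})
        (C := r * β) (ae_of_all _ fun y => ?_)
      · simpa using this
      · have hSy : MeasurableSet {x | x + y ∈ S} :=
          (by fun_prop : Measurable fun x : ℝ => x + y) hS
        rw [map_measureReal_apply hAm hSy]
        exact ih (fun j hj => hβ j (hj.trans (Nat.lt_succ_self r))) hSy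
    have := abs_sub_le (μ.real {ω | ∑ i ∈ Finset.range (r + 1), V i ω ∈ S})
      (((μ.map A).conv (μ.map (V r))).real S) ((convLaw μ V (r + 1)).real S)
    push_cast
    linarith

/-- The usual Bernstein choice `θ = y / (s + b y)` is admissible, that is `θ b ≤ 1/2`, exactly when
`b y ≤ s`. Beyond that, the extreme value `θ = 1 / (2 b)` still gives the same bound, and `s ≤ b y`
is just what the comparison needs. -/
lemma measureReal_Ici_le_exp {ν : Measure ℝ} [IsProbabilityMeasure ν] {s b y : ℝ} (hs : 0 < s)
    (hb : 0 < b) (hy : 0 < y)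
    (h : ∀ θ, 0 < θ → θ * b ≤ 1 / 2 → ∫⁻ x, ENNReal.ofReal (Real.exp (θ * x)) ∂ν ≤
      ENNReal.ofReal (Real.exp (θ ^ 2 * s / (2 * (1 - θ * b))))) :
    ν.real (Ici y) ≤ Real.exp (-(y ^ 2 / (2 * (s + b * y)))) := by
  have hby : 0 < b * y := mul_pos hb hy
  have cher : ∀ θ, 0 < θ → θ * b ≤ 1 / 2 →
      ν.real (Ici y) ≤ Real.exp (θ ^ 2 * s / (2 * (1 - θ * b)) - θ * y) := by
    intro θ h0 h1
    have hm := mul_meas_ge_le_lintegral₀ (μ := ν)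
      (f := fun x => ENNReal.ofReal (Real.exp (θ * x))) (by fun_prop)
      (ENNReal.ofReal (Real.exp (θ * y)))
    have hset : {x : ℝ | ENNReal.ofReal (Real.exp (θ * y)) ≤ ENNReal.ofReal (Real.exp (θ * x))} =
        Ici y := by
      ext x
      rw [mem_ofPred_eq, ENNReal.ofReal_le_ofReal_iff (Real.exp_pos _).le, Real.exp_le_exp,
        mul_le_mul_iff_right₀ h0, mem_Ici]
    rw [hset] at hm
    have := ENNReal.toReal_mono ENNReal.ofReal_ne_top (hm.trans (h θ h0 h1))
    rw [ENNReal.toReal_mul, ENNReal.toReal_ofReal (Real.exp_pos _).le,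
      ENNReal.toReal_ofReal (Real.exp_pos _).le] at this
    rw [Real.exp_sub, le_div_iff₀ (Real.exp_pos _), mul_comm]
    exact this
  rcases le_or_gt (b * y) s with hc | hc
  · have hτ : y / (s + b * y) * b ≤ 1 / 2 := by
      rw [div_mul_eq_mul_div, div_le_iff₀ (by positivity)]; linarith
    refine (cher (y / (s + b * y)) (by positivity) hτ).trans (Real.exp_le_exp.2 (le_of_eq ?_))
    have : 1 - y / (s + b * y) * b = s / (s + b * y) := by field_simp; ring
    rw [this]
    field_simp
    ring
  · refine (cher (1 / (2 * b)) (by positivity) (le_of_eq (by field_simp))).trans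
      (Real.exp_le_exp.2 ?_)
    have h1 : (1 / (2 * b)) ^ 2 * s / (2 * (1 - 1 / (2 * b) * b)) - 1 / (2 * b) * y =
        (s - 2 * (b * y)) / (4 * b ^ 2) := by field_simp; ring
    rw [h1, ← neg_div, div_le_div_iff₀ (by positivity) (by positivity)]
    nlinarith [mul_pos hs hby, mul_nonneg hs.le (sub_nonneg.2 hc.le)]

/-- Bernstein's inequality for `β`-mixing variables. -/
theorem measureReal_abs_sum_ge_le {V : ℕ → Ω → ℝ} (hV : ∀ j, Measurable (V j)) {β : ℝ} {r : ℕ}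
    (hβ : ∀ j < r, betaMixing (⨆ i, ⨆ (_ : i < j), MeasurableSpace.comap (V i) inferInstance)
      (MeasurableSpace.comap (V j) inferInstance) μ ≤ β) {s : ℕ → ℝ} {b y : ℝ}
    (hs : 0 < ∑ j ∈ Finset.range r, s j) (hb : 0 < b) (hy : 0 < y)
    (h : ∀ θ, 0 < |θ| → |θ| * b ≤ 1 / 2 → ∀ j < r, ∫⁻ ω, ENNReal.ofReal (Real.exp (θ * V j ω)) ∂μ ≤
      ENNReal.ofReal (Real.exp (θ ^ 2 * s j / (2 * (1 - |θ| * b))))) :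
    μ.real {ω | y ≤ |∑ j ∈ Finset.range r, V j ω|} ≤
      2 * Real.exp (-(y ^ 2 / (2 * (∑ j ∈ Finset.range r, s j + b * y)))) + r * β := by
  have hp := isProbabilityMeasure_convLaw (μ := μ) hV r
  have hm : MeasurableSet {x : ℝ | y ≤ |x|} := measurableSet_le (by fun_prop) (by fun_prop)
  -- Decoupling is applied once, to the two-sided event, so the mixing error is not doubled; only
  -- the independent law is split into two tails.
  have h1 := abs_sub_convLaw_le (μ := μ) hV hβ hm
  have hexp : ∀ θ, 0 < |θ| → |θ| * b ≤ 1 / 2 →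
      ∫⁻ x, ENNReal.ofReal (Real.exp (θ * x)) ∂convLaw μ V r ≤
      ENNReal.ofReal (Real.exp (θ ^ 2 * (∑ j ∈ Finset.range r, s j) / (2 * (1 - |θ| * b)))) := by
    intro θ h0 h1
    rw [Finset.mul_sum, Finset.sum_div]
    exact lintegral_exp_convLaw_le hV θ (h θ h0 h1)
  have h2 := measureReal_Ici_le_exp (ν := convLaw μ V r) hs hb hy fun θ h0 h1 => by
    simpa only [abs_of_pos h0] using hexp θ (abs_pos.2 h0.ne') (by rwa [abs_of_pos h0])
  have hp' : IsProbabilityMeasure ((convLaw μ V r).map Neg.neg) :=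
    Measure.isProbabilityMeasure_map (by fun_prop)
  have h3 := measureReal_Ici_le_exp (ν := (convLaw μ V r).map Neg.neg) hs hb hy fun θ h0 h1 => by
    rw [lintegral_map (by fun_prop) (by fun_prop)]
    simpa only [abs_neg, abs_of_pos h0, neg_mul_comm, neg_sq] using
      hexp (-θ) (by rwa [abs_neg, abs_of_pos h0]) (by rwa [abs_neg, abs_of_pos h0])
  rw [map_measureReal_apply (by fun_prop) measurableSet_Ici] at h3
  have h4 : (convLaw μ V r).real {x : ℝ | y ≤ |x|} ≤
      (convLaw μ V r).real (Ici y) + (convLaw μ V r).real (Neg.neg ⁻¹' Ici y) := by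
    refine le_trans (measureReal_mono ?_) (measureReal_union_le _ _)
    intro x hx
    rw [mem_ofPred_eq] at hx
    exact le_abs.1 hx
  have h5 := (abs_le.1 h1).2
  simp only [mem_ofPred_eq] at h5
  linarith

end Mixing

end DynNet

namespace DynNet

section Compensated

/-! ### Compensated integrals -/

/-- `∫_0^T f dN - ∫_0^T f λ ds`. -/
def compInt {Ω : Type*} (T : ℝ≥0) (N : ℝ≥0 → Ω → ℕ) (lam f : ℝ≥0 → Ω → ℝ) (ω : Ω) : ℝ :=
  ∫ s, f s ω ∂jumpMeasure (fun t => N t ω) T - ∫ s, f s ω * lam s ω ∂lebesgueUpTo T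

lemma compInt_mul {Ω : Type*} (T : ℝ≥0) (N : ℝ≥0 → Ω → ℕ) (lam f : ℝ≥0 → Ω → ℝ)
    (c : Ω → ℝ) (ω : Ω) :
    compInt T N lam (fun s ω => c ω * f s ω) ω = c ω * compInt T N lam f ω := by
  simp only [compInt, mul_assoc, integral_const_mul, mul_sub]

variable {Ω : Type*} [mΩ : MeasurableSpace Ω]

lemma measurable_fst_predictable (ℱ : Filtration ℝ≥0 mΩ) :
    Measurable[ℱ.predictable] fun p : ℝ≥0 × Ω => p.1 := by
  refine measurable_of_Ioi (mδ := ℱ.predictable) fun a => ?_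
  have : (fun p : ℝ≥0 × Ω => p.1) ⁻¹' Ioi a = Ioi a ×ˢ univ := by ext; simp
  rw [this]
  exact measurableSet_predictable_Ioi_prod MeasurableSet.univ

/-- A quantity known at time `t` and switched on strictly after `t` is predictable. Block indicators
and `Γ` enter the integrands in this way. -/
lemma measurable_indicator_Ioi_predictable {ℱ : Filtration ℝ≥0 mΩ} {t : ℝ≥0} {w : Ω → ℝ}
    (hw : Measurable[ℱ t] w) :
    Measurable[ℱ.predictable] fun p : ℝ≥0 × Ω => (Ioi t).indicator (fun _ => w p.2) p.1 := by
  intro S hS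
  have hI : MeasurableSet[ℱ.predictable] {p : ℝ≥0 × Ω | t < p.1} :=
    measurable_fst_predictable ℱ measurableSet_Ioi
  have : (fun p : ℝ≥0 × Ω => (Ioi t).indicator (fun _ => w p.2) p.1) ⁻¹' S =
      (Ioi t ×ˢ (w ⁻¹' S)) ∪ ({p | t < p.1}ᶜ ∩ {_p | (0 : ℝ) ∈ S}) := by
    ext ⟨s, ω⟩
    by_cases hs : t < s <;> simp [indicator, hs]
  rw [this]
  exact (measurableSet_predictable_Ioi_prod (hw hS)).union
    (hI.compl.inter (MeasurableSet.const _))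

namespace HasIntensity

variable {ℱ : Filtration ℝ≥0 mΩ} {μ : Measure Ω} {T : ℝ≥0} {N : ℝ≥0 → Ω → ℕ}
  {lam : ℝ≥0 → Ω → ℝ} {Λ : ℝ}

lemma measurable_compInt (h : HasIntensity ℱ μ T N lam Λ) {f : ℝ≥0 → Ω → ℝ}
    (hf : Measurable[ℱ.predictable] (Function.uncurry f)) : Measurable (compInt T N lam f) :=
  (h.measurable_integral hf).sub
    (HasIntensity.measurable_integral_lebesgue (f := fun s ω => f s ω * lam s ω) T
      (hf.mul h.predictable))

lemma integral_compInt [IsProbabilityMeasure μ] (h : HasIntensity ℱ μ T N lam Λ)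
    {f : ℝ≥0 → Ω → ℝ} (hf : Measurable[ℱ.predictable] (Function.uncurry f)) {C : ℝ}
    (hC : ∀ s ω, |f s ω| ≤ C) : ∫ ω, compInt T N lam f ω ∂μ = 0 := by
  obtain ⟨h1, h2, h3⟩ := h.integral_eq hf hC
  simp only [compInt]
  rw [integral_sub h1 h2, h3, sub_self]

end HasIntensity

variable {ℱ : Filtration ℝ≥0 mΩ} {μ : Measure Ω} {T : ℝ≥0} {ι : Type*} [Fintype ι]
  {N : ι → ℝ≥0 → Ω → ℕ} {lam : ι → ℝ≥0 → Ω → ℝ} {Λ : ℝ}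

/-- Moving the linear part `f λ` into the stochastic integral compensates it and leaves the
second-order remainder `exp f - 1 - f`, which is what can be compared with the variance. -/
lemma expExponent_eq (h : ∀ u, HasIntensity ℱ μ T (N u) (lam u) Λ) {f : ι → ℝ≥0 → Ω → ℝ}
    (hf : ∀ u, Measurable[ℱ.predictable] (Function.uncurry (f u))) {a : ℝ}
    (ha : ∀ u s ω, |f u s ω| ≤ a) (ω : Ω) :
    expExponent T N lam f ω = ∑ u, compInt T (N u) (lam u) (f u) ω -
      ∫ s, ∑ u, (Real.exp (f u s ω) - 1 - f u s ω) * lam u s ω ∂lebesgueUpTo T := by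
  have hsec : ∀ {g : ℝ≥0 → Ω → ℝ} (_ : Measurable[ℱ.predictable] (Function.uncurry g)),
      Measurable fun s => g s ω := fun hg =>
    (hg.mono (predictable_le ℱ) le_rfl).comp measurable_prodMk_right
  have hl : ∀ u s, |lam u s ω| ≤ Λ := fun u s => by
    rw [abs_of_nonneg ((h u).nonneg s ω)]; exact (h u).le s ω
  have i1 : ∀ u, Integrable (fun s => f u s ω * lam u s ω) (lebesgueUpTo T) := fun u =>
    Integrable.of_bound ((hsec (hf u)).mul (hsec (h u).predictable)).aestronglyMeasurable (a * Λ)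
      (ae_of_all _ fun s => by
        rw [norm_mul]
        exact mul_le_mul (ha u s ω) (hl u s) (abs_nonneg _) ((abs_nonneg _).trans (ha u s ω)))
  have i2 : ∀ u, Integrable (fun s => (Real.exp (f u s ω) - 1 - f u s ω) * lam u s ω)
      (lebesgueUpTo T) := fun u =>
    Integrable.of_bound ((((hsec (hf u)).exp.sub_const 1).sub (hsec (hf u))).mul
      (hsec (h u).predictable)).aestronglyMeasurable (a ^ 2 / 2 * Real.exp a * Λ)
      (ae_of_all _ fun s => by
        have h0 := ha u s ω
        have h1 := exp_sub_one_sub_le (f u s ω)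
        have h2 := Real.add_one_le_exp (f u s ω)
        have h3 : Real.exp |f u s ω| ≤ Real.exp a := Real.exp_le_exp.2 h0
        have h4 : f u s ω ^ 2 ≤ a ^ 2 := sq_le_sq' (by linarith [(abs_le.1 h0).1]) (abs_le.1 h0).2
        rw [norm_mul, Real.norm_of_nonneg (by linarith), Real.norm_eq_abs]
        refine mul_le_mul (h1.trans ?_) (hl u s) (abs_nonneg _) (by positivity)
        gcongr)
  rw [expExponent]
  simp only [compInt]
  rw [Finset.sum_sub_distrib, sub_sub, ← integral_finsetSum _ fun u _ => i1 u,
    ← integral_add (integrable_finsetSum _ fun u _ => i1 u) (integrable_finsetSum _ fun u _ => i2 u)]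
  simp only [← Finset.sum_add_distrib, ← add_mul, add_sub_cancel]

/-- The bound for the moment generating function of the compensated sum over one block. -/
theorem lintegral_exp_compInt_le [IsProbabilityMeasure μ]
    (hN : ∀ u, HasIntensity ℱ μ T (N u) (lam u) Λ)
    (hdisj : ∀ᵐ ω ∂μ, ∀ u v, u ≠ v →
      Disjoint (jumpTimes (fun t => N u t ω) T) (jumpTimes (fun t => N v t ω) T))
    {Kb Khat h A B τ θ E : ℝ} (hKb : 1 / 2 ≤ Kb) (hKhat : 0 < Khat)
    (hΛ : 0 < Λ) (hh : 0 < h) (hh1 : h ≤ 1) (hA : 0 < A)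
    (hA1 : max (max √Khat Khat) (max (1 / Kb) √((2 : ℝ) ^ (3 / 2 : ℝ) * √Λ * (Khat / Kb))) ≤ A)
    (hA2 : 1 / A * Real.exp (√2 / (A * √Λ)) ≤ 1) (hB : 1 ≤ B * √h)
    (hτ0 : 0 < τ) (hτ : τ ≤ 1 / 2) (hθ : |θ| * (√(Λ / (2 * h)) * Kb * Khat * A * B) = τ)
    {k : ℝ≥0 → ℝ} (hk : Measurable k) (hk0 : ∀ s, 0 ≤ k s) (hk1 : ∀ s, k s ≤ Kb / h)
    {t₁ : ℝ≥0} (hkt : ∀ s ≤ t₁, k s = 0)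
    {w : ι → Ω → ℝ} (hw : ∀ u, Measurable[ℱ t₁] (w u)) (hw0 : ∀ u ω, 0 ≤ w u ω)
    (hw1 : ∀ u ω, w u ω ≤ 1)
    {φ : ι → ℝ≥0 → Ω → ℝ} (hφ : ∀ u, Measurable[ℱ.predictable] (Function.uncurry (φ u)))
    (hφb : ∀ u s ω, |φ u s ω| ≤ Khat)
    {C : ι → ℝ≥0 → Ω → ℝ} (hC : ∀ u, Measurable[ℱ.predictable] (Function.uncurry (C u)))
    (hC0 : ∀ u s ω, 0 ≤ C u s ω) (hC1 : ∀ u s ω, C u s ω ≤ 1)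
    (hlC : ∀ u s ω, lam u s ω ≤ Λ * C u s ω)
    (hWB : ∀ᵐ ω ∂μ, ∑ u, w u ω * ∫ s, k s * C u s ω ∂lebesgueUpTo T ≤ B)
    (hWE : ∫ ω, ∑ u, w u ω * ∫ s, k s * C u s ω ∂lebesgueUpTo T ∂μ ≤ E) :
    ∫⁻ ω, ENNReal.ofReal (Real.exp (θ *
      ∑ u, compInt T (N u) (lam u) (fun s ω => w u ω * (k s * φ u s ω)) ω)) ∂μ ≤
      ENNReal.ofReal (Real.exp
        (θ ^ 2 * (1 / h * Λ * A ^ 2 * Kb * Khat * E) / (2 * (1 - τ)))) := by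
  have hKb0 : 0 < Kb := by linarith
  obtain ⟨-, hjump⟩ := jump_bound_le hKb0 hKhat hΛ hh hA hA2 hB hθ
  set P := A ^ (τ * (1 + τ)) with hP
  have hP0 : 0 < P := Real.rpow_pos_of_pos hA _
  have hB0 : 0 < B := pos_of_mul_pos_left (by linarith) (Real.sqrt_nonneg h)
  -- As `k` vanishes up to `t₁`, replacing `w` by `w 1(s > t₁)` changes nothing and makes the
  -- integrand predictable.
  have hfm : ∀ u, Measurable[ℱ.predictable]
      (Function.uncurry fun s ω => w u ω * (k s * φ u s ω)) := fun u => by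
    have e : (Function.uncurry fun s ω => w u ω * (k s * φ u s ω)) = fun p : ℝ≥0 × Ω =>
        (Ioi t₁).indicator (fun _ => w u p.2) p.1 * (k p.1 * φ u p.1 p.2) := by
      ext ⟨s, ω⟩
      by_cases hs : t₁ < s
      · simp [hs]
      · simp [hs, hkt s (not_lt.1 hs)]
    rw [e]
    exact (measurable_indicator_Ioi_predictable (hw u)).mul
      ((hk.comp (measurable_fst_predictable ℱ)).mul (hφ u))
  have hfb : ∀ u s ω, |w u ω * (k s * φ u s ω)| ≤ Kb * Khat / h := fun u s ω => by
    rw [abs_mul, abs_mul, abs_of_nonneg (hw0 u ω), abs_of_nonneg (hk0 s)]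
    calc w u ω * (k s * |φ u s ω|) ≤ 1 * (Kb / h * Khat) := by
          gcongr
          · exact mul_nonneg (hk0 s) (abs_nonneg _)
          · exact hw1 u ω
          · exact hk1 s
          · exact hφb u s ω
      _ = Kb * Khat / h := by ring
  set f : ι → ℝ≥0 → Ω → ℝ := fun u s ω => (1 + τ) * θ * (w u ω * (k s * φ u s ω)) with hf
  have hfm' : ∀ u, Measurable[ℱ.predictable] (Function.uncurry (f u)) := fun u =>
    (hfm u).const_mul ((1 + τ) * θ)
  have hfb' : ∀ u s ω, |f u s ω| ≤ (1 + τ) * |θ| * (Kb * Khat / h) := fun u s ω => by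
    simp only [hf]
    rw [abs_mul, abs_mul, abs_of_pos (by linarith : 0 < 1 + τ)]
    have := hfb u s ω
    gcongr
  set Y : Ω → ℝ := fun ω => θ * ∑ u, compInt T (N u) (lam u) (fun s ω => w u ω * (k s * φ u s ω)) ω
    with hY
  set Ψ : Ω → ℝ := fun ω =>
    ∫ s, ∑ u, (Real.exp (f u s ω) - 1 - f u s ω) * lam u s ω ∂lebesgueUpTo T with hΨ
  have hYm : Measurable Y :=
    (Finset.measurable_fun_sum _ fun u _ => (hN u).measurable_compInt (hfm u)).const_mul θ
  have hΨm : Measurable Ψ := by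
    refine HasIntensity.measurable_integral_lebesgue (ℱ := ℱ)
      (f := fun s ω => ∑ u, (Real.exp (f u s ω) - 1 - f u s ω) * lam u s ω) T ?_
    exact Finset.measurable_fun_sum
      (f := fun u (p : ℝ≥0 × Ω) => (Real.exp (f u p.1 p.2) - 1 - f u p.1 p.2) * lam u p.1 p.2) _
      fun u _ => (((hfm' u).exp.sub_const 1).sub (hfm' u)).mul (hN u).predictable
  have hkC : ∀ u, Measurable[ℱ.predictable] (Function.uncurry fun s ω => k s * C u s ω) := fun u =>
    (hk.comp (measurable_fst_predictable ℱ)).mul (hC u)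
  have hWm : Measurable fun ω => ∑ u, w u ω * ∫ s, k s * C u s ω ∂lebesgueUpTo T :=
    Finset.measurable_fun_sum _ fun u _ => ((hw u).mono (ℱ.le _) le_rfl).mul
      (HasIntensity.measurable_integral_lebesgue T (hkC u))
  have hexp1 : ∫⁻ ω, ENNReal.ofReal (Real.exp ((1 + τ) * Y ω - Ψ ω)) ∂μ ≤ 1 := by
    refine le_trans (le_of_eq (lintegral_congr fun ω => ?_))
      (lintegral_exp_le_one hN hdisj hfm' hfb')
    rw [expExponent_eq hN hfm' hfb']
    congr 3
    simp only [hY, hf]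
    rw [Finset.mul_sum, Finset.mul_sum]
    refine Finset.sum_congr rfl fun u _ => ?_
    rw [compInt_mul T (N u) (lam u) (fun s ω => w u ω * (k s * φ u s ω)) (fun _ => (1 + τ) * θ)]
    ring
  set g := (1 + τ) ^ 2 * θ ^ 2 / 2 * P * (Kb * Khat ^ 2 * Λ / h) with hg
  have hg0 : 0 ≤ g := by positivity
  have hsec : ∀ {g : ℝ≥0 → Ω → ℝ} (_ : Measurable[ℱ.predictable] (Function.uncurry g)) ω,
      Measurable fun s => g s ω := fun hg ω =>
    (hg.mono (predictable_le ℱ) le_rfl).comp measurable_prodMk_right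
  have ikC : ∀ u ω, Integrable (fun s => k s * C u s ω) (lebesgueUpTo T) := fun u ω =>
    Integrable.of_bound (hsec (hkC u) ω).aestronglyMeasurable (Kb / h) (ae_of_all _ fun s => by
      rw [Real.norm_of_nonneg (mul_nonneg (hk0 s) (hC0 u s ω))]
      calc k s * C u s ω ≤ Kb / h * 1 := by
            gcongr
            · exact hC0 u s ω
            · exact hk1 s
            · exact hC1 u s ω
        _ = Kb / h := mul_one _)
  have hΨW : ∀ ω, Ψ ω ≤ g * ∑ u, w u ω * ∫ s, k s * C u s ω ∂lebesgueUpTo T := by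
    intro ω
    have e : g * ∑ u, w u ω * ∫ s, k s * C u s ω ∂lebesgueUpTo T =
        ∫ s, ∑ u, g * (w u ω * (k s * C u s ω)) ∂lebesgueUpTo T := by
      rw [integral_finsetSum _ fun u _ => ((ikC u ω).const_mul _).const_mul _, Finset.mul_sum]
      simp only [integral_const_mul]
    rw [e]
    refine integral_mono_of_nonneg (ae_of_all _ fun s => ?_)
      (integrable_finsetSum _ fun u _ => ((ikC u ω).const_mul _).const_mul _)
      (ae_of_all _ fun s => ?_)
    · refine Finset.sum_nonneg fun u _ => mul_nonneg ?_ ((hN u).nonneg s ω)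
      have := Real.add_one_le_exp (f u s ω)
      linarith
    · refine Finset.sum_le_sum fun u _ => ?_
      have h1 := exp_sub_one_sub_le (f u s ω)
      have h2 : Real.exp |f u s ω| ≤ P := (Real.exp_le_exp.2 (hfb' u s ω)).trans hjump
      -- One factor `k` and one factor `w` of the square are kept and the others are bounded by `Kb
      -- / h` and `1`. The remainder thus becomes linear in `w k C`, which integrates to `W`.
      have h3 : f u s ω ^ 2 ≤ (1 + τ) ^ 2 * θ ^ 2 * (w u ω * (k s * (Kb / h) * Khat ^ 2)) := by
        have e2 : f u s ω ^ 2 = (1 + τ) ^ 2 * θ ^ 2 * ((w u ω * w u ω) *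
            (k s * k s * φ u s ω ^ 2)) := by simp only [hf]; ring
        rw [e2]
        have a1 : w u ω * w u ω ≤ w u ω := mul_le_of_le_one_left (hw0 u ω) (hw1 u ω)
        have a2 : φ u s ω ^ 2 ≤ Khat ^ 2 :=
          sq_le_sq' (by linarith [(abs_le.1 (hφb u s ω)).1]) (abs_le.1 (hφb u s ω)).2
        have a3 := hk0 s
        have a4 := hk1 s
        have a5 := hw0 u ω
        gcongr
      have h4 : 0 ≤ f u s ω ^ 2 := sq_nonneg _
      have a3 := hk0 s
      have a5 := hw0 u ω
      have h5 := (hN u).nonneg s ω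
      calc (Real.exp (f u s ω) - 1 - f u s ω) * lam u s ω
          ≤ (f u s ω ^ 2 / 2 * Real.exp |f u s ω|) * lam u s ω := by gcongr
        _ ≤ ((1 + τ) ^ 2 * θ ^ 2 * (w u ω * (k s * (Kb / h) * Khat ^ 2)) / 2 * P) *
            (Λ * C u s ω) := by
            have := hlC u s ω
            gcongr
        _ = g * (w u ω * (k s * C u s ω)) := by rw [hg]; ring
  have hW0 : ∀ ω, 0 ≤ ∑ u, w u ω * ∫ s, k s * C u s ω ∂lebesgueUpTo T := fun ω =>
    Finset.sum_nonneg fun u _ => mul_nonneg (hw0 u ω)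
      (integral_nonneg fun s => mul_nonneg (hk0 s) (hC0 u s ω))
  have hE0 : 0 ≤ E := (integral_nonneg hW0).trans hWE
  refine (lintegral_exp_le_of_compensator hYm hΨm hWm hτ0 hg0 hB0 hexp1 (ae_of_all _ hΨW)
    (ae_of_all _ hW0) hWB hWE).trans (ENNReal.ofReal_le_ofReal ?_)
  exact holder_bound_le_exp hKb hKhat hΛ hh hh1 hA hA1 hA2 hB hE0 hτ0 hτ hθ

end Compensated

end DynNet

namespace DynNet

/-! ### Smoothing kernels -/

namespace IsHolderKernel

variable {K : ℝ → ℝ} {Kb : ℝ}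

lemma continuous (hK : IsHolderKernel K Kb) : Continuous K := by
  obtain ⟨α, H, hα, hH⟩ := hK.holder
  rw [continuous_iff_continuousAt]
  intro z
  rw [ContinuousAt, tendsto_iff_dist_tendsto_zero]
  refine squeeze_zero (fun _ => dist_nonneg) (fun y => hH y z) ?_
  have h1 : Tendsto (fun y : ℝ => |y - z|) (𝓝 z) (𝓝 0) := by
    have : Continuous fun y : ℝ => |y - z| := by fun_prop
    simpa using this.tendsto z
  have h2 := (h1.rpow_const (p := α) (Or.inr hα.le)).const_mul H
  simpa [Real.zero_rpow hα.ne'] using h2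

/-- Continuity extends the vanishing outside `[-1, 1]` to the endpoints, by approach from outside
along `y (1 + t)`. -/
lemma eq_zero (hK : IsHolderKernel K Kb) {y : ℝ} (hy : 1 ≤ |y|) : K y = 0 := by
  have h1 : Tendsto (fun t : ℝ => K (y * (1 + t))) (𝓝[>] 0) (𝓝 (K y)) := by
    have : Continuous fun t : ℝ => K (y * (1 + t)) := hK.continuous.comp (by fun_prop)
    simpa using (this.tendsto 0).mono_left nhdsWithin_le_nhds
  refine tendsto_nhds_unique h1 (tendsto_const_nhds.congr' ?_)
  filter_upwards [self_mem_nhdsWithin] with t ht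
  have ht : 0 < t := ht
  refine (hK.support _ ?_).symm
  rw [abs_mul, abs_of_pos (by linarith : 0 < 1 + t)]
  nlinarith

/-- A kernel of mass one on an interval of length two must reach height `1/2`. This is where the
bound `A² F ≤ 2` in the constants comes from. -/
lemma half_le (hK : IsHolderKernel K Kb) : 1 / 2 ≤ Kb := by
  have h1 : ∫ y in Icc (-1 : ℝ) 1, K y = 1 := by
    rw [setIntegral_eq_integral_of_forall_compl_eq_zero, hK.integral_eq_one]
    intro y hy
    refine hK.support y ?_
    by_contra! h
    exact hy (abs_le.1 h)
  have h2 := norm_setIntegral_le_of_norm_le_const (μ := volume) (s := Icc (-1 : ℝ) 1) (f := K)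
    (C := Kb) (by simp) fun y _ => by rw [Real.norm_of_nonneg (hK.nonneg y)]; exact hK.bounded y
  rw [h1, norm_one] at h2
  norm_num at h2
  linarith

end IsHolderKernel

namespace Smoothing

variable (W : Smoothing) {Kb : ℝ}

lemma Kh_nonneg (hK : IsHolderKernel W.K Kb) (s : ℝ) : 0 ≤ W.Kh s :=
  mul_nonneg (by positivity) (hK.nonneg _)

lemma Kh_le (hK : IsHolderKernel W.K Kb) (s : ℝ) : W.Kh s ≤ Kb / W.h := by
  have := hK.bounded ((s - W.t₀) / W.h)
  calc W.Kh s ≤ 1 / W.h * Kb := by unfold Kh; gcongr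
    _ = Kb / W.h := by ring

lemma continuous_Kh (hK : IsHolderKernel W.K Kb) : Continuous W.Kh :=
  continuous_const.mul (hK.continuous.comp (by fun_prop))

lemma Kh_eq_zero (hK : IsHolderKernel W.K Kb) (hh : 0 < W.h) {s : ℝ}
    (hs : (W.h : ℝ) ≤ |s - W.t₀|) : W.Kh s = 0 := by
  have hh' : (0 : ℝ) < W.h := hh
  rw [Kh, hK.eq_zero, mul_zero]
  rwa [abs_div, abs_of_pos hh', le_div_iff₀ hh', one_mul]

lemma integral_Kh (hK : IsHolderKernel W.K Kb) (hh : 0 < W.h) : ∫ s, W.Kh s = 1 := by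
  have hh' : (0 : ℝ) < W.h := hh
  simp only [Kh]
  rw [integral_const_mul, integral_sub_right_eq_self fun s => W.K (s / W.h),
    Measure.integral_comp_div, hK.integral_eq_one, abs_of_pos hh', smul_eq_mul, mul_one]
  field_simp

/-- The smoothing kernel restricted to times after the left end of the window. -/
def kern (s : ℝ≥0) : ℝ := (Ioi W.left).indicator (fun s => W.Kh s) s

lemma kern_nonneg (hK : IsHolderKernel W.K Kb) (s : ℝ≥0) : 0 ≤ W.kern s :=
  indicator_nonneg (fun _ _ => W.Kh_nonneg hK _) _

lemma kern_le (hK : IsHolderKernel W.K Kb) (s : ℝ≥0) : W.kern s ≤ Kb / W.h :=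
  indicator_le' (fun _ _ => W.Kh_le hK _)
    (fun _ _ => (W.Kh_nonneg hK 0).trans (W.Kh_le hK 0)) _

lemma kern_eq_zero {s : ℝ≥0} (hs : s ≤ W.left) : W.kern s = 0 :=
  indicator_of_notMem (by simpa using hs) _

lemma measurable_kern (hK : IsHolderKernel W.K Kb) : Measurable W.kern :=
  ((W.continuous_Kh hK).measurable.comp measurable_coe_nnreal_real).indicator measurableSet_Ioi

/-- The cut at `W.left` removes only zeros of the kernel, except possibly at time `0`: if `t₀ < h`,
the left end is `0` and `W.Kh 0` need not vanish. Neither the jumps nor Lebesgue measure charge `0`.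
-/
lemma kern_eq (hK : IsHolderKernel W.K Kb) (hh : 0 < W.h) {s : ℝ≥0} (hs : 0 < s) :
    W.kern s = W.Kh s := by
  by_cases h : s ∈ Ioi W.left
  · exact indicator_of_mem h _
  · rw [kern, indicator_of_notMem h, W.Kh_eq_zero hK hh]
    rw [mem_Ioi, not_lt, left] at h
    have h2 : s + W.h ≤ W.t₀ := by
      rcases le_total W.h W.t₀ with h3 | h3
      · exact (add_le_add_left h W.h).trans (tsub_add_cancel_of_le h3).le
      · rw [tsub_eq_zero_of_le h3] at h
        exact absurd hs (not_lt.2 h)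
    have h3 : (s : ℝ) + W.h ≤ W.t₀ := by exact_mod_cast h2
    rw [abs_sub_comm]
    exact le_trans (by linarith) (le_abs_self _)

lemma mem_window_of_kern_ne_zero (hK : IsHolderKernel W.K Kb) (hh : 0 < W.h) {s : ℝ≥0}
    (hsT : s ≤ W.T) (hs : W.kern s ≠ 0) : s ∈ W.window := by
  have h1 : W.left < s := by
    by_contra! h
    exact hs (W.kern_eq_zero h)
  refine ⟨h1.le, le_min ?_ hsT⟩
  by_contra! h
  refine hs ?_
  have h2 : ((W.t₀ + W.h : ℝ≥0) : ℝ) < s := by exact_mod_cast h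
  rw [NNReal.coe_add] at h2
  rw [kern, indicator_of_mem (mem_Ioi.2 h1), W.Kh_eq_zero hK hh]
  exact le_trans (by linarith) (le_abs_self _)

lemma integrable_kern (hK : IsHolderKernel W.K Kb) : Integrable W.kern (lebesgueUpTo W.T) :=
  Integrable.of_bound (W.measurable_kern hK).aestronglyMeasurable (Kb / W.h)
    (ae_of_all _ fun s => by
      rw [Real.norm_of_nonneg (W.kern_nonneg hK s)]
      exact W.kern_le hK s)

lemma integral_kern_mul (hK : IsHolderKernel W.K Kb) (hh : 0 < W.h) {g : ℝ≥0 → ℝ}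
    (hg : Measurable g) :
    ∫ s, W.kern s * g s ∂lebesgueUpTo W.T = ∫ s in (0 : ℝ)..W.T, W.Kh s * g s.toNNReal := by
  rw [integral_lebesgueUpTo W.T (f := fun s => W.kern s * g s)
    ((W.measurable_kern hK).mul hg).stronglyMeasurable]
  refine intervalIntegral.integral_congr_ae (ae_of_all _ fun s hs => ?_)
  rw [uIoc_of_le W.T.coe_nonneg] at hs
  rw [W.kern_eq hK hh (Real.toNNReal_pos.2 hs.1), Real.coe_toNNReal s hs.1.le]

lemma integral_kern_le_one (hK : IsHolderKernel W.K Kb) (hh : 0 < W.h) :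
    ∫ s, W.kern s ∂lebesgueUpTo W.T ≤ 1 := by
  have h1 := W.integral_kern_mul hK hh (g := fun _ => 1) measurable_const
  simp only [mul_one] at h1
  rw [h1, intervalIntegral.integral_of_le W.T.coe_nonneg, ← W.integral_Kh hK hh]
  refine setIntegral_le_integral (Integrable.of_integral_ne_zero ?_)
    (ae_of_all _ fun s => W.Kh_nonneg hK s)
  rw [W.integral_Kh hK hh]
  exact one_ne_zero

end Smoothing

end DynNet

namespace DynNet

/-! ### Smoothed martingale integrals of a network -/

section Glue

variable {κ : NetworkKind} {n q : ℕ} {Ω : Type*} [mΩ : MeasurableSpace Ω] {D : Network κ n q Ω}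
  {μ : Measure Ω} {T : ℝ≥0} {Λ : ℝ}

lemma measurable_section {ℱ : Filtration ℝ≥0 mΩ} {g : ℝ≥0 → Ω → ℝ}
    (hg : Measurable[ℱ.predictable] (Function.uncurry g)) (ω : Ω) : Measurable fun s => g s ω :=
  (hg.mono (predictable_le ℱ) le_rfl).comp measurable_prodMk_right

namespace Network.IsStructured

lemma measurable_C (hD : D.IsStructured μ T) (u : Pair κ n) :
    Measurable[D.ℱ.predictable] (Function.uncurry (D.C u)) := (hD.C_predictable u).measurable

lemma measurable_intensity (hD : D.IsStructured μ T) (u : Pair κ n) :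
    Measurable[D.ℱ.predictable] (Function.uncurry (D.intensity u)) :=
  (hD.measurable_C u).mul (hD.link_measurable.comp
    ((measurable_fst_predictable D.ℱ).prodMk (hD.X_predictable u).measurable)).coe_nnreal_real

lemma C_nonneg (hD : D.IsStructured μ T) (u : Pair κ n) (s : ℝ≥0) (ω : Ω) : 0 ≤ D.C u s ω := by
  rcases hD.C_mem u s ω with h | h <;> simp [h]

lemma C_le_one (hD : D.IsStructured μ T) (u : Pair κ n) (s : ℝ≥0) (ω : Ω) : D.C u s ω ≤ 1 := by
  rcases hD.C_mem u s ω with h | h <;> simp [h]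

lemma intensity_nonneg (hD : D.IsStructured μ T) (u : Pair κ n) (s : ℝ≥0) (ω : Ω) :
    0 ≤ D.intensity u s ω := mul_nonneg (hD.C_nonneg u s ω) NNReal.zero_le_coe

/-- The bound `Λ` holds only almost surely and only up to `T`. The truncated intensity obeys it
everywhere and has the same integrals over `(0, T]` almost surely. -/
lemma hasIntensity [IsProbabilityMeasure μ] (hD : D.IsStructured μ T) (hΛ : 0 < Λ)
    (hlam : ∀ᵐ ω ∂μ, ∀ u, ∀ t ≤ T, D.intensity u t ω ≤ Λ) (u : Pair κ n) :
    HasIntensity D.ℱ μ T (D.N u) (fun t ω => min (D.intensity u t ω) Λ) Λ where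
  path := hD.N_path u
  adapted := hD.N_adapted u
  predictable := (hD.measurable_intensity u).min measurable_const
  nonneg t ω := le_min (hD.intensity_nonneg u t ω) hΛ.le
  le t ω := min_le_right _ _
  lintegral_eq {H} hH := by
    refine (lintegral_jumpMeasure_eq (hD.N_path u) (hD.N_adapted u) (hD.measurable_intensity u)
      (hD.intensity_nonneg u) hΛ.le (hlam.mono fun ω h => h u) (hD.M_martingale u) hH).trans ?_
    refine lintegral_congr_ae ?_
    filter_upwards [hlam] with ω hω
    refine lintegral_congr_ae ?_
    filter_upwards [ae_lebesgueUpTo_le T] with s hs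
    rw [min_eq_left (hω u s hs.2)]

/-- The set `{C = 0}` is predictable, so the expected number of jumps in it is the expected integral
of the intensity over it, which is zero. -/
lemma ae_C_ne_zero_of_mem_jumpTimes [IsProbabilityMeasure μ] (hD : D.IsStructured μ T)
    (hΛ : 0 < Λ) (hlam : ∀ᵐ ω ∂μ, ∀ u, ∀ t ≤ T, D.intensity u t ω ≤ Λ) :
    ∀ᵐ ω ∂μ, ∀ u, ∀ s ∈ jumpTimes (fun t => D.N u t ω) T, D.C u s ω ≠ 0 := by
  rw [ae_all_iff]
  intro u
  have hI := hD.hasIntensity hΛ hlam u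
  have hS : MeasurableSet[D.ℱ.predictable] {p : ℝ≥0 × Ω | D.C u p.1 p.2 = 0} :=
    hD.measurable_C u (measurableSet_singleton 0)
  have hH : Measurable[D.ℱ.predictable]
      ({p : ℝ≥0 × Ω | D.C u p.1 p.2 = 0}.indicator (fun _ => (1 : ℝ≥0∞))) :=
    Measurable.indicator measurable_const hS
  have h0 : ∫⁻ ω, ∫⁻ s, {p : ℝ≥0 × Ω | D.C u p.1 p.2 = 0}.indicator (fun _ => (1 : ℝ≥0∞)) (s, ω)
      ∂jumpMeasure (fun t => D.N u t ω) T ∂μ = 0 := by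
    rw [hI.lintegral_eq hH]
    refine (lintegral_congr fun ω => (lintegral_congr fun s => ?_).trans lintegral_zero).trans
      lintegral_zero
    by_cases hs : D.C u s ω = 0
    · simp [Network.intensity, hs, hΛ.le]
    · rw [indicator_of_notMem (by simpa using hs), zero_mul]
  rw [lintegral_eq_zero_iff (hI.measurable_lintegral hH)] at h0
  filter_upwards [h0] with ω hω s hs hC
  rw [(hD.N_path u ω).lintegral_jumpMeasure, Pi.zero_apply, Finset.sum_eq_zero_iff] at hω
  have := hω s (by simpa using hs)
  rw [indicator_of_mem (by simpa using hC)] at this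
  exact one_ne_zero this

end Network.IsStructured

namespace Smoothing

variable (W : Smoothing) {φ : Pair κ n → ℝ≥0 → Ω → ℝ} {Kb Khat : ℝ}

lemma smoothInt_eq (hD : D.IsStructured μ W.T) (hK : IsHolderKernel W.K Kb)
    (hφ : ∀ u, Measurable[D.ℱ.predictable] (Function.uncurry (φ u))) (u : Pair κ n) (ω : Ω) :
    W.smoothInt D φ u ω = ∫ s, W.Kh s * φ u s ω ∂jumpMeasure (fun t => D.N u t ω) W.T -
      ∫ s, D.intensity u s ω * (W.Kh s * φ u s ω) ∂lebesgueUpTo W.T := by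
  rw [(hD.N_path u ω).integral_jumpMeasure, integral_lebesgueUpTo]
  · rfl
  · exact ((measurable_section (hD.measurable_intensity u) ω).mul
      (((W.continuous_Kh hK).measurable.comp measurable_coe_nnreal_real).mul
      (measurable_section (hφ u) ω))).stronglyMeasurable

lemma measurable_smoothInt [IsProbabilityMeasure μ] (hD : D.IsStructured μ W.T)
    (hK : IsHolderKernel W.K Kb) (hΛ : 0 < Λ)
    (hlam : ∀ᵐ ω ∂μ, ∀ u, ∀ t ≤ W.T, D.intensity u t ω ≤ Λ)
    (hφ : ∀ u, Measurable[D.ℱ.predictable] (Function.uncurry (φ u))) (u : Pair κ n) :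
    Measurable (W.smoothInt D φ u) := by
  have hm : Measurable[D.ℱ.predictable] (Function.uncurry fun s ω => W.Kh s * φ u s ω) :=
    (((W.continuous_Kh hK).measurable.comp measurable_coe_nnreal_real).comp
      (measurable_fst_predictable D.ℱ)).mul (hφ u)
  rw [funext fun ω => W.smoothInt_eq hD hK hφ u ω]
  exact ((hD.hasIntensity hΛ hlam u).measurable_integral hm).sub
    (HasIntensity.measurable_integral_lebesgue
      (f := fun s ω => D.intensity u s ω * (W.Kh s * φ u s ω)) W.T
      ((hD.measurable_intensity u).mul hm))

/-- Truncation to `[-c, c]`. -/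
def clamp (c x : ℝ) : ℝ := max (-c) (min x c)

lemma clamp_eq {c x : ℝ} (h : |x| ≤ c) : clamp c x = x := by
  rw [clamp, min_eq_left (abs_le.1 h).2, max_eq_right (abs_le.1 h).1]

lemma abs_clamp_le {c : ℝ} (hc : 0 ≤ c) (x : ℝ) : |clamp c x| ≤ c :=
  abs_le.2 ⟨le_max_left _ _, max_le (by linarith) (min_le_right _ _)⟩

lemma measurable_clamp (c : ℝ) : Measurable (clamp c) :=
  measurable_const.max (measurable_id.min measurable_const)

lemma ae_smoothInt_eq_compInt (hD : D.IsStructured μ W.T) (hh : 0 < W.h)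
    (hK : IsHolderKernel W.K Kb)
    (hlam : ∀ᵐ ω ∂μ, ∀ u, ∀ t ≤ W.T, D.intensity u t ω ≤ Λ)
    (hφ : ∀ u, Measurable[D.ℱ.predictable] (Function.uncurry (φ u)))
    (hφb : ∀ᵐ ω ∂μ, ∀ u, ∀ t ≤ W.T, |φ u t ω| ≤ Khat) :
    ∀ᵐ ω ∂μ, ∀ u, W.smoothInt D φ u ω =
      compInt W.T (D.N u) (fun t ω => min (D.intensity u t ω) Λ)
        (fun s ω => W.kern s * clamp Khat (φ u s ω)) ω := by
  filter_upwards [hlam, hφb] with ω h1 h2 u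
  rw [W.smoothInt_eq hD hK hφ, compInt]
  congr 1
  · rw [(hD.N_path u ω).integral_jumpMeasure, (hD.N_path u ω).integral_jumpMeasure]
    refine finsum_mem_congr rfl fun s hs => ?_
    rw [W.kern_eq hK hh hs.1, clamp_eq (h2 u s hs.2.1)]
  · refine integral_congr_ae ?_
    filter_upwards [ae_lebesgueUpTo_le W.T] with s hs
    rw [W.kern_eq hK hh hs.1, clamp_eq (h2 u s hs.2), min_eq_left (h1 u s hs.2), mul_comm]

/-- An inactive pair has no jumps and no intensity in the window, and the kernel vanishes outside
it. This disposes of the pairs that belong to no block. -/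
lemma ae_smoothInt_eq_zero [IsProbabilityMeasure μ] (hD : D.IsStructured μ W.T) (hh : 0 < W.h)
    (hK : IsHolderKernel W.K Kb) (hΛ : 0 < Λ)
    (hlam : ∀ᵐ ω ∂μ, ∀ u, ∀ t ≤ W.T, D.intensity u t ω ≤ Λ)
    (hφ : ∀ u, Measurable[D.ℱ.predictable] (Function.uncurry (φ u)))
    (hφb : ∀ᵐ ω ∂μ, ∀ u, ∀ t ≤ W.T, |φ u t ω| ≤ Khat) :
    ∀ᵐ ω ∂μ, ∀ u, (∀ r ∈ W.window, D.C u r ω = 0) → W.smoothInt D φ u ω = 0 := by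
  filter_upwards [W.ae_smoothInt_eq_compInt hD hh hK hlam hφ hφb,
    hD.ae_C_ne_zero_of_mem_jumpTimes hΛ hlam] with ω h1 h2 u hC
  rw [h1 u, compInt, (hD.N_path u ω).integral_jumpMeasure]
  have e1 : ∀ s ∈ jumpTimes (fun t => D.N u t ω) W.T, W.kern s * clamp Khat (φ u s ω) = 0 := by
    intro s hs
    by_contra! h
    exact h2 u s hs (hC s (W.mem_window_of_kern_ne_zero hK hh hs.2.1 (left_ne_zero_of_mul h)))
  have e2 : ∫ s, W.kern s * clamp Khat (φ u s ω) * min (D.intensity u s ω) Λ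
      ∂lebesgueUpTo W.T = 0 := by
    refine (integral_congr_ae ?_).trans (integral_zero _ _)
    filter_upwards [ae_lebesgueUpTo_le W.T] with s hs
    by_cases h : W.kern s = 0
    · rw [h, zero_mul, zero_mul]
    · rw [Network.intensity, hC s (W.mem_window_of_kern_ne_zero hK hh hs.2 h), zero_mul,
        min_eq_left hΛ.le, mul_zero]
  rw [e2, finsum_mem_congr rfl e1, finsum_mem_zero, sub_zero]

/-- Coordinates commute with a Bochner integral only when the integrand is integrable; the almost
sure bounds supply this, so the identity is an almost sure one. -/
lemma ae_smoothInt_apply {d : ℕ} {φ : Pair κ n → ℝ≥0 → Ω → EuclideanSpace ℝ (Fin d)}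
    (hD : D.IsStructured μ W.T) (hK : IsHolderKernel W.K Kb)
    (hlam : ∀ᵐ ω ∂μ, ∀ u, ∀ t ≤ W.T, D.intensity u t ω ≤ Λ)
    (hφ : ∀ u, IsStronglyPredictable D.ℱ (φ u))
    (hφb : ∀ᵐ ω ∂μ, ∀ u, ∀ t ≤ W.T, ∀ i, |φ u t ω i| ≤ Khat) :
    ∀ᵐ ω ∂μ, ∀ u i, W.smoothInt D φ u ω i = W.smoothInt D (fun u s ω => φ u s ω i) u ω := by
  filter_upwards [hlam, hφb] with ω h1 h2 u i
  have hm : Measurable fun s => φ u s ω :=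
    ((hφ u).measurable.mono (predictable_le D.ℱ) le_rfl).comp measurable_prodMk_right
  have hint : IntervalIntegrable (fun s : ℝ => D.intensity u s.toNNReal ω •
      (W.Kh s.toNNReal • φ u s.toNNReal ω)) volume 0 W.T := by
    rw [intervalIntegrable_iff, uIoc_of_le W.T.coe_nonneg]
    refine IntegrableOn.of_bound (by simp) (Measurable.aestronglyMeasurable ?_)
      (Λ * (Kb / W.h * √(d * Khat ^ 2))) ?_
    · exact ((measurable_section (hD.measurable_intensity u) ω).comp measurable_real_toNNReal).smul
        (((W.continuous_Kh hK).measurable.comp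
          (measurable_coe_nnreal_real.comp measurable_real_toNNReal)).smul
          (hm.comp measurable_real_toNNReal))
    · filter_upwards [ae_restrict_mem measurableSet_Ioc] with s hs
      have hsT : s.toNNReal ≤ W.T := Real.toNNReal_le_iff_le_coe.2 hs.2
      have a1 := h1 u _ hsT
      have a2 := W.Kh_le hK (s.toNNReal : ℝ)
      have a3 := W.Kh_nonneg hK (s.toNNReal : ℝ)
      have a4 := hD.intensity_nonneg u s.toNNReal ω
      have a5 : ‖φ u s.toNNReal ω‖ ≤ √(d * Khat ^ 2) := by
        rw [EuclideanSpace.norm_eq]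
        refine Real.sqrt_le_sqrt ?_
        calc ∑ i, ‖φ u s.toNNReal ω i‖ ^ 2 ≤ ∑ _i : Fin d, Khat ^ 2 :=
              Finset.sum_le_sum fun i _ =>
                pow_le_pow_left₀ (norm_nonneg _) (h2 u _ hsT i) 2
          _ = d * Khat ^ 2 := by simp
      rw [norm_smul, norm_smul, Real.norm_of_nonneg a4, Real.norm_of_nonneg a3]
      have a6 := a4.trans a1
      have a7 := a3.trans a2
      gcongr
  have hc := (EuclideanSpace.proj i : EuclideanSpace ℝ (Fin d) →L[ℝ] ℝ).intervalIntegral_comp_comm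
    hint
  simp only [EuclideanSpace.coe_proj, PiLp.smul_apply] at hc
  simp only [smoothInt, Network.integralM, PiLp.sub_apply]
  rw [← hc]
  congr 1
  rw [finsum_mem_eq_finite_toFinset_sum _ ((hD.N_path u ω).finite_jumpTimes W.T),
    finsum_mem_eq_finite_toFinset_sum _ ((hD.N_path u ω).finite_jumpTimes W.T)]
  simp

end Smoothing

end Glue

end DynNet

namespace DynNet

/-! ### Blocks -/

section Blocks

lemma blockInd_nonneg {κ : NetworkKind} {n 𝒦 : ℕ} {Ω : Type*} (G : Blocks κ n 𝒦 Ω) (k : Fin 𝒦)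
    (m : Fin (numPairs κ n)) (u : Pair κ n) (ω : Ω) : 0 ≤ blockInd G k m u ω :=
  indicator_nonneg (fun _ _ => zero_le_one) _

lemma blockInd_le_one {κ : NetworkKind} {n 𝒦 : ℕ} {Ω : Type*} (G : Blocks κ n 𝒦 Ω) (k : Fin 𝒦)
    (m : Fin (numPairs κ n)) (u : Pair κ n) (ω : Ω) : blockInd G k m u ω ≤ 1 :=
  indicator_le' (fun _ _ => le_rfl) (fun _ _ => zero_le_one) _

lemma measurable_blockInd {κ : NetworkKind} {n 𝒦 : ℕ} {Ω : Type*} {m₀ : MeasurableSpace Ω}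
    {G : Blocks κ n 𝒦 Ω} (hG : ∀ k m u, MeasurableSet {ω | u ∈ G k m ω}) (k : Fin 𝒦)
    (m : Fin (numPairs κ n)) (u : Pair κ n) : Measurable (blockInd G k m u) :=
  (measurable_const (a := (1 : ℝ))).indicator (hG k m u)

lemma sum_blockInd_le_S {κ : NetworkKind} {n 𝒦 : ℕ} {Ω : Type*} (G : Blocks κ n 𝒦 Ω) (k : Fin 𝒦)
    (m : Fin (numPairs κ n)) (ω : Ω) : ∑ u, blockInd G k m u ω ≤ Smoothing.S G k ω :=
  le_ciSup (f := fun m => ∑ u, blockInd G k m u ω) (Set.finite_range _).bddAbove m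

lemma measurable_S {κ : NetworkKind} {n 𝒦 : ℕ} {Ω : Type*} {m₀ : MeasurableSpace Ω}
    {G : Blocks κ n 𝒦 Ω} (hG : ∀ k m u, MeasurableSet {ω | u ∈ G k m ω}) (k : Fin 𝒦) :
    Measurable (Smoothing.S G k) :=
  Measurable.iSup fun m => Finset.measurable_fun_sum _ fun u _ => measurable_blockInd hG k m u

lemma measurableSet_forall_S {κ : NetworkKind} {n 𝒦 : ℕ} {Ω : Type*} {m₀ : MeasurableSpace Ω}
    {G : Blocks κ n 𝒦 Ω} (hG : ∀ k m u, MeasurableSet {ω | u ∈ G k m ω}) (R c h : ℝ) :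
    MeasurableSet {ω | ∀ k, Smoothing.S G k ω ^ 2 * Real.log R / R ≤ c ∧
      1 ≤ Smoothing.S G k ω * √h} := by
  rw [ofPred_forall]
  refine MeasurableSet.iInter fun k => ?_
  have := measurable_S hG k
  exact (measurableSet_le (((this.pow_const 2).mul_const _).div_const _) measurable_const).inter
    (measurableSet_le measurable_const (this.mul_const _))

variable {κ : NetworkKind} {n q 𝒦 : ℕ} {Ω : Type*} [mΩ : MeasurableSpace Ω] {D : Network κ n q Ω}
  {μ : Measure Ω} {Λ Kb Khat : ℝ} {G : Blocks κ n 𝒦 Ω}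

namespace Smoothing

variable (W : Smoothing)

lemma measurableSet_goodEvent
    (hG : ∀ k m u, MeasurableSet[D.ℱ W.left] {ω | u ∈ G k m ω}) (c₃ : ℝ) :
    MeasurableSet[D.ℱ W.left] (W.goodEvent D μ G c₃) :=
  measurableSet_forall_S hG _ _ _

lemma integral_kern_C_nonneg (hD : D.IsStructured μ W.T) (hK : IsHolderKernel W.K Kb)
    (u : Pair κ n) (ω : Ω) : 0 ≤ ∫ s, W.kern s * D.C u s ω ∂lebesgueUpTo W.T :=
  integral_nonneg fun s => mul_nonneg (W.kern_nonneg hK s) (hD.C_nonneg u s ω)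

lemma integral_kern_C_le_one (hD : D.IsStructured μ W.T) (hK : IsHolderKernel W.K Kb)
    (hh : 0 < W.h) (u : Pair κ n) (ω : Ω) :
    ∫ s, W.kern s * D.C u s ω ∂lebesgueUpTo W.T ≤ 1 := by
  refine le_trans (integral_mono_of_nonneg (ae_of_all _ fun s => ?_) (W.integrable_kern hK)
    (ae_of_all _ fun s => ?_)) (W.integral_kern_le_one hK hh)
  · exact mul_nonneg (W.kern_nonneg hK s) (hD.C_nonneg u s ω)
  · exact mul_le_of_le_one_right (W.kern_nonneg hK s) (hD.C_le_one u s ω)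

lemma measurable_integral_kern_C (hD : D.IsStructured μ W.T) (hK : IsHolderKernel W.K Kb)
    (u : Pair κ n) : Measurable fun ω => ∫ s, W.kern s * D.C u s ω ∂lebesgueUpTo W.T :=
  HasIntensity.measurable_integral_lebesgue W.T
    (((W.measurable_kern hK).comp (measurable_fst_predictable D.ℱ)).mul (hD.measurable_C u))

/-- Almost surely, the blocks cover all pairs which are active somewhere in the window. -/
lemma ae_sum_blockInd_eq_one_or (hD : D.IsStructured μ W.T)
    (hGcover : ∀ᵐ ω ∂μ, ∀ u, ∑ k, ∑ m, blockInd G k m u ω = ⨆ r : W.window, D.C u r ω) :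
    ∀ᵐ ω ∂μ, ∀ u, ∑ k, ∑ m, blockInd G k m u ω = 1 ∨ ∀ r ∈ W.window, D.C u r ω = 0 := by
  filter_upwards [hGcover] with ω hω u
  by_cases h : ∀ r ∈ W.window, D.C u r ω = 0
  · exact Or.inr h
  · push Not at h
    obtain ⟨r, hr, hC⟩ := h
    have hC1 : D.C u r ω = 1 := (hD.C_mem u r ω).resolve_left hC
    left
    rw [hω u]
    have : Nonempty W.window := ⟨⟨r, hr⟩⟩
    refine le_antisymm (ciSup_le fun s => hD.C_le_one u s ω) ?_
    rw [← hC1]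
    exact le_ciSup (f := fun r : W.window => D.C u r ω)
      ⟨1, by rintro _ ⟨s, rfl⟩; exact hD.C_le_one u s ω⟩ ⟨r, hr⟩

variable [IsProbabilityMeasure μ]

lemma integral_Kh_mul_integral (hD : D.IsStructured μ W.T) (hK : IsHolderKernel W.K Kb)
    (hh : 0 < W.h) (u : Pair κ n) {g : Ω → ℝ} (hg : Measurable g) (hg0 : ∀ ω, 0 ≤ g ω)
    (hg1 : ∀ ω, g ω ≤ 1) :
    ∫ s in (0 : ℝ)..W.T, W.Kh s * ∫ ω, g ω * D.C u s.toNNReal ω ∂μ =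
      ∫ ω, g ω * ∫ s, W.kern s * D.C u s ω ∂lebesgueUpTo W.T ∂μ := by
  have hC : Measurable (Function.uncurry (D.C u)) :=
    (hD.measurable_C u).mono (predictable_le D.ℱ) le_rfl
  have hprod : Measurable fun p : ℝ≥0 × Ω => g p.2 * D.C u p.1 p.2 :=
    (hg.comp measurable_snd).mul hC
  rw [← W.integral_kern_mul hK hh (g := fun s => ∫ ω, g ω * D.C u s ω ∂μ)
    (StronglyMeasurable.integral_prod_right (f := fun s ω => g ω * D.C u s ω)
      hprod.stronglyMeasurable).measurable]
  simp only [← integral_const_mul]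
  rw [integral_integral_swap]
  · refine integral_congr_ae (ae_of_all _ fun ω => integral_congr_ae (ae_of_all _ fun s => ?_))
    simp only; ring
  · refine Integrable.of_bound
      (((W.measurable_kern hK).comp measurable_fst).mul hprod).aestronglyMeasurable (Kb / W.h)
      (ae_of_all _ fun p => ?_)
    have a1 := W.kern_nonneg hK p.1
    have a2 := W.kern_le hK p.1
    have a3 := hD.C_nonneg u p.1 p.2
    have a4 := hD.C_le_one u p.1 p.2
    have a5 := mul_nonneg (hg0 p.2) a3
    have a6 : g p.2 * D.C u p.1 p.2 ≤ 1 := mul_le_one₀ (hg1 p.2) a3 a4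
    have : 0 ≤ W.kern p.1 * (g p.2 * D.C u p.1 p.2) := mul_nonneg a1 a5
    simp only [Function.uncurry]
    rw [Real.norm_of_nonneg this]
    calc W.kern p.1 * (g p.2 * D.C u p.1 p.2) ≤ W.kern p.1 * 1 := by gcongr
      _ ≤ Kb / W.h := by rwa [mul_one]

lemma integrable_mul_integral_kern_C (hD : D.IsStructured μ W.T) (hK : IsHolderKernel W.K Kb)
    (hh : 0 < W.h) (u : Pair κ n) {g : Ω → ℝ} (hg : Measurable g) (hg0 : ∀ ω, 0 ≤ g ω)
    (hg1 : ∀ ω, g ω ≤ 1) :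
    Integrable (fun ω => g ω * ∫ s, W.kern s * D.C u s ω ∂lebesgueUpTo W.T) μ := by
  refine Integrable.of_bound (hg.mul (W.measurable_integral_kern_C hD hK u)).aestronglyMeasurable 1
    (ae_of_all _ fun ω => ?_)
  have a1 := W.integral_kern_C_nonneg hD hK u ω
  rw [Real.norm_of_nonneg (mul_nonneg (hg0 ω) a1)]
  exact mul_le_one₀ (hg1 ω) a1 (W.integral_kern_C_le_one hD hK hh u ω)

lemma Ekm_eq (hD : D.IsStructured μ W.T) (hK : IsHolderKernel W.K Kb) (hh : 0 < W.h)
    (hG : ∀ k m u, MeasurableSet {ω | u ∈ G k m ω}) (k : Fin 𝒦) (m : Fin (numPairs κ n)) :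
    W.Ekm D μ G k m =
      ∫ ω, ∑ u, blockInd G k m u ω * ∫ s, W.kern s * D.C u s ω ∂lebesgueUpTo W.T ∂μ := by
  rw [integral_finsetSum _ fun u _ => W.integrable_mul_integral_kern_C hD hK hh u
    (measurable_blockInd hG k m u) (blockInd_nonneg G k m u) (blockInd_le_one G k m u)]
  exact Finset.sum_congr rfl fun u _ => W.integral_Kh_mul_integral hD hK hh u
    (measurable_blockInd hG k m u) (blockInd_nonneg G k m u) (blockInd_le_one G k m u)

lemma R_eq (hD : D.IsStructured μ W.T) (hK : IsHolderKernel W.K Kb) (hh : 0 < W.h) :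
    W.R D μ = ∫ ω, ∑ u, ∫ s, W.kern s * D.C u s ω ∂lebesgueUpTo W.T ∂μ := by
  have hint : ∀ u, Integrable (fun ω => ∫ s, W.kern s * D.C u s ω ∂lebesgueUpTo W.T) μ := fun u => by
    simpa only [one_mul] using W.integrable_mul_integral_kern_C hD hK hh u (g := fun _ => 1)
      measurable_const (fun _ => zero_le_one) fun _ => le_rfl
  rw [integral_finsetSum _ fun u _ => hint u]
  have h1 : ∀ u, ∫ ω, ∫ s, W.kern s * D.C u s ω ∂lebesgueUpTo W.T ∂μ = W.pbar D μ := fun u => by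
    have := W.integral_Kh_mul_integral hD hK hh u (g := fun _ => 1) (μ := μ)
      measurable_const (fun _ => zero_le_one) fun _ => le_rfl
    simp only [one_mul] at this
    rw [← this, pbar]
    congr 1
    ext s
    rw [hD.edgeProb_eq u]
    congr 1
    have hm : Measurable (D.C u s.toNNReal) :=
      ((hD.measurable_C u).mono (predictable_le D.ℱ) le_rfl).comp measurable_prodMk_left
    rw [← integral_indicator_one (show MeasurableSet {ω | D.C u s.toNNReal ω = 1} from
      hm (measurableSet_singleton 1))]
    refine integral_congr_ae (ae_of_all _ fun ω => ?_)
    rcases hD.C_mem u s.toNNReal ω with h | h <;> simp [indicator, h]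
  rw [Finset.sum_congr rfl fun u _ => h1 u, R, Finset.sum_const, nsmul_eq_mul]
  rfl

/-- A pair active somewhere in the window has indicators summing to one, and any other pair has zero
kernel-weighted activity. Thus nothing is lost in splitting `R` over blocks, and the thresholds for
the types can be chosen proportional to `∑_m E_{k,m}`. -/
lemma sum_Ekm (hD : D.IsStructured μ W.T) (hK : IsHolderKernel W.K Kb) (hh : 0 < W.h)
    (hG : ∀ k m u, MeasurableSet {ω | u ∈ G k m ω})
    (hGcover : ∀ᵐ ω ∂μ, ∀ u, ∑ k, ∑ m, blockInd G k m u ω = ⨆ r : W.window, D.C u r ω) :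
    ∑ k, ∑ m, W.Ekm D μ G k m = W.R D μ := by
  have hint : ∀ k m, Integrable (fun ω => ∑ u, blockInd G k m u ω *
      ∫ s, W.kern s * D.C u s ω ∂lebesgueUpTo W.T) μ := fun k m =>
    integrable_finsetSum _ fun u _ => W.integrable_mul_integral_kern_C hD hK hh u
      (measurable_blockInd hG k m u) (blockInd_nonneg G k m u) (blockInd_le_one G k m u)
  rw [W.R_eq hD hK hh]
  simp only [W.Ekm_eq hD hK hh hG]
  rw [← Finset.sum_congr rfl fun k _ => integral_finsetSum _ fun m _ => hint k m,
    ← integral_finsetSum _ fun k _ => integrable_finsetSum _ fun m _ => hint k m]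
  refine integral_congr_ae ?_
  filter_upwards [W.ae_sum_blockInd_eq_one_or hD hGcover] with ω hω
  have e : ∑ k, ∑ m, ∑ u, blockInd G k m u ω * ∫ s, W.kern s * D.C u s ω ∂lebesgueUpTo W.T =
      ∑ u, (∑ k, ∑ m, blockInd G k m u ω) * ∫ s, W.kern s * D.C u s ω ∂lebesgueUpTo W.T := by
    simp only [Finset.sum_mul]
    rw [Finset.sum_comm' (t' := Finset.univ) (s' := fun _ => Finset.univ) (by simp)]
    rw [Finset.sum_comm]
    simp only [Finset.sum_comm (s := (Finset.univ : Finset (Pair κ n)))]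
  rw [e]
  refine Finset.sum_congr rfl fun u _ => ?_
  rcases hω u with h | h
  · rw [h, one_mul]
  · have : ∫ s, W.kern s * D.C u s ω ∂lebesgueUpTo W.T = 0 := by
      refine (integral_congr_ae ?_).trans (integral_zero _ _)
      filter_upwards [ae_lebesgueUpTo_le W.T] with s hs
      by_cases hk : W.kern s = 0
      · rw [hk, zero_mul]
      · rw [h s (W.mem_window_of_kern_ne_zero hK hh hs.2 hk), mul_zero]
    rw [this, mul_zero]

end Smoothing

end Blocks

end DynNet

/-! ### Bernstein's inequality for the block sums of a network -/

namespace DynNet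

/-- Bernstein's inequality for a `β`-mixing sequence indexed by `Fin r`. -/
theorem measureReal_abs_sum_fin_ge_le {Ω : Type*} [mΩ : MeasurableSpace Ω] {μ : Measure Ω}
    [IsProbabilityMeasure μ] {r : ℕ} {U : Fin r → Ω → ℝ} (hU : ∀ m, Measurable (U m)) {β : ℝ}
    (hβ : ∀ M, betaMixing (⨆ m, ⨆ (_ : m < M), MeasurableSpace.comap (U m) inferInstance)
      (MeasurableSpace.comap (U M) inferInstance) μ ≤ β) {s : Fin r → ℝ} {b y : ℝ}
    (hs : 0 < ∑ m, s m) (hb : 0 < b) (hy : 0 < y)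
    (h : ∀ θ, 0 < |θ| → |θ| * b ≤ 1 / 2 → ∀ m, ∫⁻ ω, ENNReal.ofReal (Real.exp (θ * U m ω)) ∂μ ≤
      ENNReal.ofReal (Real.exp (θ ^ 2 * s m / (2 * (1 - |θ| * b))))) :
    μ.real {ω | y ≤ |∑ m, U m ω|} ≤
      2 * Real.exp (-(y ^ 2 / (2 * (∑ m, s m + b * y)))) + r * β := by
  -- Extension by zero to all of `ℕ`; up to index `r` the generated past σ-algebras coincide.
  set V : ℕ → Ω → ℝ := fun j => if hj : j < r then U ⟨j, hj⟩ else 0 with hV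
  set s' : ℕ → ℝ := fun j => if hj : j < r then s ⟨j, hj⟩ else 0 with hs'
  have hVj : ∀ j (hj : j < r), V j = U ⟨j, hj⟩ := fun j hj => dif_pos hj
  have hsj : ∀ j (hj : j < r), s' j = s ⟨j, hj⟩ := fun j hj => dif_pos hj
  have hVm : ∀ j, Measurable (V j) := fun j => by
    by_cases hj : j < r
    · rw [hVj j hj]; exact hU _
    · simp only [hV, dif_neg hj]; exact measurable_const
  have e1 : ∑ j ∈ Finset.range r, s' j = ∑ m, s m := by
    rw [Finset.sum_range]
    exact Finset.sum_congr rfl fun m _ => hsj m m.2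
  have e2 : ∀ ω, ∑ j ∈ Finset.range r, V j ω = ∑ m, U m ω := fun ω => by
    rw [Finset.sum_range]
    exact Finset.sum_congr rfl fun m _ => congrFun (hVj m m.2) ω
  have := measureReal_abs_sum_ge_le (μ := μ) hVm (β := β) (r := r) (s := s') (b := b) (y := y)
    (fun j hj => ?_) (by rwa [e1]) hb hy fun θ h0 h1 j hj => by
      rw [hVj j hj, hsj j hj]; exact h θ h0 h1 _
  · simpa only [e1, e2] using this
  · refine le_trans (le_of_eq ?_) (hβ ⟨j, hj⟩)
    rw [hVj j hj]
    congr 1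
    refine le_antisymm (iSup₂_le fun i hi => ?_) (iSup₂_le fun m hm => ?_)
    · rw [hVj i (hi.trans hj)]
      exact le_iSup₂_of_le (f := fun m (_ : m < (⟨j, hj⟩ : Fin r)) =>
        MeasurableSpace.comap (U m) inferInstance) ⟨i, hi.trans hj⟩ hi le_rfl
    · rw [← hVj m m.2]
      exact le_iSup₂_of_le (f := fun i (_ : i < j) =>
        MeasurableSpace.comap (V i) inferInstance) (m : ℕ) hm le_rfl

section BlockSums

variable {κ : NetworkKind} {n q 𝒦 : ℕ} {Ω : Type*} [mΩ : MeasurableSpace Ω] {D : Network κ n q Ω}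
  {μ : Measure Ω} {Λ Kb Khat : ℝ} {G : Blocks κ n 𝒦 Ω}

lemma betaMixing_le_networkBeta (G : Blocks κ n 𝒦 Ω) (Z : Pair κ n → Ω → ℝ) (k : Fin 𝒦)
    (M : Fin (numPairs κ n)) :
    betaMixing (⨆ m, ⨆ (_ : m < M), MeasurableSpace.comap (blockSum μ G Z k m) inferInstance)
      (MeasurableSpace.comap (blockSum μ G Z k M) inferInstance) μ ≤ networkBeta μ G Z :=
  (le_ciSup (f := fun M => betaMixing (⨆ m, ⨆ (_ : m < M),
    MeasurableSpace.comap (blockSum μ G Z k m) inferInstance)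
      (MeasurableSpace.comap (blockSum μ G Z k M) inferInstance) μ)
    (Set.finite_range _).bddAbove M).trans
  (le_ciSup (f := fun k => ⨆ M, betaMixing (⨆ m, ⨆ (_ : m < M),
    MeasurableSpace.comap (blockSum μ G Z k m) inferInstance)
      (MeasurableSpace.comap (blockSum μ G Z k M) inferInstance) μ)
    (Set.finite_range _).bddAbove k)

lemma networkBeta_nonneg [IsProbabilityMeasure μ] (G : Blocks κ n 𝒦 Ω) (Z : Pair κ n → Ω → ℝ) :
    0 ≤ networkBeta μ G Z :=
  Real.iSup_nonneg fun _ => Real.iSup_nonneg fun _ => betaMixing_nonneg _ _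

namespace Smoothing

variable (W : Smoothing) {c₃ : ℝ} {φ : Pair κ n → ℝ≥0 → Ω → ℝ}

lemma networkBeta_le_beta {d : ℕ} (φ : Pair κ n → ℝ≥0 → Ω → EuclideanSpace ℝ (Fin d)) (i : Fin d) :
    networkBeta μ G (fun u => (W.goodEvent D μ G c₃).indicator
      (W.smoothInt D (fun u s ω => φ u s ω i) u)) ≤ W.beta D μ G c₃ φ :=
  le_ciSup (f := fun i : Fin d => networkBeta μ G fun u => (W.goodEvent D μ G c₃).indicator
      (W.smoothInt D (fun u s ω => φ u s ω i) u)) (Set.finite_range _).bddAbove i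

lemma beta_nonneg [IsProbabilityMeasure μ] {d : ℕ}
    (φ : Pair κ n → ℝ≥0 → Ω → EuclideanSpace ℝ (Fin d)) :
    0 ≤ W.beta D μ G c₃ φ := Real.iSup_nonneg fun _ => networkBeta_nonneg _ _

lemma measurable_weight (hG : ∀ k m u, MeasurableSet[D.ℱ W.left] {ω | u ∈ G k m ω})
    (k : Fin 𝒦) (m : Fin (numPairs κ n)) (u : Pair κ n) :
    Measurable[D.ℱ W.left] ((W.goodEvent D μ G c₃).indicator (blockInd G k m u)) :=
  (measurable_blockInd hG k m u).indicator (W.measurableSet_goodEvent hG c₃)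

lemma weight_nonneg (k : Fin 𝒦) (m : Fin (numPairs κ n)) (u : Pair κ n) (ω : Ω) :
    0 ≤ (W.goodEvent D μ G c₃).indicator (blockInd G k m u) ω :=
  indicator_nonneg (fun _ _ => blockInd_nonneg G k m u _) _

lemma weight_le_blockInd (k : Fin 𝒦) (m : Fin (numPairs κ n)) (u : Pair κ n) (ω : Ω) :
    (W.goodEvent D μ G c₃).indicator (blockInd G k m u) ω ≤ blockInd G k m u ω :=
  indicator_le_self' (fun _ _ => blockInd_nonneg G k m u _) _

lemma measurable_weight_mul (hK : IsHolderKernel W.K Kb)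
    (hG : ∀ k m u, MeasurableSet[D.ℱ W.left] {ω | u ∈ G k m ω})
    (hφ : ∀ u, Measurable[D.ℱ.predictable] (Function.uncurry (φ u)))
    (k : Fin 𝒦) (m : Fin (numPairs κ n)) (u : Pair κ n) :
    Measurable[D.ℱ.predictable] (Function.uncurry fun s ω =>
      (W.goodEvent D μ G c₃).indicator (blockInd G k m u) ω *
        (W.kern s * clamp Khat (φ u s ω))) := by
  have e : (Function.uncurry fun s ω => (W.goodEvent D μ G c₃).indicator (blockInd G k m u) ω *
        (W.kern s * clamp Khat (φ u s ω))) = fun p : ℝ≥0 × Ω =>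
      (Ioi W.left).indicator
        (fun _ => (W.goodEvent D μ G c₃).indicator (blockInd G k m u) p.2) p.1 *
        (W.kern p.1 * clamp Khat (φ u p.1 p.2)) := by
    ext ⟨s, ω⟩
    by_cases hs : W.left < s
    · simp [hs]
    · simp [hs, W.kern_eq_zero (not_lt.1 hs)]
  rw [e]
  exact (measurable_indicator_Ioi_predictable (W.measurable_weight hG k m u)).mul
    (((W.measurable_kern hK).comp (measurable_fst_predictable D.ℱ)).mul
      ((measurable_clamp Khat).comp (hφ u)))

lemma ae_indicator_smoothInt_mul_eq (hD : D.IsStructured μ W.T) (hh : 0 < W.h)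
    (hK : IsHolderKernel W.K Kb)
    (hlam : ∀ᵐ ω ∂μ, ∀ u, ∀ t ≤ W.T, D.intensity u t ω ≤ Λ)
    (hφ : ∀ u, Measurable[D.ℱ.predictable] (Function.uncurry (φ u)))
    (hφb : ∀ᵐ ω ∂μ, ∀ u, ∀ t ≤ W.T, |φ u t ω| ≤ Khat) (k : Fin 𝒦) (m : Fin (numPairs κ n)) :
    ∀ᵐ ω ∂μ, ∀ u, (W.goodEvent D μ G c₃).indicator (W.smoothInt D φ u) ω * blockInd G k m u ω =
      compInt W.T (D.N u) (fun t ω => min (D.intensity u t ω) Λ)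
        (fun s ω => (W.goodEvent D μ G c₃).indicator (blockInd G k m u) ω *
          (W.kern s * clamp Khat (φ u s ω))) ω := by
  filter_upwards [W.ae_smoothInt_eq_compInt hD hh hK hlam hφ hφb] with ω hω u
  rw [compInt_mul, ← hω u]
  by_cases h : ω ∈ W.goodEvent D μ G c₃
  · rw [indicator_of_mem h, indicator_of_mem h, mul_comm]
  · rw [indicator_of_notMem h, indicator_of_notMem h, zero_mul, zero_mul]

/-- Each `Γ Z_u I_u` is almost surely the compensated integral of a bounded predictable integrand,
because `Γ I_u` is known before the kernel starts. Its mean is zero and the centring disappears. -/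
lemma blockSum_eq [IsProbabilityMeasure μ] (hD : D.IsStructured μ W.T) (hh : 0 < W.h)
    (hK : IsHolderKernel W.K Kb)
    (hΛ : 0 < Λ) (hKhat : 0 ≤ Khat)
    (hG : ∀ k m u, MeasurableSet[D.ℱ W.left] {ω | u ∈ G k m ω})
    (hlam : ∀ᵐ ω ∂μ, ∀ u, ∀ t ≤ W.T, D.intensity u t ω ≤ Λ)
    (hφ : ∀ u, Measurable[D.ℱ.predictable] (Function.uncurry (φ u)))
    (hφb : ∀ᵐ ω ∂μ, ∀ u, ∀ t ≤ W.T, |φ u t ω| ≤ Khat) (k : Fin 𝒦) (m : Fin (numPairs κ n))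
    (ω : Ω) :
    blockSum μ G (fun u => (W.goodEvent D μ G c₃).indicator (W.smoothInt D φ u)) k m ω =
      ∑ u, (W.goodEvent D μ G c₃).indicator (W.smoothInt D φ u) ω * blockInd G k m u ω := by
  refine Finset.sum_congr rfl fun u _ => ?_
  rw [integral_congr_ae ((W.ae_indicator_smoothInt_mul_eq hD hh hK hlam hφ hφb k m).mono
    fun ω h => h u), (hD.hasIntensity hΛ hlam u).integral_compInt
      (W.measurable_weight_mul hK hG hφ k m u) (C := Kb / W.h * Khat), sub_zero]
  intro s ω
  have a1 := W.weight_nonneg (D := D) (μ := μ) (c₃ := c₃) (G := G) k m u ω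
  have a2 := (W.weight_le_blockInd (D := D) (μ := μ) (c₃ := c₃) (G := G) k m u ω).trans
    (blockInd_le_one G k m u ω)
  have a3 := W.kern_nonneg hK s
  have a4 := W.kern_le hK s
  have a5 := abs_clamp_le hKhat (φ u s ω)
  have a6 := a3.trans a4
  rw [abs_mul, abs_mul, abs_of_nonneg a1, abs_of_nonneg a3]
  calc _ ≤ 1 * (Kb / W.h * Khat) := by gcongr
    _ = Kb / W.h * Khat := one_mul _

lemma measurable_blockSum [IsProbabilityMeasure μ] (hD : D.IsStructured μ W.T)
    (hK : IsHolderKernel W.K Kb) (hΛ : 0 < Λ)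
    (hG : ∀ k m u, MeasurableSet[D.ℱ W.left] {ω | u ∈ G k m ω})
    (hlam : ∀ᵐ ω ∂μ, ∀ u, ∀ t ≤ W.T, D.intensity u t ω ≤ Λ)
    (hφ : ∀ u, Measurable[D.ℱ.predictable] (Function.uncurry (φ u)))
    (k : Fin 𝒦) (m : Fin (numPairs κ n)) :
    Measurable (blockSum μ G (fun u => (W.goodEvent D μ G c₃).indicator (W.smoothInt D φ u)) k m) :=
  Finset.measurable_fun_sum _ fun u _ =>
    (((W.measurable_smoothInt hD hK hΛ hlam hφ u).indicator
      (D.ℱ.le _ _ (W.measurableSet_goodEvent hG c₃))).mul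
      (measurable_blockInd (fun k m u => D.ℱ.le _ _ (hG k m u)) k m u)).sub_const _

lemma S_le_of_mem_goodEvent (hR : 1 < W.R D μ) (hc₃ : 0 < c₃) {ω : Ω}
    (hω : ω ∈ W.goodEvent D μ G c₃) (k : Fin 𝒦) :
    S G k ω ≤ c₃ * √(W.R D μ / Real.log (W.R D μ)) := by
  have hl : 0 < Real.log (W.R D μ) := Real.log_pos hR
  have hR0 : 0 < W.R D μ := by linarith
  have h := (hω k).1
  rw [div_le_iff₀ hR0] at h
  refine le_of_sq_le_sq ?_ (by positivity)
  rw [mul_pow, Real.sq_sqrt (by positivity), ← mul_div_assoc, le_div_iff₀ hl]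
  exact h

/-- The moment generating function of a centred block sum. -/
lemma lintegral_exp_blockSum_le [IsProbabilityMeasure μ] {A τ θ : ℝ} (hD : D.IsStructured μ W.T)
    (hh : 0 < W.h)
    (hh1 : W.h ≤ 1) (hK : IsHolderKernel W.K Kb) (hΛ : 0 < Λ) (hKhat : 0 < Khat) (hA : 0 < A)
    (hA1 : max (max √Khat Khat) (max (1 / Kb) √((2 : ℝ) ^ (3 / 2 : ℝ) * √Λ * (Khat / Kb))) ≤ A)
    (hA2 : 1 / A * Real.exp (√2 / (A * √Λ)) ≤ 1)
    (hG : ∀ k m u, MeasurableSet[D.ℱ W.left] {ω | u ∈ G k m ω})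
    (hlam : ∀ᵐ ω ∂μ, ∀ u, ∀ t ≤ W.T, D.intensity u t ω ≤ Λ)
    (hφ : ∀ u, Measurable[D.ℱ.predictable] (Function.uncurry (φ u)))
    (hφb : ∀ᵐ ω ∂μ, ∀ u, ∀ t ≤ W.T, |φ u t ω| ≤ Khat) {B : ℝ} (hB : 1 ≤ B * √(W.h : ℝ))
    (hSB : ∀ ω ∈ W.goodEvent D μ G c₃, ∀ k, S G k ω ≤ B)
    (hτ0 : 0 < τ) (hτ : τ ≤ 1 / 2)
    (hθ : |θ| * (√(Λ / (2 * W.h)) * Kb * Khat * A * B) = τ) (k : Fin 𝒦)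
    (m : Fin (numPairs κ n)) :
    ∫⁻ ω, ENNReal.ofReal (Real.exp (θ * blockSum μ G
      (fun u => (W.goodEvent D μ G c₃).indicator (W.smoothInt D φ u)) k m ω)) ∂μ ≤
      ENNReal.ofReal (Real.exp
        (θ ^ 2 * (1 / W.h * Λ * A ^ 2 * Kb * Khat * W.Ekm D μ G k m) / (2 * (1 - τ)))) := by
  have hB0 : 0 < B := pos_of_mul_pos_left (by linarith) (Real.sqrt_nonneg (W.h : ℝ))
  have hG' : ∀ k m u, MeasurableSet {ω | u ∈ G k m ω} := fun k m u => D.ℱ.le _ _ (hG k m u)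
  have e : ∫⁻ ω, ENNReal.ofReal (Real.exp (θ * blockSum μ G
      (fun u => (W.goodEvent D μ G c₃).indicator (W.smoothInt D φ u)) k m ω)) ∂μ =
      ∫⁻ ω, ENNReal.ofReal (Real.exp (θ * ∑ u, compInt W.T (D.N u)
        (fun t ω => min (D.intensity u t ω) Λ) (fun s ω =>
          (W.goodEvent D μ G c₃).indicator (blockInd G k m u) ω *
          (W.kern s * clamp Khat (φ u s ω))) ω)) ∂μ := by
    refine lintegral_congr_ae ?_
    filter_upwards [W.ae_indicator_smoothInt_mul_eq hD hh hK hlam hφ hφb (c₃ := c₃) (G := G) k m]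
      with ω hω
    rw [W.blockSum_eq hD hh hK hΛ hKhat.le hG hlam hφ hφb, Finset.sum_congr rfl fun u _ => hω u]
  rw [e]
  refine lintegral_exp_compInt_le (T := W.T) (N := D.N)
    (lam := fun u t ω => min (D.intensity u t ω) Λ) (C := D.C)
    (φ := fun u s ω => clamp Khat (φ u s ω))
    (hD.hasIntensity hΛ hlam) hD.no_common_jumps hK.half_le hKhat hΛ
    (show (0 : ℝ) < W.h from hh) (show (W.h : ℝ) ≤ 1 from hh1) hA hA1 hA2 hB hτ0 hτ hθ
    (W.measurable_kern hK) (W.kern_nonneg hK) (W.kern_le hK) (fun s hs => W.kern_eq_zero hs)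
    (W.measurable_weight hG k m) (W.weight_nonneg k m)
    (fun u ω => (W.weight_le_blockInd k m u ω).trans (blockInd_le_one G k m u ω))
    (fun u => (measurable_clamp Khat).comp (hφ u)) (fun u s ω => abs_clamp_le hKhat.le _)
    hD.measurable_C hD.C_nonneg hD.C_le_one (fun u s ω => ?_) (ae_of_all _ fun ω => ?_) ?_
  · rcases hD.C_mem u s ω with h | h
    · simp [Network.intensity, h, hΛ.le]
    · rw [h, mul_one]; exact min_le_right _ _
  -- On `Γ` the active mass of a block is at most its size, hence at most `B`; off `Γ` all weights
  -- vanish.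
  · by_cases hω : ω ∈ W.goodEvent D μ G c₃
    · refine le_trans (Finset.sum_le_sum fun u _ => ?_)
        ((sum_blockInd_le_S G k m ω).trans (hSB ω hω k))
      rw [indicator_of_mem hω]
      exact mul_le_of_le_one_right (blockInd_nonneg G k m u ω)
        (W.integral_kern_C_le_one hD hK hh u ω)
    · simp [indicator_of_notMem hω, hB0.le]
  · rw [W.Ekm_eq hD hK hh hG']
    refine integral_mono (integrable_finsetSum _ fun u _ =>
      W.integrable_mul_integral_kern_C hD hK hh u
        ((W.measurable_weight hG k m u).mono (D.ℱ.le _) le_rfl) (W.weight_nonneg k m u)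
        fun ω => (W.weight_le_blockInd k m u ω).trans (blockInd_le_one G k m u ω))
      (integrable_finsetSum _ fun u _ => W.integrable_mul_integral_kern_C hD hK hh u
        (measurable_blockInd hG' k m u) (blockInd_nonneg G k m u) (blockInd_le_one G k m u))
      fun ω => Finset.sum_le_sum fun u _ => ?_
    exact mul_le_mul_of_nonneg_right (W.weight_le_blockInd k m u ω)
      (W.integral_kern_C_nonneg hD hK u ω)

/-- The sum of the smoothed integrals splits into its block sums. -/
lemma ae_sum_smoothInt_eq [IsProbabilityMeasure μ] (hD : D.IsStructured μ W.T) (hh : 0 < W.h)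
    (hK : IsHolderKernel W.K Kb)
    (hΛ : 0 < Λ) (hKhat : 0 ≤ Khat)
    (hG : ∀ k m u, MeasurableSet[D.ℱ W.left] {ω | u ∈ G k m ω})
    (hGcover : ∀ᵐ ω ∂μ, ∀ u, ∑ k, ∑ m, blockInd G k m u ω = ⨆ r : W.window, D.C u r ω)
    (hlam : ∀ᵐ ω ∂μ, ∀ u, ∀ t ≤ W.T, D.intensity u t ω ≤ Λ)
    (hφ : ∀ u, Measurable[D.ℱ.predictable] (Function.uncurry (φ u)))
    (hφb : ∀ᵐ ω ∂μ, ∀ u, ∀ t ≤ W.T, |φ u t ω| ≤ Khat) :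
    ∀ᵐ ω ∂μ, ω ∈ W.goodEvent D μ G c₃ → ∑ u, W.smoothInt D φ u ω =
      ∑ k, ∑ m, blockSum μ G
        (fun u => (W.goodEvent D μ G c₃).indicator (W.smoothInt D φ u)) k m ω := by
  filter_upwards [W.ae_sum_blockInd_eq_one_or hD hGcover,
    W.ae_smoothInt_eq_zero hD hh hK hΛ hlam hφ hφb] with ω h1 h2 hω
  simp only [W.blockSum_eq hD hh hK hΛ hKhat hG hlam hφ hφb, indicator_of_mem hω]
  have e : ∑ k, ∑ m, ∑ u, W.smoothInt D φ u ω * blockInd G k m u ω =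
      ∑ u, W.smoothInt D φ u ω * (∑ k, ∑ m, blockInd G k m u ω) := by
    simp only [Finset.mul_sum]
    rw [Finset.sum_comm (s := (Finset.univ : Finset (Pair κ n)))]
    exact Finset.sum_congr rfl fun k _ => Finset.sum_comm
  rw [e]
  refine Finset.sum_congr rfl fun u _ => ?_
  rcases h1 u with h | h
  · rw [h, mul_one]
  · rw [h2 u h, zero_mul]

end Smoothing

end BlockSums

end DynNet

namespace DynNet

/-! ### The exponential inequality -/

section Final

variable {κ : NetworkKind} {n q 𝒦 : ℕ} {Ω : Type*} [mΩ : MeasurableSpace Ω] {D : Network κ n q Ω}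
  {μ : Measure Ω} [IsProbabilityMeasure μ] {Λ Kb Khat : ℝ} {G : Blocks κ n 𝒦 Ω}

namespace Smoothing

variable (W : Smoothing) {c₂ c₃ A : ℝ}

/-- The tail bound for the sum of the blocks of one type. -/
lemma measureReal_sum_blockSum_ge_le {φ : Pair κ n → ℝ≥0 → Ω → ℝ} (hD : D.IsStructured μ W.T)
    (hh : 0 < W.h) (hh1 : W.h ≤ 1) (hK : IsHolderKernel W.K Kb) (hΛ : 0 < Λ) (hKhat : 0 < Khat)
    (hA : 0 < A)
    (hA1 : max (max √Khat Khat) (max (1 / Kb) √((2 : ℝ) ^ (3 / 2 : ℝ) * √Λ * (Khat / Kb))) ≤ A)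
    (hA2 : 1 / A * Real.exp (√2 / (A * √Λ)) ≤ 1)
    (hG : ∀ k m u, MeasurableSet[D.ℱ W.left] {ω | u ∈ G k m ω})
    (hlam : ∀ᵐ ω ∂μ, ∀ u, ∀ t ≤ W.T, D.intensity u t ω ≤ Λ)
    (hφ : ∀ u, Measurable[D.ℱ.predictable] (Function.uncurry (φ u)))
    (hφb : ∀ᵐ ω ∂μ, ∀ u, ∀ t ≤ W.T, |φ u t ω| ≤ Khat) (hR : 1 < W.R D μ)
    (hc₂ : 0 < c₂) (hc₃ : 0 < c₃) (hne : (W.goodEvent D μ G c₃).Nonempty) (k : Fin 𝒦)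
    (hE : c₂ ≤ 1 / W.R D μ * ∑ m, W.Ekm D μ G k m) {x : ℝ} (hx : 0 < x) :
    μ.real {ω | x * √(Real.log (W.R D μ) / W.R D μ) * ∑ m, W.Ekm D μ G k m ≤ |∑ m, blockSum μ G
      (fun u => (W.goodEvent D μ G c₃).indicator (W.smoothInt D φ u)) k m ω|} ≤
      2 * W.R D μ ^ (-(c₂ * x ^ 2 / (2 * (1 / W.h * Λ * A ^ 2 * Kb * Khat +
        √(Λ / (2 * W.h)) * Kb * Khat * A * c₃ * x)))) + numPairs κ n *
      networkBeta μ G (fun u => (W.goodEvent D μ G c₃).indicator (W.smoothInt D φ u)) := by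
  set R := W.R D μ
  have hR0 : 0 < R := by linarith
  have hl : 0 < Real.log R := Real.log_pos hR
  have hKb : 0 < Kb := by linarith [hK.half_le]
  have hh' : (0 : ℝ) < W.h := hh
  set V := ∑ m, W.Ekm D μ G k m
  -- `B` bounds the block sizes on `Γ` and satisfies `B * L = c₃`, which is how `c₃` enters the
  -- exponent.
  set B := c₃ * √(R / Real.log R) with hB
  set L := √(Real.log R / R) with hL
  set c₁ := √(Λ / (2 * W.h)) * Kb * Khat * A with hc₁
  set σ := 1 / W.h * Λ * A ^ 2 * Kb * Khat with hσ
  have hV : c₂ * R ≤ V := by rwa [one_div, inv_mul_eq_div, le_div_iff₀ hR0] at hE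
  have hV0 : 0 < V := lt_of_lt_of_le (by positivity) hV
  have hσ0 : 0 < σ := by positivity
  have hc₁0 : 0 < c₁ := by positivity
  have hB0 : 0 < B := by positivity
  have hL0 : 0 < L := by positivity
  have hBL : B * L = c₃ := by
    rw [hB, hL, mul_assoc, ← Real.sqrt_mul (by positivity)]
    have : R / Real.log R * (Real.log R / R) = 1 := by field_simp
    rw [this, Real.sqrt_one, mul_one]
  have hL2 : L ^ 2 = Real.log R / R := Real.sq_sqrt (by positivity)
  have hSB : ∀ ω ∈ W.goodEvent D μ G c₃, ∀ k, S G k ω ≤ B := fun ω hω k =>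
    W.S_le_of_mem_goodEvent hR hc₃ hω k
  -- This deterministic inequality is read off from a single outcome in `Γ`; hence the nonemptiness
  -- assumption.
  have hB1 : 1 ≤ B * √(W.h : ℝ) := by
    obtain ⟨ω, hω⟩ := hne
    exact (hω k).2.trans (mul_le_mul_of_nonneg_right (hSB ω hω k) (Real.sqrt_nonneg _))
  have hs : ∑ m, σ * W.Ekm D μ G k m = σ * V := by rw [← Finset.mul_sum]
  have key := measureReal_abs_sum_fin_ge_le (μ := μ)
    (U := blockSum μ G (fun u => (W.goodEvent D μ G c₃).indicator (W.smoothInt D φ u)) k)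
    (W.measurable_blockSum hD hK hΛ hG hlam hφ k)
    (betaMixing_le_networkBeta G _ k) (s := fun m => σ * W.Ekm D μ G k m) (b := c₁ * B)
    (y := x * L * V) (by rw [hs]; positivity) (by positivity) (by positivity)
    fun θ h0 h1 m => W.lintegral_exp_blockSum_le hD hh hh1 hK hΛ hKhat hA hA1 hA2 hG hlam hφ hφb
      hB1 hSB (by positivity) h1 rfl k m
  refine key.trans ?_
  gcongr
  rw [hs, Real.rpow_def_of_pos hR0, Real.exp_le_exp, mul_neg, neg_le_neg_iff]
  -- With `b = c₁ B` and `y = x L V` the denominator is proportional to `V` and the numerator to `V²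
  -- log R / R`, leaving `log R` times `V / R ≥ c₂`.
  have e1 : σ * V + c₁ * B * (x * L * V) = V * (σ + c₁ * c₃ * x) := by
    rw [← hBL]; ring
  have e2 : (x * L * V) ^ 2 / (2 * (V * (σ + c₁ * c₃ * x))) =
      Real.log R * (V / R * x ^ 2 / (2 * (σ + c₁ * c₃ * x))) := by
    rw [mul_pow, mul_pow, hL2]; field_simp
  rw [e1, e2]
  have : c₂ ≤ V / R := by rwa [le_div_iff₀ hR0]
  gcongr

/-- If the norm is large on `Γ`, some coordinate of the sum reaches `x L R`, and for it some type
`k` reaches its share `y k`. The union bound over `d 𝒦` such events gives the three terms. -/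
theorem expInequality_of_predictable (hD : D.IsStructured μ W.T)
    (hh : 0 < W.h) (hh1 : W.h ≤ 1) (hK : IsHolderKernel W.K Kb) (hΛ : 0 < Λ)
    (hlam : ∀ᵐ ω ∂μ, ∀ u, ∀ t ≤ W.T, D.intensity u t ω ≤ Λ) (hA : 0 < A)
    (hA1 : max (max √Khat Khat) (max (1 / Kb) √((2 : ℝ) ^ (3 / 2 : ℝ) * √Λ * (Khat / Kb))) ≤ A)
    (hA2 : 1 / A * Real.exp (√2 / (A * √Λ)) ≤ 1)
    (hG : ∀ k m u, MeasurableSet[D.ℱ W.left] {ω | u ∈ G k m ω})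
    (hGcover : ∀ᵐ ω ∂μ, ∀ u, ∑ k, ∑ m, blockInd G k m u ω = ⨆ r : W.window, D.C u r ω)
    (hR : 1 < W.R D μ) (hc₂ : 0 < c₂) (hc₃ : 0 < c₃)
    (hE : ∀ k, c₂ ≤ 1 / W.R D μ * ∑ m, W.Ekm D μ G k m) {d : ℕ} (hd : 0 < d)
    {φ : Pair κ n → ℝ≥0 → Ω → EuclideanSpace ℝ (Fin d)}
    (hφ : ∀ u, IsStronglyPredictable D.ℱ (φ u))
    (hφb : ∀ᵐ ω ∂μ, ∀ u, ∀ t ≤ W.T, ∀ i, |φ u t ω i| ≤ Khat) :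
    W.ExpInequality D μ G (1 / W.h * Λ * A ^ 2 * Kb * Khat) (√(Λ / (2 * W.h)) * Kb * Khat * A)
      c₂ c₃ φ := by
  intro cs hcs x hx
  have hR0 : 0 < W.R D μ := by linarith
  have hG' : ∀ k m u, MeasurableSet {ω | u ∈ G k m ω} := fun k m u => D.ℱ.le _ _ (hG k m u)
  have hsum := W.sum_Ekm hD hK hh hG' hGcover
  have hd1 : (1 : ℝ) ≤ d := by exact_mod_cast hd
  have hβ0 := W.beta_nonneg (D := D) (μ := μ) (G := G) (c₃ := c₃) φ
  have h𝒦 : 0 < 𝒦 := by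
    rcases Nat.eq_zero_or_pos 𝒦 with rfl | h
    · simp only [Finset.univ_eq_empty, Finset.sum_empty] at hsum
      linarith
    · exact h
  have h𝒦1 : (1 : ℝ) ≤ 𝒦 := by exact_mod_cast h𝒦
  have hKhat0 : 0 ≤ Khat := by
    obtain ⟨u⟩ : Nonempty (Pair κ n) := by
      by_contra hempty
      have : numPairs κ n = 0 := Fintype.card_eq_zero_iff.2 (not_nonempty_iff.1 hempty)
      rw [R, this, Nat.cast_zero, zero_mul] at hR
      linarith
    obtain ⟨ω, hω⟩ := hφb.exists
    exact (abs_nonneg _).trans (hω u 0 zero_le ⟨0, hd⟩)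
  set P := W.R D μ ^ (-(c₂ * x ^ 2 / (2 * (1 / W.h * Λ * A ^ 2 * Kb * Khat +
    √(Λ / (2 * W.h)) * Kb * Khat * A * c₃ * x)))) with hP
  have hP0 : 0 < P := Real.rpow_pos_of_pos hR0 _
  set Γ := W.goodEvent D μ G c₃ with hΓ
  set β := W.beta D μ G c₃ φ with hβ
  have hΓ0 : 0 ≤ μ.real Γᶜ := measureReal_nonneg
  -- For `Khat = 0` the denominator of the exponent is zero; division by zero gives `P = 1` and a
  -- trivial bound.
  rcases hKhat0.eq_or_lt with hKz | hKhat
  · have hP1 : P = 1 := by simp [hP, ← hKz]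
    rw [hP1]
    refine measureReal_le_one.trans ?_
    have : (1 : ℝ) ≤ 2 * d * 𝒦 * 1 := by nlinarith
    have : 0 ≤ 2 * d * β * (𝒦 * numPairs κ n) := by positivity
    have : 0 ≤ 2 * d * μ.real Γᶜ := by positivity
    linarith
  -- If `Γ` is empty, the term `2 d P(Γ = 0)` alone exceeds one.
  rcases Γ.eq_empty_or_nonempty with hem | hne
  · refine measureReal_le_one.trans ?_
    rw [hem, compl_empty, probReal_univ]
    have : 0 ≤ 2 * d * 𝒦 * P := by positivity
    have : 0 ≤ 2 * d * β * (𝒦 * numPairs κ n) := by positivity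
    linarith
  -- Testing the norm comparison on a unit coordinate vector excludes `cs ≤ 0`; here `d > 0` is
  -- needed.
  have hcs0 : 0 < cs := by
    by_contra! h
    have h1 := hcs (EuclideanSpace.single ⟨0, hd⟩ 1)
    rw [PiLp.norm_single, norm_one] at h1
    have h2 : 0 ≤ ∑ i, |(EuclideanSpace.single (⟨0, hd⟩ : Fin d) (1 : ℝ)) i| :=
      Finset.sum_nonneg fun i _ => abs_nonneg _
    nlinarith
  set L := √(Real.log (W.R D μ) / W.R D μ) with hL
  set Z : Fin d → Pair κ n → Ω → ℝ := fun i u =>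
    Γ.indicator (W.smoothInt D (fun u s ω => φ u s ω i) u) with hZ
  have hφi : ∀ i u, Measurable[D.ℱ.predictable] (Function.uncurry fun s ω => φ u s ω i) :=
    fun i u => (EuclideanSpace.proj i : EuclideanSpace ℝ (Fin d) →L[ℝ] ℝ).continuous.measurable.comp
      (hφ u).measurable
  have hφbi : ∀ i, ∀ᵐ ω ∂μ, ∀ u, ∀ t ≤ W.T, |φ u t ω i| ≤ Khat := fun i =>
    hφb.mono fun ω h u t ht => h u t ht i
  set y : Fin 𝒦 → ℝ := fun k => x * L * ∑ m, W.Ekm D μ G k m with hy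
  have hysum : ∑ k, y k = x * L * W.R D μ := by rw [← hsum, Finset.mul_sum]
  set Ev : Fin d → Fin 𝒦 → Set Ω := fun i k => {ω | y k ≤ |∑ m, blockSum μ G (Z i) k m ω|} with hEv
  -- Argued by contraposition: if every type stays below its threshold, each coordinate is below `x
  -- L R`, so the `1`-norm is below `d x L R` and the norm below `cs` times that.
  have hsub : {ω | x * d * cs * L ≤ 1 / W.R D μ * ‖∑ u, W.smoothInt D φ u ω‖} ≤ᵐ[μ]
      (Γᶜ ∪ ⋃ i, ⋃ k, Ev i k : Set Ω) := by
    have hsplit : ∀ᵐ ω ∂μ, ∀ i, ω ∈ Γ → ∑ u, W.smoothInt D (fun u s ω => φ u s ω i) u ω =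
        ∑ k, ∑ m, blockSum μ G (Z i) k m ω := by
      rw [ae_all_iff]
      exact fun i => W.ae_sum_smoothInt_eq hD hh hK hΛ hKhat0 hG hGcover hlam (hφi i) (hφbi i)
    filter_upwards [hsplit, W.ae_smoothInt_apply hD hK hlam hφ hφb] with ω h1 h2 hω
    have hω : x * d * cs * L ≤ 1 / W.R D μ * ‖∑ u, W.smoothInt D φ u ω‖ := hω
    by_cases hωΓ : ω ∈ Γ
    swap
    · exact Or.inl hωΓ
    refine Or.inr ?_
    by_contra hnot
    simp only [mem_iUnion, not_exists, hEv, mem_ofPred_eq, not_le] at hnot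
    have h3 : ∀ i, |(∑ u, W.smoothInt D φ u ω) i| < x * L * W.R D μ := fun i => by
      have : (∑ u, W.smoothInt D φ u ω) i = ∑ k, ∑ m, blockSum μ G (Z i) k m ω := by
        rw [← h1 i hωΓ, WithLp.ofLp_sum, Finset.sum_apply]
        exact Finset.sum_congr rfl fun u _ => h2 u i
      rw [this, ← hysum]
      refine (Finset.abs_sum_le_sum_abs _ _).trans_lt ?_
      exact Finset.sum_lt_sum_of_nonempty ⟨⟨0, h𝒦⟩, Finset.mem_univ _⟩ fun k _ => hnot i k
    have h4 : ∑ i, |(∑ u, W.smoothInt D φ u ω) i| < d * (x * L * W.R D μ) := by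
      refine (Finset.sum_lt_sum_of_nonempty ⟨⟨0, hd⟩, Finset.mem_univ _⟩ fun i _ => h3 i).trans_le
        (le_of_eq ?_)
      simp
    have h5 := hcs (∑ u, W.smoothInt D φ u ω)
    rw [one_div, inv_mul_eq_div, le_div_iff₀ hR0] at hω
    nlinarith [mul_lt_mul_of_pos_left h4 hcs0]
  have hEvle : ∀ i k, μ.real (Ev i k) ≤ 2 * P + numPairs κ n * β := fun i k => by
    refine (W.measureReal_sum_blockSum_ge_le hD hh hh1 hK hΛ hKhat hA hA1 hA2 hG hlam (hφi i)
      (hφbi i) hR hc₂ hc₃ hne k (hE k) hx).trans ?_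
    gcongr
    exact W.networkBeta_le_beta φ i
  calc μ.real {ω | x * d * cs * L ≤ 1 / W.R D μ * ‖∑ u, W.smoothInt D φ u ω‖}
      ≤ μ.real (Γᶜ ∪ ⋃ i, ⋃ k, Ev i k) :=
        ENNReal.toReal_mono (measure_ne_top _ _) (measure_mono_ae hsub)
    _ ≤ μ.real Γᶜ + ∑ i, ∑ k, μ.real (Ev i k) :=
        (measureReal_union_le _ _).trans (add_le_add le_rfl
          ((measureReal_iUnion_fintype_le _).trans
            (Finset.sum_le_sum fun i _ => measureReal_iUnion_fintype_le _)))
    _ ≤ μ.real Γᶜ + ∑ _i : Fin d, ∑ _k : Fin 𝒦, (2 * P + numPairs κ n * β) := by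
        gcongr with i _ k _
        exact hEvle i k
    _ = μ.real Γᶜ + d * (𝒦 * (2 * P + numPairs κ n * β)) := by
        simp only [Finset.sum_const, Finset.card_univ, Fintype.card_fin, nsmul_eq_mul]
    _ ≤ 2 * d * 𝒦 * P + 2 * d * β * (𝒦 * numPairs κ n) + 2 * d * μ.real Γᶜ := by
        have h1 : 0 ≤ d * β * (𝒦 * numPairs κ n) := by positivity
        have h2 : μ.real Γᶜ ≤ 2 * d * μ.real Γᶜ := le_mul_of_one_le_left hΓ0 (by linarith)
        linarith

end Smoothing

end Final

end DynNet
end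

theorem mainTheorem5 {κ : DynNet.NetworkKind} {n q 𝒦 : ℕ} (hq : 0 < q)
    {Ω : Type*} [MeasurableSpace Ω] (μ : Measure Ω) [IsProbabilityMeasure μ]
    (D : DynNet.Network κ n q Ω) (W : DynNet.Smoothing)
    (hD : D.IsStructured μ W.T)
    (ht₀ : W.t₀ ≤ W.T) (hh : 0 < W.h) (hh1 : W.h ≤ 1)
    (Kb Khat Λ A : ℝ) (hK : DynNet.IsHolderKernel W.K Kb)
    (hX : ∀ᵐ ω ∂μ, ∀ u, ∀ t ≤ W.T, ∀ i, |D.X u t ω i| ≤ Khat)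
    (hΛ : 0 < Λ) (hlam : ∀ᵐ ω ∂μ, ∀ u, ∀ t ≤ W.T, D.intensity u t ω ≤ Λ)
    (hA : 0 < A)
    (hA1 : max (max √Khat Khat) (max (1 / Kb) √((2 : ℝ) ^ (3 / 2 : ℝ) * √Λ * (Khat / Kb))) ≤ A)
    (hA2 : 1 / A * Real.exp (√2 / (A * √Λ)) ≤ 1)
    (Δ : ℝ) (hΔ : 0 < Δ) (G : DynNet.Blocks κ n 𝒦 Ω)
    (hG : ∀ᵐ ω ∂μ, DynNet.IsDeltaPartition D W.left Δ G ω)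
    (hGmeas : ∀ k m u, MeasurableSet[D.ℱ W.left] {ω | u ∈ G k m ω})
    (hGcover : ∀ᵐ ω ∂μ, ∀ u,
      ∑ k, ∑ m, DynNet.blockInd G k m u ω = ⨆ r : W.window, D.C u r ω)
    (hR : 1 < W.R D μ)
    (c₂ c₃ : ℝ) (hc₂ : 0 < c₂) (hc₃ : 0 < c₃)
    (hE : ∀ k, c₂ ≤ 1 / W.R D μ * ∑ m, W.Ekm D μ G k m) :
    W.ExpInequality D μ G (1 / W.h * Λ * A ^ 2 * Kb * Khat) (√(Λ / (2 * W.h)) * Kb * Khat * A)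
        c₂ c₃ D.X ∧
      ∀ (d : ℕ), 0 < d → ∀ φ : DynNet.Pair κ n → ℝ≥0 → Ω → EuclideanSpace ℝ (Fin d),
        (∀ u, IsStronglyPredictable D.ℱ (φ u)) →
        (∀ᵐ ω ∂μ, ∀ u, ∀ t ≤ W.T, ∀ i, |φ u t ω i| ≤ Khat) →
        W.ExpInequality D μ G (1 / W.h * Λ * A ^ 2 * Kb * Khat)
          (√(Λ / (2 * W.h)) * Kb * Khat * A) c₂ c₃ φ :=
  ⟨W.expInequality_of_predictable hD hh hh1 hK hΛ hlam hA hA1 hA2 hGmeas hGcover hR hc₂ hc₃ hE hq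
      hD.X_predictable hX,
    fun _ hd _ hφ hφb => W.expInequality_of_predictable hD hh hh1 hK hΛ hlam hA hA1 hA2 hGmeas
      hGcover hR hc₂ hc₃ hE hd hφ hφb⟩
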